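/- Work over $\mathbb{C}$ and let $G=\mathbb{G}_m=\mathbb{C}^*$. All $A_\infty$-algebras $A$ (operations $\mu_A^d\colon A^{\otimes d}\to A[2-d]$, $d\ge 1$) and right $A_\infty$-modules $M$ over $A$ (operations $\mu_M^{d+1}\colon M\otimes A^{\otimes d}\to M[1-d]$, $d\ge 0$) are $\mathbb{Z}$-graded and strictly unital. A representation of $G$ is rational if it is a direct sum of finite-dimensional algebraic representations, equivalently if it comes from a comodule over $\mathbb{C}[G]=\mathbb{C}[z,z^{-1}]$. A rational $G$-action on $A$ is a rational action on the underlying graded vector space (preserving degrees) for which all $\mu_A^d$ are equivariant. Given such an action, a naive $G$-action on an $A$-module $M$ is a rational action on the underlying graded vector space (preserving degrees) for which all $\mu_M^{d+1}$ are equivariant. Let $A^{\mathit{mod}}$ be the dg category of right $A_\infty$-modules over $A$: an element of $\mathit{hom}^k_{A^{\mathit{mod}}}(M_0,M_1)$ is a sequence of linear maps $\phi^{d+1}\colon M_0\otimes A^{\otimes d}\to M_1[k-d]$, $d\ge 0$, and a module homomorphism is a closed element of degree $0$; it is a quasi-isomorphism if the map $H(M_0)\to H(M_1)$ induced by $m\mapsto(-1)^{|m|}\phi^1(m)$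 is an isomorphism. A module is perfect if, in $H^0(A^{\mathit{mod}})$, it is isomorphic to a direct summand of a module constructed from the free module $A$ by a finite sequence of shifts and mapping cones. A module $M$ is rigid and simple if $H^1(\mathit{hom}_{A^{\mathit{mod}}}(M,M))=0$ and $H^0(\mathit{hom}_{A^{\mathit{mod}}}(M,M))\cong\mathbb{C}$. **Theorem.** Let $A$ be an $A_\infty$-algebra with a rational $G$-action, such that $H(A)$ is finite-dimensional in each degree and bounded below ($H^n(A)=0$ for all sufficiently negative $n$). Let $M$ be a perfect $A_\infty$-module over $A$ which is rigid and simple. Then there is an $A_\infty$-module $M'$ over $A$ which carries a naive $G$-action, together with a quasi-isomorphism $M\to M'$. -/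

import Mathlib

open Finset

set_option linter.unusedSectionVars false

universe u

namespace AInf

/-! ### Tuples of inputs

The inputs `a_d, …, a_1` of an operation are encoded as a sequence `a : ℕ → V`, in which `a k`
stands for `a_{k+1}`; only the entries `a 0, …, a (d - 1)` matter. -/

section Tuples

variable {V W X : Type*} [AddCommGroup V] [Module ℂ V] [AddCommGroup W] [Module ℂ W]
  [AddCommGroup X] [Module ℂ X]

/-- The block `(a_{i+n}, …, a_{i+1})` of consecutive inputs. -/
def block (i n : ℕ) (a : ℕ → V) : Fin n → V := fun k => a (i + k)

/-- The inputs `(…, a_{i+j+1}, x, a_i, …, a_1)`, where `x` replaces `a_{i+j}, …, a_{i+1}`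
(for `1 ≤ j`). -/
def splice (i j : ℕ) (x : V) (a : ℕ → V) : ℕ → V :=
  fun k => if k < i then a k else if k = i then x else a (k + j - 1)

/-- Apply `s` to the inputs `a_i, …, a_1`. -/
def mapLow (s : V →ₗ[ℂ] V) (i : ℕ) (a : ℕ → V) : ℕ → V :=
  fun k => if k < i then s (a k) else a k

/-- Apply `s` to all inputs except `a_i, …, a_1`. -/
def mapHigh (s : V →ₗ[ℂ] V) (i : ℕ) (a : ℕ → V) : ℕ → V :=
  fun k => if i ≤ k then s (a k) else a k

/-- Extend a finite tuple to a sequence. -/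
def pad {d : ℕ} (a : Fin d → V) : ℕ → V := fun k => if h : k < d then a ⟨k, h⟩ else 0

theorem block_pad {d : ℕ} (a : Fin d → V) : block 0 d (pad a) = a := by
  funext k; simp [block, pad]

theorem pad_update {d : ℕ} (a : Fin d → V) (p : Fin d) (x : V) :
    pad (Function.update a p x) = Function.update (pad a) p x := by
  funext k
  by_cases hk : k = p
  · subst hk; simp [pad]
  · by_cases h : k < d
    · have : (⟨k, h⟩ : Fin d) ≠ p := fun e => hk (by rw [← e])
      simp [pad, h, hk, this]
    · simp [pad, h, hk]

theorem block_congr {i n : ℕ} {a b : ℕ → V} (h : ∀ k, k < n → a (i + k) = b (i + k)) :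
    block i n a = block i n b := by
  funext k; exact h k k.2

theorem block_update_mem {i n p : ℕ} (a : ℕ → V) (x : V) (h : i ≤ p) (h' : p < i + n) :
    block i n (Function.update a p x)
      = Function.update (block i n a) ⟨p - i, by omega⟩ x := by
  funext k
  by_cases hk : k = ⟨p - i, by omega⟩
  · subst hk
    have : i + (p - i) = p := by omega
    simp [block, this]
  · have : i + (k : ℕ) ≠ p := fun e => hk (Fin.ext (by simp; omega))
    simp [block, hk, this]

theorem block_update_notMem {i n p : ℕ} (a : ℕ → V) (x : V) (h : p < i ∨ i + n ≤ p) :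
    block i n (Function.update a p x) = block i n a := by
  refine block_congr fun k hk => ?_
  rw [Function.update_of_ne (by omega)]

theorem mapHigh_update_of_le (s : V →ₗ[ℂ] V) {i p : ℕ} (a : ℕ → V) (x : V) (h : i ≤ p) :
    mapHigh s i (Function.update a p x) = Function.update (mapHigh s i a) p (s x) := by
  funext k
  by_cases hk : k = p
  · subst hk; simp [mapHigh, h]
  · simp [mapHigh, hk]

theorem mapHigh_update_of_lt (s : V →ₗ[ℂ] V) {i p : ℕ} (a : ℕ → V) (x : V) (h : p < i) :
    mapHigh s i (Function.update a p x) = Function.update (mapHigh s i a) p x := by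
  funext k
  by_cases hk : k = p
  · subst hk; simp [mapHigh, h]
  · simp [mapHigh, hk]

theorem splice_eq_update (i j : ℕ) (y : V) (a : ℕ → V) :
    splice i j y a = Function.update (splice i j 0 a) i y := by
  funext k
  by_cases hk : k = i
  · subst hk; simp [splice]
  · simp [splice, hk]

theorem splice_update_lt {i j p : ℕ} (y : V) (a : ℕ → V) (x : V) (hj : 1 ≤ j) (h : p < i) :
    splice i j y (Function.update a p x) = Function.update (splice i j y a) p x := by
  funext k
  simp only [splice, Function.update_apply]
  split_ifs <;> first | rfl | (exfalso; omega)

theorem splice_update_mid {i j p : ℕ} (y : V) (a : ℕ → V) (x : V) (h : i ≤ p)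
    (h' : p < i + j) :
    splice i j y (Function.update a p x) = splice i j y a := by
  funext k
  simp only [splice, Function.update_apply]
  split_ifs <;> first | rfl | (exfalso; omega)

theorem splice_update_ge {i j p : ℕ} (y : V) (a : ℕ → V) (x : V) (hj : 1 ≤ j)
    (h : i + j ≤ p) :
    splice i j y (Function.update a p x) = Function.update (splice i j y a) (p + 1 - j) x := by
  funext k
  simp only [splice, Function.update_apply]
  split_ifs <;> first | rfl | (exfalso; omega)

/-- Linearity of a function of a sequence in each of its first `d` entries. -/
def MultilinOn (d : ℕ) (F : (ℕ → V) → W) : Prop :=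
  ∀ p < d, ∀ a : ℕ → V, IsLinearMap ℂ fun x => F (Function.update a p x)

theorem MultilinOn.sum {ι : Type*} {d : ℕ} (s : Finset ι) {F : ι → (ℕ → V) → W}
    (h : ∀ i ∈ s, MultilinOn d (F i)) : MultilinOn d fun a => ∑ i ∈ s, F i a := by
  intro p hp a
  constructor
  · intro x y
    rw [← Finset.sum_add_distrib]
    exact Finset.sum_congr rfl fun i hi => (h i hi p hp a).map_add x y
  · intro c x
    rw [Finset.smul_sum]
    exact Finset.sum_congr rfl fun i hi => (h i hi p hp a).map_smul c x

theorem MultilinOn.add {d : ℕ} {F F' : (ℕ → V) → W} (h : MultilinOn d F)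
    (h' : MultilinOn d F') : MultilinOn d fun a => F a + F' a := by
  intro p hp a
  constructor
  · intro x y
    simp only [(h p hp a).map_add x y, (h' p hp a).map_add x y]
    abel
  · intro c x
    simp only [(h p hp a).map_smul c x, (h' p hp a).map_smul c x, smul_add]

/-- The multilinear map in `d` variables given by a function of sequences. -/
def ofSeq {d : ℕ} (F : (ℕ → V) → W) (h : MultilinOn d F) :
    MultilinearMap ℂ (fun _ : Fin d => V) W where
  toFun a := F (pad a)
  map_update_add' := by
    intro inst a p x y
    rw [Subsingleton.elim inst (instDecidableEqFin d)]
    simp only [pad_update]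
    exact (h p p.2 _).map_add x y
  map_update_smul' := by
    intro inst a p c x
    rw [Subsingleton.elim inst (instDecidableEqFin d)]
    simp only [pad_update]
    exact (h p p.2 _).map_smul c x

theorem multilinOn_nest (s : V →ₗ[ℂ] V) {d i : ℕ} (hi : i ≤ d)
    (P : W →ₗ[ℂ] MultilinearMap ℂ (fun _ : Fin i => V) X)
    (Q : MultilinearMap ℂ (fun _ : Fin (d - i) => V) W) :
    MultilinOn d fun a => P (Q (block i (d - i) (mapHigh s i a))) (block 0 i a) := by
  intro p hp a
  rcases le_or_gt i p with h | h
  · have e : ∀ x, P (Q (block i (d - i) (mapHigh s i (Function.update a p x))))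
          (block 0 i (Function.update a p x))
        = P (Q (Function.update (block i (d - i) (mapHigh s i a)) ⟨p - i, by omega⟩ (s x)))
          (block 0 i a) := by
      intro x
      rw [mapHigh_update_of_le s a _ h, block_update_mem _ _ h (by omega),
        block_update_notMem _ _ (by omega)]
    simp only [e]
    constructor <;> intros <;> simp
  · have e : ∀ x, P (Q (block i (d - i) (mapHigh s i (Function.update a p x))))
          (block 0 i (Function.update a p x))
        = P (Q (block i (d - i) (mapHigh s i a)))
          (Function.update (block 0 i a) ⟨p - 0, by omega⟩ x) := by
      intro x
      rw [mapHigh_update_of_lt s a _ h, block_update_notMem (i := i) _ _ (by omega),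
        block_update_mem _ _ (Nat.zero_le _) (by omega)]
    simp only [e]
    constructor <;> intros <;> simp

theorem multilinOn_splice (s : V →ₗ[ℂ] V) {d i j : ℕ} (hj : 1 ≤ j) (hij : i + j ≤ d)
    (P : MultilinearMap ℂ (fun _ : Fin (d + 1 - j) => V) X)
    (Q : MultilinearMap ℂ (fun _ : Fin j => V) V) :
    MultilinOn d fun a =>
      P (block 0 (d + 1 - j) (splice i j (Q (block i j (mapHigh s i a))) (mapHigh s i a))) := by
  have key : ∀ (q : ℕ) (b : ℕ → V), q < d + 1 - j →
      IsLinearMap ℂ fun x => P (block 0 (d + 1 - j) (Function.update b q x)) := by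
    intro q b hq
    constructor
    · intro x y
      rw [block_update_mem _ _ (Nat.zero_le _) (by omega),
        block_update_mem _ _ (Nat.zero_le _) (by omega),
        block_update_mem _ _ (Nat.zero_le _) (by omega)]
      simp
    · intro c x
      rw [block_update_mem _ _ (Nat.zero_le _) (by omega),
        block_update_mem _ _ (Nat.zero_le _) (by omega)]
      simp
  intro p hp a
  rcases lt_or_ge p i with h | h
  · have e : ∀ x, splice i j (Q (block i j (mapHigh s i (Function.update a p x))))
          (mapHigh s i (Function.update a p x))
        = Function.update (splice i j (Q (block i j (mapHigh s i a))) (mapHigh s i a)) p x := by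
      intro x
      rw [mapHigh_update_of_lt s a _ h, block_update_notMem _ _ (by omega),
        splice_update_lt _ _ _ hj h]
    simp only [e]
    exact key p _ (by omega)
  rcases lt_or_ge p (i + j) with h' | h'
  · have e : ∀ x, splice i j (Q (block i j (mapHigh s i (Function.update a p x))))
          (mapHigh s i (Function.update a p x))
        = Function.update (splice i j 0 (mapHigh s i a)) i
          (Q (Function.update (block i j (mapHigh s i a)) ⟨p - i, by omega⟩ (s x))) := by
      intro x
      rw [mapHigh_update_of_le s a _ h, block_update_mem _ _ h h',
        splice_update_mid _ _ _ h h', splice_eq_update]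
    simp only [e]
    constructor
    · intro x y
      rw [map_add, Q.map_update_add]
      exact (key i _ (by omega)).map_add _ _
    · intro c x
      rw [map_smul, Q.map_update_smul]
      exact (key i _ (by omega)).map_smul _ _
  · have e : ∀ x, splice i j (Q (block i j (mapHigh s i (Function.update a p x))))
          (mapHigh s i (Function.update a p x))
        = Function.update (splice i j (Q (block i j (mapHigh s i a))) (mapHigh s i a))
          (p + 1 - j) (s x) := by
      intro x
      rw [mapHigh_update_of_le s a _ h, block_update_notMem _ _ (by omega),
        splice_update_ge _ _ _ hj h']
    simp only [e]
    constructor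
    · intro x y
      rw [map_add]
      exact (key _ _ (by omega)).map_add _ _
    · intro c x
      rw [map_smul]
      exact (key _ _ (by omega)).map_smul _ _

end Tuples

/-! ### Graded spaces and cohomology -/

/-- The degree `n` cohomology of an endomorphism `D` of degree one, with respect to the
subspaces `F n` of elements of degree `n`. -/
abbrev Coh {V : Type*} [AddCommGroup V] [Module ℂ V] (F : ℤ → Submodule ℂ V) (D : V →ₗ[ℂ] V)
    (n : ℤ) : Type _ :=
  ↥(F n ⊓ LinearMap.ker D) ⧸ ((F (n - 1)).map D).submoduleOf (F n ⊓ LinearMap.ker D)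

/-- A `ℤ`-graded complex vector space `V = ⨁ n, deg n`. -/
structure GradedSpace where
  V : Type u
  [addCommGroup : AddCommGroup V]
  [module : Module ℂ V]
  deg : ℤ → Submodule ℂ V
  internal : DirectSum.IsInternal deg

attribute [instance] GradedSpace.addCommGroup GradedSpace.module

/-- The linear map `v ↦ (-1)^|v| v`. -/
noncomputable def GradedSpace.sgn (X : GradedSpace.{u}) : X.V →ₗ[ℂ] X.V :=
  (DirectSum.toModule ℂ ℤ X.V fun n => (-1 : ℂ) ^ n • (X.deg n).subtype) ∘ₗ
    (LinearEquiv.ofBijective (DirectSum.coeLinearMap X.deg) X.internal).symm.toLinearMap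

/-- The linear map `v ↦ (-1)^(|v| - 1) v`. -/
noncomputable def GradedSpace.rsgn (X : GradedSpace.{u}) : X.V →ₗ[ℂ] X.V := -X.sgn

theorem GradedSpace.sgn_apply (X : GradedSpace.{u}) {n : ℤ} {v : X.V} (hv : v ∈ X.deg n) :
    X.sgn v = (-1 : ℂ) ^ n • v := by
  have : (LinearEquiv.ofBijective (DirectSum.coeLinearMap X.deg) X.internal).symm v
      = DirectSum.lof ℂ ℤ (fun n => X.deg n) n ⟨v, hv⟩ := by
    rw [LinearEquiv.symm_apply_eq]
    exact (DirectSum.coeLinearMap_lof X.deg n ⟨v, hv⟩).symm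
  simp [GradedSpace.sgn, this]

theorem GradedSpace.sgn_mem (X : GradedSpace.{u}) {n : ℤ} {v : X.V} (hv : v ∈ X.deg n) :
    X.sgn v ∈ X.deg n := by
  rw [X.sgn_apply hv]; exact Submodule.smul_mem _ _ hv

theorem GradedSpace.induction (X : GradedSpace.{u}) {P : X.V → Prop} (v : X.V)
    (h : ∀ n, ∀ v ∈ X.deg n, P v) (hadd : ∀ v w, P v → P w → P (v + w)) : P v := by
  have hv : v ∈ ⨆ n, X.deg n := by
    rw [X.internal.submodule_iSup_eq_top]; trivial
  exact Submodule.iSup_induction X.deg (motive := P) hv h (h 0 0 (zero_mem _)) hadd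

theorem GradedSpace.sgn_sgn (X : GradedSpace.{u}) (v : X.V) : X.sgn (X.sgn v) = v := by
  induction v using X.induction with
  | h n v hv =>
    rw [X.sgn_apply hv, map_smul, X.sgn_apply hv, smul_smul, ← mul_zpow]
    simp
  | hadd v w hv hw => rw [map_add, map_add, hv, hw]

theorem GradedSpace.rsgn_rsgn (X : GradedSpace.{u}) (v : X.V) : X.rsgn (X.rsgn v) = v := by
  simp [GradedSpace.rsgn, X.sgn_sgn]

/-- The shift `X[k]`, with `X[k]^n = X^(n+k)`. -/
abbrev GradedSpace.shift (X : GradedSpace.{u}) (k : ℤ) : GradedSpace.{u} where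
  V := X.V
  deg n := X.deg (n + k)
  internal := by
    have h := X.internal
    rw [DirectSum.isInternal_submodule_iff_iSupIndep_and_iSup_eq_top] at h ⊢
    refine ⟨h.1.comp (add_left_injective k), ?_⟩
    rw [← h.2]
    exact (Equiv.addRight k).iSup_comp (g := X.deg)

/-- The direct sum of two graded spaces. -/
abbrev GradedSpace.prod (X Y : GradedSpace.{u}) : GradedSpace.{u} where
  V := X.V × Y.V
  deg n := (X.deg n).prod (Y.deg n)
  internal := by
    have hX := X.internal
    have hY := Y.internal
    rw [DirectSum.isInternal_submodule_iff_iSupIndep_and_iSup_eq_top] at hX hY ⊢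
    constructor
    · intro n
      rw [Submodule.disjoint_def]
      rintro ⟨x, y⟩ hxy hs
      have h1 := Submodule.mem_map_of_mem (f := LinearMap.fst ℂ X.V Y.V) hs
      have h2 := Submodule.mem_map_of_mem (f := LinearMap.snd ℂ X.V Y.V) hs
      simp only [Submodule.map_iSup, Submodule.prod_map_fst, Submodule.prod_map_snd] at h1 h2
      have hx := Submodule.disjoint_def.1 (hX.1 n) x hxy.1 h1
      have hy := Submodule.disjoint_def.1 (hY.1 n) y hxy.2 h2
      rw [hx, hy]; rfl
    · rw [eq_top_iff]
      rintro ⟨x, y⟩ -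
      have h1 : (LinearMap.inl ℂ X.V Y.V) x ∈ ⨆ n, (X.deg n).prod (Y.deg n) := by
        have : x ∈ ⨆ n, X.deg n := by rw [hX.2]; trivial
        have := Submodule.mem_map_of_mem (f := LinearMap.inl ℂ X.V Y.V) this
        rw [Submodule.map_iSup] at this
        refine (iSup_mono fun n => ?_ : _ ≤ ⨆ n, (X.deg n).prod (Y.deg n)) this
        rintro _ ⟨x, hx, rfl⟩
        exact ⟨hx, zero_mem _⟩
      have h2 : (LinearMap.inr ℂ X.V Y.V) y ∈ ⨆ n, (X.deg n).prod (Y.deg n) := by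
        have : y ∈ ⨆ n, Y.deg n := by rw [hY.2]; trivial
        have := Submodule.mem_map_of_mem (f := LinearMap.inr ℂ X.V Y.V) this
        rw [Submodule.map_iSup] at this
        refine (iSup_mono fun n => ?_ : _ ≤ ⨆ n, (X.deg n).prod (Y.deg n)) this
        rintro _ ⟨x, hx, rfl⟩
        exact ⟨zero_mem _, hx⟩
      have := add_mem h1 h2
      simpa using this

/-! ### A∞-algebras -/

/-- A strictly unital `A∞`-algebra over `ℂ`, with operations `μ^d : A^{⊗d} → A[2-d]`, `d ≥ 1`,
written `mu d ![a_1, …, a_d] = μ^d(a_d, …, a_1)`.  The relations are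
`∑ (-1)^(|a_1|+⋯+|a_i|-i) μ^{d+1-j}(a_d, …, μ^j(a_{i+j}, …, a_{i+1}), a_i, …, a_1) = 0`;
the sign is produced by applying `rsgn` to each of `a_i, …, a_1`. -/
structure AInfAlgebra extends GradedSpace.{u} where
  mu : (d : ℕ) → MultilinearMap ℂ (fun _ : Fin d => V) V
  mu_zero : mu 0 = 0
  mu_deg : ∀ (d : ℕ) (a : Fin d → V) (n : Fin d → ℤ), (∀ k, a k ∈ deg (n k)) →
    mu d a ∈ deg (∑ k, n k + 2 - d)
  relation : ∀ (d : ℕ) (a : ℕ → V),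
    ∑ i ∈ range d, ∑ j ∈ Icc 1 (d - i),
      mu (d + 1 - j) (block 0 (d + 1 - j)
        (splice i j (mu j (block i j a)) (mapLow toGradedSpace.rsgn i a))) = 0
  /-- The strict unit. -/
  e : V
  e_deg : e ∈ deg 0
  /-- `μ²(x, e) = x`. -/
  mu_two_right : ∀ x, mu 2 ![e, x] = x
  /-- `μ²(e, x) = (-1)^|x| x`. -/
  mu_two_left : ∀ x, mu 2 ![x, e] = toGradedSpace.sgn x
  mu_unit : ∀ d, d ≠ 2 → ∀ a : Fin d → V, (∃ k, a k = e) → mu d a = 0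

/-- The differential `μ^1_A`. -/
def AInfAlgebra.mu1 (A : AInfAlgebra.{u}) : A.V →ₗ[ℂ] A.V :=
  (A.mu 1).toLinearMap (fun _ => 0) 0

/-- The graded pieces `H^n(A)` of the cohomology. -/
abbrev AInfAlgebra.H (A : AInfAlgebra.{u}) (n : ℤ) : Type u := Coh A.deg A.mu1 n

/-! ### A∞-modules -/

/-- A right `A∞`-module over `A`, with operations `μ^{d+1} : M ⊗ A^{⊗d} → M[1-d]`, `d ≥ 0`,
written `mu d m ![a_1, …, a_d] = μ^{d+1}(m, a_d, …, a_1)`.  The relations are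
`∑ (-1)^(|a_1|+⋯+|a_i|-i) μ_M^{d+2-j}(m, a_d, …, μ_A^j(a_{i+j}, …, a_{i+1}), a_i, …, a_1)`
`+ ∑ (-1)^(|a_1|+⋯+|a_i|-i) μ_M^{i+1}(μ_M^{d+1-i}(m, a_d, …, a_{i+1}), a_i, …, a_1) = 0`.
Unitality is the separate predicate `StrictlyUnital`. -/
structure AInfModule (A : AInfAlgebra.{u}) extends GradedSpace.{u} where
  mu : (d : ℕ) → V →ₗ[ℂ] MultilinearMap ℂ (fun _ : Fin d => A.V) V
  mu_deg : ∀ (d : ℕ) (m : V) (p : ℤ) (a : Fin d → A.V) (n : Fin d → ℤ), m ∈ deg p →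
    (∀ k, a k ∈ A.deg (n k)) → mu d m a ∈ deg (p + ∑ k, n k + 1 - d)
  relation : ∀ (d : ℕ) (m : V) (a : ℕ → A.V),
    ∑ i ∈ range d, ∑ j ∈ Icc 1 (d - i),
      mu (d + 1 - j) m (block 0 (d + 1 - j)
        (splice i j (A.mu j (block i j a)) (mapLow A.rsgn i a)))
    + ∑ i ∈ range (d + 1),
      mu i (mu (d - i) m (block i (d - i) a)) (block 0 i (mapLow A.rsgn i a)) = 0

namespace AInfModule

variable {A : AInfAlgebra.{u}}

/-- `μ²(m, e) = m`, and all other `μ^{d+1}(m, …, e, …)` vanish. -/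
structure StrictlyUnital (M : AInfModule A) : Prop where
  mu_one : ∀ m, M.mu 1 m ![A.e] = m
  mu_unit : ∀ d, d ≠ 1 → ∀ (m : M.V) (a : Fin d → A.V), (∃ k, a k = A.e) → M.mu d m a = 0

/-- The differential `μ^1_M`. -/
def mu1 (M : AInfModule A) : M.V →ₗ[ℂ] M.V where
  toFun m := M.mu 0 m ![]
  map_add' := by simp
  map_smul' := by simp

/-- The graded pieces `H^n(M)` of the cohomology. -/
abbrev H (M : AInfModule A) (n : ℤ) : Type u := Coh M.deg M.mu1 n

/-! ### Morphism complexes -/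

/-- Sequences of maps `φ^{d+1} : M ⊗ A^{⊗d} → N`, `d ≥ 0`, with
`φ d m ![a_1, …, a_d] = φ^{d+1}(m, a_d, …, a_1)`. -/
abbrev PreHom (M N : AInfModule A) : Type u :=
  (d : ℕ) → M.V →ₗ[ℂ] MultilinearMap ℂ (fun _ : Fin d => A.V) N.V

/-- The space `hom^k(M, N)`: all `φ^{d+1}` have degree `k - d`. -/
def hom (M N : AInfModule A) (k : ℤ) : Submodule ℂ (PreHom M N) where
  carrier := {φ | ∀ (d : ℕ) (m : M.V) (p : ℤ) (a : Fin d → A.V) (n : Fin d → ℤ), m ∈ M.deg p →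
    (∀ k, a k ∈ A.deg (n k)) → φ d m a ∈ N.deg (p + ∑ k, n k + k - d)}
  add_mem' := fun h h' d m p a n hm ha => add_mem (h d m p a n hm ha) (h' d m p a n hm ha)
  zero_mem' := fun _ _ _ _ _ _ _ => zero_mem _
  smul_mem' := fun c _ h d m p a n hm ha => Submodule.smul_mem _ c (h d m p a n hm ha)

/-- The value of the differential of `hom(M, N)`, as a function of a sequence of inputs.
Each of the three sums carries the sign `(-1)^(|a_{i+1}|+⋯+|a_d|+|m|+d-i)`, which is produced by
applying `sgn` to `m` and `rsgn` to each of `a_d, …, a_{i+1}`: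
`∑ ± μ_N^{i+1}(φ^{d+1-i}(m, a_d, …, a_{i+1}), a_i, …, a_1)`
`+ ∑ ± φ^{i+1}(μ_M^{d+1-i}(m, a_d, …, a_{i+1}), a_i, …, a_1)`
`+ ∑ ± φ^{d+2-j}(m, a_d, …, μ_A^j(a_{i+j}, …, a_{i+1}), a_i, …, a_1)`. -/
noncomputable def diffFun (M N : AInfModule A) (φ : PreHom M N) (d : ℕ) (m : M.V)
    (a : ℕ → A.V) : N.V :=
  ∑ i ∈ range (d + 1),
    N.mu i (φ (d - i) (M.sgn m) (block i (d - i) (mapHigh A.rsgn i a))) (block 0 i a)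
  + ∑ i ∈ range (d + 1),
    φ i (M.mu (d - i) (M.sgn m) (block i (d - i) (mapHigh A.rsgn i a))) (block 0 i a)
  + ∑ i ∈ range d, ∑ j ∈ Icc 1 (d - i),
    φ (d + 1 - j) (M.sgn m) (block 0 (d + 1 - j)
      (splice i j (A.mu j (block i j (mapHigh A.rsgn i a))) (mapHigh A.rsgn i a)))

theorem diffFun_multilin (M N : AInfModule A) (φ : PreHom M N) (d : ℕ) (m : M.V) :
    MultilinOn d (M.diffFun N φ d m) := by
  refine MultilinOn.add (MultilinOn.add ?_ ?_) ?_
  · refine MultilinOn.sum _ fun i hi => ?_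
    exact multilinOn_nest _ (Nat.lt_succ_iff.1 (mem_range.1 hi)) _ _
  · refine MultilinOn.sum _ fun i hi => ?_
    exact multilinOn_nest _ (Nat.lt_succ_iff.1 (mem_range.1 hi)) _ _
  · refine MultilinOn.sum _ fun i hi => MultilinOn.sum _ fun j hj => ?_
    have hi := mem_range.1 hi
    have hj := mem_Icc.1 hj
    exact multilinOn_splice _ hj.1 (by omega) _ _

/-- The differential `μ^1` of the morphism complex `hom(M, N)`. -/
noncomputable def diff (M N : AInfModule A) : PreHom M N →ₗ[ℂ] PreHom M N where
  toFun φ d :=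
    { toFun := fun m => ofSeq (M.diffFun N φ d m) (M.diffFun_multilin N φ d m)
      map_add' := by
        intro m m'
        ext a
        simp [ofSeq, diffFun, Finset.sum_add_distrib]
        abel
      map_smul' := by
        intro c m
        ext a
        simp [ofSeq, diffFun, Finset.smul_sum] }
  map_add' := by
    intro φ ψ
    funext d
    ext m a
    simp [ofSeq, diffFun, Finset.sum_add_distrib]
    abel
  map_smul' := by
    intro c φ
    funext d
    ext m a
    simp [ofSeq, diffFun, Finset.smul_sum]

/-- The graded pieces `H^k(hom(M, N))` of the cohomology of the morphism complex. -/
abbrev HomH (M N : AInfModule A) (k : ℤ) : Type u := Coh (M.hom N) (M.diff N) k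

/-- Module homomorphisms: closed elements of `hom^0(M, N)`. -/
abbrev Closed (M N : AInfModule A) : Type u := ↥(M.hom N 0 ⊓ LinearMap.ker (M.diff N))

/-- The composition `μ²(ψ, φ)` in the category of modules, with components
`∑ (-1)^(|a_{i+1}|+⋯+|a_d|+|m|+d-i) ψ^{i+1}(φ^{d+1-i}(m, a_d, …, a_{i+1}), a_i, …, a_1)`. -/
noncomputable def comp {M N P : AInfModule A} (ψ : PreHom N P) (φ : PreHom M N) :
    PreHom M P := fun d =>
  { toFun := fun m => ofSeq
      (fun a => ∑ i ∈ range (d + 1),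
        ψ i (φ (d - i) (M.sgn m) (block i (d - i) (mapHigh A.rsgn i a))) (block 0 i a))
      (MultilinOn.sum _ fun _ hi =>
        multilinOn_nest _ (Nat.lt_succ_iff.1 (mem_range.1 hi)) _ _)
    map_add' := by
      intro m m'
      ext a
      simp [ofSeq, Finset.sum_add_distrib]
    map_smul' := by
      intro c m
      ext a
      simp [ofSeq, Finset.smul_sum] }

/-- The identity morphism: `id^1(m) = (-1)^|m| m`, and `id^{d+1} = 0` for `d > 0`. -/
noncomputable def idHom (M : AInfModule A) : PreHom M M
  | 0 =>
    { toFun := fun m => MultilinearMap.constOfIsEmpty ℂ _ (M.sgn m)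
      map_add' := by intro m m'; ext a; simp
      map_smul' := by intro c m; ext a; simp }
  | _ + 1 => 0

/-! ### Quasi-isomorphisms -/

/-- The map `m ↦ (-1)^|m| f^1(m)`, which is a chain map if `f` is a module homomorphism. -/
noncomputable def linearPart {M N : AInfModule A} (f : PreHom M N) : M.V →ₗ[ℂ] N.V where
  toFun m := f 0 (M.sgn m) ![]
  map_add' := by simp
  map_smul' := by simp

theorem mu1_mem (M : AInfModule A) {n : ℤ} {m : M.V} (hm : m ∈ M.deg n) :
    M.mu1 m ∈ M.deg (n + 1) := by
  have := M.mu_deg 0 m n ![] ![] hm (fun k => k.elim0)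
  change M.mu 0 m ![] ∈ _
  simpa using this

theorem linearPart_mem {M N : AInfModule A} (f : Closed M N) {n : ℤ} {m : M.V}
    (hm : m ∈ M.deg n) : linearPart f.1 m ∈ N.deg n := by
  have := f.2.1 0 (M.sgn m) n ![] ![] (M.sgn_mem hm) (fun k => k.elim0)
  change f.1 0 (M.sgn m) ![] ∈ _
  simpa using this

theorem sgn_mu1 (M : AInfModule A) (m : M.V) : M.sgn (M.mu1 m) = -M.mu1 (M.sgn m) := by
  induction m using M.induction with
  | h n m hm =>
    rw [M.sgn_apply hm, M.sgn_apply (M.mu1_mem hm), map_smul, ← neg_smul]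
    congr 1
    rw [zpow_add₀ (by norm_num)]
    simp
  | hadd v w hv hw => simp only [map_add, hv, hw, neg_add]

theorem linearPart_mu1 {M N : AInfModule A} (f : Closed M N) (m : M.V) :
    linearPart f.1 (M.mu1 m) = N.mu1 (linearPart f.1 m) := by
  have h : M.diff N f.1 = 0 := f.2.2
  have h0 := congrArg (fun φ : PreHom M N => φ 0 m ![]) h
  simp [diff, ofSeq, diffFun] at h0
  have e : ∀ (a : Fin 0 → A.V), a = ![] := fun a => Subsingleton.elim _ _
  rw [e (block 0 0 _), e (block 0 0 _)] at h0
  change f.1 0 (M.sgn (M.mu1 m)) ![] = N.mu 0 (f.1 0 (M.sgn m) ![]) ![]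
  rw [sgn_mu1]
  change N.mu 0 (f.1 0 (M.sgn m) ![]) ![] + f.1 0 (M.mu1 (M.sgn m)) ![] = 0 at h0
  rw [map_neg, eq_comm, eq_neg_of_add_eq_zero_left h0]
  rfl

/-- The map `H^n(M) → H^n(N)` induced by a module homomorphism. -/
noncomputable def mapH {M N : AInfModule A} (f : Closed M N) (n : ℤ) : M.H n →ₗ[ℂ] N.H n :=
  Submodule.mapQ _ _
    ((linearPart f.1).restrict (p := M.deg n ⊓ LinearMap.ker M.mu1)
      (q := N.deg n ⊓ LinearMap.ker N.mu1) (fun m hm => ⟨linearPart_mem f hm.1, by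
        change N.mu1 _ = 0
        rw [← linearPart_mu1, LinearMap.mem_ker.1 hm.2, map_zero]⟩))
    (by
      rintro ⟨m, hm⟩ ⟨x, hx, rfl⟩
      exact ⟨linearPart f.1 x, linearPart_mem f hx, (linearPart_mu1 f x).symm⟩)

/-- A quasi-isomorphism: a module homomorphism which is an isomorphism on cohomology. -/
def IsQuasiIso {M N : AInfModule A} (f : Closed M N) : Prop :=
  ∀ n, Function.Bijective (mapH f n)

/-! ### Perfect modules -/

/-- The shift `M[k]`. -/
def shift (M : AInfModule A) (k : ℤ) : AInfModule A where
  toGradedSpace := M.toGradedSpace.shift k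
  mu := M.mu
  mu_deg := by
    intro d m p a n hm ha
    have := M.mu_deg d m (p + k) a n hm ha
    rw [show p + k + ∑ k, n k + 1 - d = p + ∑ k, n k + 1 - d + k by ring] at this
    exact this
  relation := M.relation

theorem mapHigh_mapHigh_zero (i : ℕ) (a : ℕ → A.V) :
    mapHigh A.rsgn i (mapHigh A.rsgn 0 a) = mapLow A.rsgn i a := by
  funext k
  by_cases h : i ≤ k
  · simp [mapHigh, mapLow, h, A.rsgn_rsgn, not_lt.2 h]
  · simp [mapHigh, mapLow, h, not_le.1 h]

theorem diffFun_congr (M N : AInfModule A) (φ : PreHom M N) (d : ℕ) (m : M.V) {a b : ℕ → A.V}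
    (h : ∀ k < d, a k = b k) : M.diffFun N φ d m a = M.diffFun N φ d m b := by
  have hb : ∀ i, i ≤ d → block 0 i a = block 0 i b := fun i hi =>
    block_congr fun k hk => h _ (by omega)
  have hc : ∀ i j, i + j ≤ d →
      block i j (mapHigh A.rsgn i a) = block i j (mapHigh A.rsgn i b) := fun i j hij =>
    block_congr fun k hk => by simp only [mapHigh]; rw [h _ (by omega)]
  have hs : ∀ i j x, 1 ≤ j → i + j ≤ d →
      block 0 (d + 1 - j) (splice i j x (mapHigh A.rsgn i a))
        = block 0 (d + 1 - j) (splice i j x (mapHigh A.rsgn i b)) := fun i j x hj hij =>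
    block_congr fun k hk => by
      simp only [splice, mapHigh]
      split_ifs <;> first | rfl | rw [h _ (by omega)]
  unfold diffFun
  refine congrArg₂ _ (congrArg₂ _ ?_ ?_) ?_
  · refine Finset.sum_congr rfl fun i hi => ?_
    have hi := mem_range.1 hi
    rw [hb i (by omega), hc i _ (by omega)]
  · refine Finset.sum_congr rfl fun i hi => ?_
    have hi := mem_range.1 hi
    rw [hb i (by omega), hc i _ (by omega)]
  · refine Finset.sum_congr rfl fun i hi => Finset.sum_congr rfl fun j hj => ?_
    have hi := mem_range.1 hi
    have hj := mem_Icc.1 hj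
    rw [hc i j (by omega), hs i j _ hj.1 (by omega)]

theorem diffFun_eq_zero {M N : AInfModule A} {f : PreHom M N}
    (hf : f ∈ LinearMap.ker (M.diff N)) (d : ℕ) (m : M.V) (a : ℕ → A.V) :
    M.diffFun N f d m a = 0 := by
  have h0 := congrArg (fun φ : PreHom M N => φ d m (block 0 d a)) (LinearMap.mem_ker.1 hf)
  refine Eq.trans (M.diffFun_congr N f d m fun k hk => ?_) h0
  simp [pad, block, hk]

theorem closed_relation {M N : AInfModule A} (f : Closed M N) (d : ℕ) (m : M.V)
    (a : ℕ → A.V) :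
    ∑ i ∈ range (d + 1),
      N.mu i (f.1 (d - i) m (block i (d - i) a)) (block 0 i (mapLow A.rsgn i a))
    + ∑ i ∈ range (d + 1),
      f.1 i (M.mu (d - i) m (block i (d - i) a)) (block 0 i (mapLow A.rsgn i a))
    + ∑ i ∈ range d, ∑ j ∈ Icc 1 (d - i), f.1 (d + 1 - j) m (block 0 (d + 1 - j)
      (splice i j (A.mu j (block i j a)) (mapLow A.rsgn i a))) = 0 := by
  have h := diffFun_eq_zero f.2.2 d (M.sgn m) (mapHigh A.rsgn 0 a)
  have e1 : ∀ i, block 0 i (mapHigh A.rsgn 0 a) = block 0 i (mapLow A.rsgn i a) := fun i =>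
    block_congr fun k hk => by simp [mapHigh, mapLow, hk]
  have e2 : ∀ i j, block i j (mapLow A.rsgn i a) = block i j a := fun i j =>
    block_congr fun k hk => by simp [mapLow]
  simpa only [diffFun, mapHigh_mapHigh_zero, e1, e2, M.sgn_sgn] using h

/-- The operations on the mapping cone. -/
def coneMu {M N : AInfModule A} (f : PreHom M N) (d : ℕ) :
    (M.V × N.V) →ₗ[ℂ] MultilinearMap ℂ (fun _ : Fin d => A.V) (M.V × N.V) where
  toFun x := (M.mu d x.1).prod (N.mu d x.2 + f d x.1)
  map_add' := by
    intro x y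
    ext a
    · simp
    · simp; abel
  map_smul' := by
    intro c x
    ext a <;> simp

/-- The mapping cone `M[1] ⊕ N` of a module homomorphism `f : M → N`, with operations
`(m, n), a_d, …, a_1 ↦ (μ_M(m, a_d, …, a_1), μ_N(n, a_d, …, a_1) + f(m, a_d, …, a_1))`. -/
def cone {M N : AInfModule A} (f : Closed M N) : AInfModule A where
  toGradedSpace := (M.toGradedSpace.shift 1).prod N.toGradedSpace
  mu := coneMu f.1
  mu_deg := by
    rintro d ⟨m, x⟩ p a n ⟨hm, hx⟩ ha
    refine ⟨?_, add_mem (N.mu_deg d x p a n hx ha) ?_⟩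
    · have := M.mu_deg d m (p + 1) a n hm ha
      rw [show p + 1 + ∑ k, n k + 1 - d = p + ∑ k, n k + 1 - d + 1 by ring] at this
      exact this
    · have := f.2.1 d m (p + 1) a n hm ha
      rw [show p + 1 + ∑ k, n k + 0 - d = p + ∑ k, n k + 1 - d by ring] at this
      exact this
  relation := by
    rintro d ⟨m, x⟩ a
    have hM := M.relation d m a
    have hN := N.relation d x a
    have hf := closed_relation f d m a
    refine Prod.ext ?_ ?_
    · simpa [coneMu, Prod.fst_sum] using hM
    · have := congrArg₂ (· + ·) hN hf
      simp only [add_zero] at this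
      simp only [coneMu, LinearMap.coe_mk, AddHom.coe_mk, MultilinearMap.prod_apply,
        _root_.add_apply, map_add, Prod.snd_add, Prod.snd_sum, Finset.sum_add_distrib,
        Prod.snd_zero]
      rw [← this]
      abel

theorem snoc_block {d : ℕ} (b : ℕ → A.V) (m : A.V) :
    (Fin.snoc (block 0 d b) m : Fin (d + 1) → A.V)
      = block 0 (d + 1) (Function.update b d m) := by
  funext k
  refine Fin.lastCases ?_ (fun k => ?_) k
  · simp [block]
  · simp [block, k.2.ne]

/-- The operations on the free module. -/
def freeMu (A : AInfAlgebra.{u}) (d : ℕ) :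
    A.V →ₗ[ℂ] MultilinearMap ℂ (fun _ : Fin d => A.V) A.V where
  toFun m :=
    { toFun := fun a => A.mu (d + 1) (Fin.snoc a m)
      map_update_add' := by
        intro inst a p x y
        rw [Subsingleton.elim inst (instDecidableEqFin d)]
        simp
      map_update_smul' := by
        intro inst a p c x
        rw [Subsingleton.elim inst (instDecidableEqFin d)]
        simp }
  map_add' := by
    intro m m'
    ext a
    have := (A.mu (d + 1)).map_update_add (Fin.snoc a m) (Fin.last d) m m'
    simp only [Fin.update_snoc_last] at this
    exact this
  map_smul' := by
    intro c m
    ext a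
    have := (A.mu (d + 1)).map_update_smul (Fin.snoc a m) (Fin.last d) c m
    simp only [Fin.update_snoc_last] at this
    exact this

theorem freeMu_apply {d : ℕ} (m : A.V) (a : Fin d → A.V) :
    freeMu A d m a = A.mu (d + 1) (Fin.snoc a m) := rfl

/-- The free module `A`, with `μ^{d+1}(m, a_d, …, a_1) = μ_A^{d+1}(m, a_d, …, a_1)`. -/
def free (A : AInfAlgebra.{u}) : AInfModule A where
  toGradedSpace := A.toGradedSpace
  mu := freeMu A
  mu_deg := by
    intro d m p a n hm ha
    have := A.mu_deg (d + 1) (Fin.snoc a m) (Fin.snoc n p) (by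
      intro k
      refine Fin.lastCases ?_ (fun k => ?_) k
      · simpa using hm
      · simpa using ha k)
    rw [Fin.sum_univ_castSucc] at this
    simp only [Fin.snoc_castSucc, Fin.snoc_last] at this
    rw [show ∑ k, n k + p + 2 - ((d + 1 : ℕ) : ℤ) = p + ∑ k, n k + 1 - d by
      push_cast; ring] at this
    exact this
  relation := by
    intro d m a
    have h := A.relation (d + 1) (Function.update a d m)
    rw [← h]
    have split : ∀ F : ℕ → ℕ → A.V, ∑ i ∈ range (d + 1), ∑ j ∈ Icc 1 (d + 1 - i), F i j
        = ∑ i ∈ range d, ∑ j ∈ Icc 1 (d - i), F i j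
          + ∑ i ∈ range (d + 1), F i (d - i + 1) := by
      intro F
      have e : ∀ i ∈ range (d + 1), ∑ j ∈ Icc 1 (d + 1 - i), F i j
          = ∑ j ∈ Icc 1 (d - i), F i j + F i (d - i + 1) := by
        intro i hi
        have hi := mem_range.1 hi
        rw [show d + 1 - i = (d - i) + 1 by omega, Finset.sum_Icc_succ_top (by omega)]
      rw [Finset.sum_congr rfl e, Finset.sum_add_distrib]
      congr 1
      rw [Finset.sum_range_succ]
      simp
    rw [split]
    refine congrArg₂ _ ?_ ?_
    · refine Finset.sum_congr rfl fun i hi => Finset.sum_congr rfl fun j hj => ?_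
      have hi := mem_range.1 hi
      have hj := mem_Icc.1 hj
      rw [freeMu_apply, snoc_block, show d + 1 + 1 - j = d + 1 - j + 1 by omega,
        block_update_notMem (i := i) _ _ (by omega)]
      refine congrArg _ (block_congr fun k hk => ?_)
      simp only [splice, mapLow, Function.update_apply]
      split_ifs <;> first | rfl | (exfalso; omega)
    · refine Finset.sum_congr rfl fun i hi => ?_
      have hi := mem_range.1 hi
      have e : (Fin.snoc (block i (d - i) a) m : Fin (d - i + 1) → A.V)
          = block i (d - i + 1) (Function.update a d m) := by
        funext k
        refine Fin.lastCases ?_ (fun k => ?_) k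
        · simp [block, show i + (d - i) = d by omega]
        · have : i + (k : ℕ) ≠ d := by have := k.2; omega
          simp [block, this]
      rw [freeMu_apply, freeMu_apply, snoc_block, show d + 1 + 1 - (d - i + 1) = i + 1 by omega, e]
      refine congrArg _ (block_congr fun k hk => ?_)
      simp only [splice, mapLow, Function.update_apply]
      split_ifs <;> first | rfl | (exfalso; omega)

/-- The modules constructed from the free module by a finite sequence of shifts and mapping
cones.  The cone of a homomorphism of strictly unital modules is in general only unital on the
level of cohomology, so strict unitality is not imposed here. -/
inductive IsTwisted : AInfModule A → Prop
  | free : IsTwisted (free A)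
  | shift (M : AInfModule A) (k : ℤ) : IsTwisted M → IsTwisted (M.shift k)
  | cone (M N : AInfModule A) (f : Closed M N) : IsTwisted M → IsTwisted N → IsTwisted (cone f)

/-- Perfect modules: up to isomorphism in `H^0(A^mod)`, a direct summand of a module as in
`IsTwisted`.  That is, there are homomorphisms `i : M → P` and `p : P → M` such that `p ∘ i` is
the identity in `H^0(hom(M, M))`. -/
def IsPerfect (M : AInfModule A) : Prop :=
  ∃ P : AInfModule A, IsTwisted P ∧ ∃ (i : Closed M P) (p : Closed P M),
    comp p.1 i.1 - M.idHom ∈ (M.hom M (-1)).map (M.diff M)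

/-- Rigid and simple modules: `H^1(hom(M, M)) = 0` and `H^0(hom(M, M)) ≅ ℂ`. -/
structure IsRigidSimple (M : AInfModule A) : Prop where
  rigid : Subsingleton (M.HomH M 1)
  simple : Nonempty (M.HomH M 0 ≃ₗ[ℂ] ℂ)

end AInfModule

/-! ### Actions of the multiplicative group -/

/-- Rational actions of `ℂ*`: for each `v`, the map `g ↦ g v` is a regular function on `ℂ*`, that
is, a Laurent polynomial in `g` with coefficients in `V`. -/
def IsRational {V : Type*} [AddCommGroup V] [Module ℂ V] (ρ : Representation ℂ ℂˣ V) : Prop :=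
  ∀ v, ∃ c : ℤ →₀ V, ∀ g : ℂˣ, ρ g v = c.sum fun n w => ((g : ℂ) ^ n) • w

/-- A rational action of `ℂ*` on an `A∞`-algebra: a rational action on the underlying graded
vector space for which all operations are equivariant. -/
structure AInfAlgebra.Action (A : AInfAlgebra.{u}) where
  rep : Representation ℂ ℂˣ A.V
  rational : IsRational rep
  rep_deg : ∀ g n, ∀ v ∈ A.deg n, rep g v ∈ A.deg n
  equivariant : ∀ g d (a : Fin d → A.V), rep g (A.mu d a) = A.mu d fun k => rep g (a k)

/-- A naive action of `ℂ*` on an `A∞`-module over an `A∞`-algebra with an action: a rational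
action on the underlying graded vector space for which all operations are equivariant. -/
structure AInfModule.NaiveAction {A : AInfAlgebra.{u}} (α : A.Action) (M : AInfModule A) where
  rep : Representation ℂ ℂˣ M.V
  rational : IsRational rep
  rep_deg : ∀ g n, ∀ v ∈ M.deg n, rep g v ∈ M.deg n
  equivariant : ∀ g d (m : M.V) (a : Fin d → A.V),
    rep g (M.mu d m a) = M.mu d (rep g m) fun k => α.rep g (a k)

end AInf

/-!
A rigid module with degreewise finite-dimensional cohomology is quasi-isomorphic to one with a naive
action of `ℂ*`. The idea is to integrate an infinitesimal action; neither simplicity of the module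
nor boundedness of `H(A)` is needed for this.

Multiplying the structure maps of `M` by the total weight of their algebra inputs gives a cocycle in
`hom^1(M, M)`, the infinitesimal deformation of `M` along the action (`AInfModule.deformation`).
Rigidity makes it the differential of some `D ∈ hom^0(M, M)`, which plays the role of a connection;
`D` can be chosen to vanish when an algebra input is the unit (`AInfModule.exists_connection`).

If `D` came from an action, the cohomology of `M` would split into eigenspaces of `T = -H(D)` with
integral eigenvalues. In general the generalised eigenspaces of `T`, with arbitrary complex
eigenvalues, have to be separated on the chain level. To this end `M` is tensored with
`ℂ(t)/ℂ[t]`, whose basis consists of the polar parts `(t - λ)^{-k-1}`; an algebra input of weight `w`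
moves a pole from `λ` to `λ + w` (`AInfModule.polar`). This module carries a naive action: poles at
`λ` get weight `⌊Re λ⌋`, and `⌊Re (λ + w)⌋ = ⌊Re λ⌋ + w`. Multiplication by `t` is equivariant but
not a module homomorphism; the failure is exactly the deformation (`AInfModule.diff_mulT`), so that
`t + D` is a closed endomorphism (`AInfModule.diff_theta`), and it is again equivariant. Its
desuspended cone `AInfModule.gradedModel` is therefore a strictly unital module with a naive action.

The residue defines a homomorphism from the cone to `M`. On cohomology it is governed by the
operator `t - T` on `H(M) ⊗ ℂ(t)/ℂ[t]`: for finite-dimensional `H^n(M)` this operator is surjective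
(`poleOp_surjective`), and the residue maps its kernel isomorphically onto `H^n(M)`, the inverse
being `v ↦ (t - T)⁻¹ v` (`exists_poleOp_eq_zero`, `eq_zero_of_poleOp_of_poleRes`). Hence the residue
is a quasi-isomorphism (`AInfModule.gradedModelProj_isQuasiIso`). Finite-dimensionality of `H^n(M)`
follows from perfectness (`AInfModule.IsPerfect.finiteDimensional_H`).

Two standard facts about `A∞`-modules over a field are proved along the way: quasi-isomorphisms can
be inverted (`AInfModule.exists_inverse_quasiIso`), because the morphism complex into an acyclic
module is acyclic; and the subcomplex of morphisms that vanish on units computes the same cohomology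
(`AInfModule.exists_reduced` is the part that is used). All computations are carried out with lists
of algebra inputs: `ev φ m l` is the value of a family `φ` on the list `l`, and `splitSum l f` sums
over the ways to cut `l` in two.
-/

namespace AInf

/-! ### Operations evaluated on lists -/

section SplitSum

variable {α β : Type*} {V W : Type*} [AddCommGroup V] [Module ℂ V] [AddCommGroup W] [Module ℂ W]

/-- The sum of `f u v` over all ways to write a list as a concatenation `u ++ v`. -/
def splitSum : List α → (List α → List α → W) → W
  | [], f => f [] []
  | a :: l, f => f [] (a :: l) + splitSum l fun u v => f (a :: u) v

@[simp] theorem splitSum_nil (f : List α → List α → W) : splitSum [] f = f [] [] := rfl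

theorem splitSum_cons (a : α) (l : List α) (f : List α → List α → W) :
    splitSum (a :: l) f = f [] (a :: l) + splitSum l fun u v => f (a :: u) v := rfl

theorem splitSum_eq_sum (l : List α) (f : List α → List α → W) :
    splitSum l f = ∑ i ∈ range (l.length + 1), f (l.take i) (l.drop i) := by
  induction l generalizing f with
  | nil => simp
  | cons a l ih =>
    rw [splitSum_cons, List.length_cons, Finset.sum_range_succ', ih, add_comm]
    simp

theorem splitSum_congr {l : List α} {f g : List α → List α → W}
    (h : ∀ u v, u ++ v = l → f u v = g u v) : splitSum l f = splitSum l g := by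
  rw [splitSum_eq_sum, splitSum_eq_sum]
  exact Finset.sum_congr rfl fun i _ => h _ _ (List.take_append_drop i l)

theorem splitSum_eq_zero {l : List α} {f : List α → List α → W}
    (h : ∀ u v, u ++ v = l → f u v = 0) : splitSum l f = 0 := by
  rw [splitSum_eq_sum]
  exact Finset.sum_eq_zero fun i _ => h _ _ (List.take_append_drop i l)

theorem splitSum_add (l : List α) (f g : List α → List α → W) :
    splitSum l (fun u v => f u v + g u v) = splitSum l f + splitSum l g := by
  simp only [splitSum_eq_sum, Finset.sum_add_distrib]

theorem splitSum_neg (l : List α) (f : List α → List α → W) :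
    splitSum l (fun u v => -f u v) = -splitSum l f := by
  simp only [splitSum_eq_sum, Finset.sum_neg_distrib]

theorem splitSum_sub (l : List α) (f g : List α → List α → W) :
    splitSum l (fun u v => f u v - g u v) = splitSum l f - splitSum l g := by
  simp only [splitSum_eq_sum, Finset.sum_sub_distrib]

theorem splitSum_smul (l : List α) (c : ℂ) (f : List α → List α → W) :
    splitSum l (fun u v => c • f u v) = c • splitSum l f := by
  simp only [splitSum_eq_sum, Finset.smul_sum]

theorem map_splitSum (L : V →ₗ[ℂ] W) (l : List α) (f : List α → List α → V) :
    L (splitSum l f) = splitSum l fun u v => L (f u v) := by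
  simp only [splitSum_eq_sum, map_sum]

theorem splitSum_map (s : α → β) (l : List α) (f : List β → List β → W) :
    splitSum (l.map s) f = splitSum l fun u v => f (u.map s) (v.map s) := by
  induction l generalizing f with
  | nil => rfl
  | cons a l ih => simp [splitSum_cons, ih]

/-- Splittings of `u ++ x :: w` cut either `u` or `w`. -/
theorem splitSum_append_cons (u w : List α) (x : α) (f : List α → List α → W) :
    splitSum (u ++ x :: w) f
      = splitSum u (fun p s => f p (s ++ x :: w))
        + splitSum w (fun p s => f (u ++ x :: p) s) := by
  induction u generalizing f with
  | nil => simp [splitSum_cons]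
  | cons a u ih => simp [splitSum_cons, ih, add_assoc]

theorem splitSum_assoc (l : List α) (f : List α → List α → List α → W) :
    splitSum l (fun p s => splitSum p fun p₁ p₂ => f p₁ p₂ s)
      = splitSum l fun p s => splitSum s fun s₁ s₂ => f p s₁ s₂ := by
  induction l generalizing f with
  | nil => rfl
  | cons a l ih =>
    simp only [splitSum_cons, splitSum_nil, splitSum_add, ih]
    abel

end SplitSum

section Eval

variable {A V W X : Type*} [AddCommGroup A] [Module ℂ A] [AddCommGroup V] [Module ℂ V]
  [AddCommGroup W] [Module ℂ W] [AddCommGroup X] [Module ℂ X]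

/-- Families `φ^{d+1} : V ⊗ A^{⊗d} → W`, `d ≥ 0`, of linear maps. -/
abbrev Fam (A V W : Type*) [AddCommGroup A] [Module ℂ A] [AddCommGroup V] [Module ℂ V]
    [AddCommGroup W] [Module ℂ W] : Type _ :=
  (d : ℕ) → V →ₗ[ℂ] MultilinearMap ℂ (fun _ : Fin d => A) W

/-- The sequence with the given initial entries, continued by zero. -/
def toSeq (l : List A) : ℕ → A := fun k => l.getD k 0

/-- The value `φ^{d+1}(m, a_d, …, a_1)` for the list `[a_1, …, a_d]`. The module variable is thus
adjacent to the end of the list: in a nested operation, the inner one takes a final segment. -/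
def ev (φ : Fam A V W) (m : V) (l : List A) : W :=
  φ l.length m (block 0 l.length (toSeq l))

/-- The value `f^d(a_d, …, a_1)` for the list `[a_1, …, a_d]`. -/
def evA (f : (d : ℕ) → MultilinearMap ℂ (fun _ : Fin d => A) W) (l : List A) : W :=
  f l.length (block 0 l.length (toSeq l))

/-- A single operation family regarded as one with a dummy module variable. -/
def toFam (f : (d : ℕ) → MultilinearMap ℂ (fun _ : Fin d => A) W) : Fam A ℂ W :=
  fun d => LinearMap.toSpanSingleton ℂ _ (f d)

theorem ev_toFam (f : (d : ℕ) → MultilinearMap ℂ (fun _ : Fin d => A) W) (l : List A) :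
    ev (toFam f) 1 l = evA f l := by
  simp [ev, evA, toFam]

theorem apply_eq_ev (φ : Fam A V W) (m : V) {n i : ℕ} {b : ℕ → A} {l : List A}
    (hl : l.length = n) (h : ∀ k, k < n → b (i + k) = l.getD k 0) :
    φ n m (block i n b) = ev φ m l := by
  subst hl
  refine congrArg _ (funext fun k => ?_)
  simpa [block, toSeq] using h k k.2

theorem apply_eq_evA (f : (d : ℕ) → MultilinearMap ℂ (fun _ : Fin d => A) W) {n i : ℕ}
    {b : ℕ → A} {l : List A}
    (hl : l.length = n) (h : ∀ k, k < n → b (i + k) = l.getD k 0) :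
    f n (block i n b) = evA f l := by
  subst hl
  refine congrArg _ (funext fun k => ?_)
  simpa [block, toSeq] using h k k.2

theorem apply_eq_ev_ofFn (φ : Fam A V W) (m : V) {n : ℕ} (a : Fin n → A) :
    φ n m a = ev φ m (List.ofFn a) := by
  rw [← apply_eq_ev φ m (n := n) (i := 0) (b := pad a) (by simp), block_pad]
  intro k hk
  simp [pad, hk, List.getD_eq_getElem?_getD]

theorem fam_ext {φ ψ : Fam A V W} (h : ∀ m l, ev φ m l = ev ψ m l) : φ = ψ := by
  funext d
  ext m a
  rw [apply_eq_ev_ofFn, apply_eq_ev_ofFn, h]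

/-- The entry at position `u.length` of `u ++ x :: v` varies linearly. -/
theorem ev_append_cons (φ : Fam A V W) (m : V) (u v : List A) (x : A) :
    ev φ m (u ++ x :: v) = (φ (u.length + v.length + 1) m).toLinearMap
      (block 0 (u.length + v.length + 1) (toSeq (u ++ 0 :: v))) ⟨u.length, by omega⟩ x := by
  rw [MultilinearMap.toLinearMap_apply,
    ← apply_eq_ev φ m (n := u.length + v.length + 1) (i := 0) (b := toSeq (u ++ x :: v))
      (by simp; omega) (by intro k _; simp [toSeq])]
  congr 1
  funext k
  rw [Function.update_apply]
  split_ifs with hk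
  · subst hk; simp [block, toSeq, List.getD_eq_getElem?_getD]
  · have hk' : (k : ℕ) ≠ u.length := fun e => hk (Fin.ext e)
    simp only [block, toSeq, zero_add, List.getD_eq_getElem?_getD]
    rcases lt_or_gt_of_ne hk' with h | h
    · rw [List.getElem?_append_left h, List.getElem?_append_left h]
    · rw [List.getElem?_append_right h.le, List.getElem?_append_right h.le]
      obtain ⟨j, hj⟩ := Nat.exists_eq_add_of_lt h
      rw [show (k : ℕ) - u.length = j + 1 by omega]
      simp

variable (φ : Fam A V W)

@[simp] theorem ev_add_left (m m' : V) (l : List A) :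
    ev φ (m + m') l = ev φ m l + ev φ m' l := by simp [ev]

@[simp] theorem ev_smul_left (c : ℂ) (m : V) (l : List A) :
    ev φ (c • m) l = c • ev φ m l := by simp [ev]

@[simp] theorem ev_neg_left (m : V) (l : List A) : ev φ (-m) l = -ev φ m l := by simp [ev]

@[simp] theorem ev_zero_left (l : List A) : ev φ 0 l = 0 := by simp [ev]

/-- `ev φ · l` as a linear map. -/
def evL (l : List A) : V →ₗ[ℂ] W where
  toFun m := ev φ m l
  map_add' _ _ := ev_add_left φ _ _ _
  map_smul' _ _ := ev_smul_left φ _ _ _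

@[simp] theorem evL_apply (l : List A) (m : V) : evL φ l m = ev φ m l := rfl

@[simp] theorem ev_add_fam (φ ψ : Fam A V W) (m : V) (l : List A) :
    ev (φ + ψ) m l = ev φ m l + ev ψ m l := by simp [ev]

@[simp] theorem ev_sub_fam (φ ψ : Fam A V W) (m : V) (l : List A) :
    ev (φ - ψ) m l = ev φ m l - ev ψ m l := by simp [ev]

@[simp] theorem ev_neg_fam (φ : Fam A V W) (m : V) (l : List A) :
    ev (-φ) m l = -ev φ m l := by simp [ev]

@[simp] theorem ev_smul_fam (c : ℂ) (φ : Fam A V W) (m : V) (l : List A) :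
    ev (c • φ) m l = c • ev φ m l := by simp [ev]

@[simp] theorem ev_zero_fam (m : V) (l : List A) : ev (0 : Fam A V W) m l = 0 := by simp [ev]

theorem ev_add_mid (m : V) (u v : List A) (x y : A) :
    ev φ m (u ++ (x + y) :: v) = ev φ m (u ++ x :: v) + ev φ m (u ++ y :: v) := by
  simp only [ev_append_cons, map_add]

theorem ev_smul_mid (m : V) (u v : List A) (c : ℂ) (x : A) :
    ev φ m (u ++ (c • x) :: v) = c • ev φ m (u ++ x :: v) := by
  simp only [ev_append_cons, map_smul]

@[simp] theorem ev_neg_mid (m : V) (u v : List A) (x : A) :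
    ev φ m (u ++ (-x) :: v) = -ev φ m (u ++ x :: v) := by
  simp only [ev_append_cons, map_neg]

@[simp] theorem ev_zero_mid (m : V) (u v : List A) :
    ev φ m (u ++ 0 :: v) = 0 := by
  simp only [ev_append_cons, map_zero]

theorem ev_splitSum_mid {α : Type*} (m : V) (u v : List A) (l : List α)
    (f : List α → List α → A) :
    ev φ m (u ++ splitSum l f :: v) = splitSum l fun p s => ev φ m (u ++ f p s :: v) := by
  simp only [ev_append_cons, map_splitSum]

theorem ev_splitSum_left {α : Type*} (w : List A) (l : List α)
    (f : List α → List α → V) :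
    ev φ (splitSum l f) w = splitSum l fun p s => ev φ (f p s) w :=
  map_splitSum (evL φ w) l f

/-- A function of a vector and a list which is linear in the vector and in each list entry. -/
structure IsMultilin (F : V → List A → W) : Prop where
  add_left : ∀ m m' l, F (m + m') l = F m l + F m' l
  smul_left : ∀ (c : ℂ) m l, F (c • m) l = c • F m l
  add_mid : ∀ m u v x y, F m (u ++ (x + y) :: v) = F m (u ++ x :: v) + F m (u ++ y :: v)
  smul_mid : ∀ m u v (c : ℂ) x, F m (u ++ (c • x) :: v) = c • F m (u ++ x :: v)

theorem ev_isMultilin : IsMultilin (ev φ) :=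
  ⟨ev_add_left φ, ev_smul_left φ, ev_add_mid φ, ev_smul_mid φ⟩

theorem ofFn_update {d : ℕ} (a : Fin d → A) (p : Fin d) :
    ∃ u v : List A, u.length = p ∧ ∀ x, List.ofFn (Function.update a p x) = u ++ x :: v := by
  refine ⟨(List.ofFn a).take p, (List.ofFn a).drop (p + 1), by simp, fun x => ?_⟩
  have : (List.ofFn (Function.update a p x)) = (List.ofFn a).set p x := by
    apply List.ext_getElem
    · simp
    · intro i h1 h2
      simp only [List.length_ofFn] at h1
      rw [List.getElem_ofFn, List.getElem_set, Function.update_apply, List.getElem_ofFn]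
      simp only [Fin.ext_iff, eq_comm]
  rw [this, List.set_eq_take_append_cons_drop, if_pos (by simp)]

/-- The family of multilinear maps given by a function of lists. -/
def mkFam (F : V → List A → W) (h : IsMultilin F) : Fam A V W := fun d =>
  { toFun := fun m =>
      { toFun := fun a => F m (List.ofFn a)
        map_update_add' := by
          intro inst a p x y
          rw [Subsingleton.elim inst (instDecidableEqFin d)]
          obtain ⟨u, v, -, e⟩ := ofFn_update a p
          rw [e, e, e, h.add_mid]
        map_update_smul' := by
          intro inst a p c x
          rw [Subsingleton.elim inst (instDecidableEqFin d)]
          obtain ⟨u, v, -, e⟩ := ofFn_update a p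
          rw [e, e, h.smul_mid] }
    map_add' := by intro m m'; ext a; exact h.add_left _ _ _
    map_smul' := by intro c m; ext a; exact h.smul_left _ _ _ }

theorem ofFn_block_toSeq (l : List A) : List.ofFn (block 0 l.length (toSeq l)) = l := by
  apply List.ext_getElem
  · simp
  · intro i h1 h2
    simp [block, toSeq, List.getD_eq_getElem?_getD, h2]

@[simp] theorem ev_mkFam (F : V → List A → W) (h : IsMultilin F) (m : V) (l : List A) :
    ev (mkFam F h) m l = F m l := by
  change F m (List.ofFn (block 0 l.length (toSeq l))) = _
  rw [ofFn_block_toSeq]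

/-- Two multilinear functions agree if they agree on lists with entries in a spanning set. -/
theorem IsMultilin.eq_of_span {F G : V → List A → W} (hF : IsMultilin F) (hG : IsMultilin G)
    {s : Set A} (hs : Submodule.span ℂ s = ⊤) (m : V)
    (h : ∀ l : List A, (∀ a ∈ l, a ∈ s) → F m l = G m l) (l : List A) : F m l = G m l := by
  suffices H : ∀ v u : List A, (∀ a ∈ u, a ∈ s) → F m (u ++ v) = G m (u ++ v) from
    H l [] (by simp)
  intro v
  induction v with
  | nil => intro u hu; simpa using h u hu
  | cons x v ih =>
    intro u hu
    have hx : x ∈ Submodule.span ℂ s := by rw [hs]; trivial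
    induction hx using Submodule.span_induction with
    | mem x hx =>
      have := ih (u ++ [x]) (by
        intro a ha
        rcases List.mem_append.1 ha with ha | ha
        · exact hu a ha
        · rw [List.mem_singleton.1 ha]; exact hx)
      simpa using this
    | zero =>
      have h1 := hF.smul_mid m u v 0 0
      have h2 := hG.smul_mid m u v 0 0
      rw [zero_smul, zero_smul] at h1 h2
      rw [h1, h2]
    | add x y _ _ hx hy => rw [hF.add_mid, hG.add_mid, hx, hy]
    | smul c x _ hx => rw [hF.smul_mid, hG.smul_mid, hx]

end Eval

end AInf

namespace AInf

/-! ### The structure equations on lists -/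

section Convert

variable {A W : Type*} [AddCommGroup A] [Module ℂ A] [AddCommGroup W] [Module ℂ W]

theorem splitSum_splitSum_eq_sum (l : List A) (f : List A → List A → List A → W)
    (h0 : ∀ u w, f u [] w = 0) :
    splitSum l (fun u r => splitSum r (f u)) = ∑ i ∈ range l.length,
      ∑ j ∈ Icc 1 (l.length - i), f (l.take i) ((l.drop i).take j) (l.drop (i + j)) := by
  rw [splitSum_eq_sum, Finset.sum_range_succ]
  simp only [List.drop_length, splitSum_nil, h0, add_zero]
  refine Finset.sum_congr rfl fun i _ => ?_
  rw [splitSum_eq_sum, List.length_drop]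
  symm
  simp only [List.drop_drop]
  refine Finset.sum_subset (fun j hj => ?_) fun j hj hj' => ?_
  · have := Finset.mem_Icc.1 hj
    exact Finset.mem_range.2 (by omega)
  · have h1 := Finset.mem_range.1 hj
    have h2 : j = 0 := by
      by_contra h
      exact hj' (Finset.mem_Icc.2 (by omega))
    subst h2
    simp [h0]

theorem getD_map (s : A →ₗ[ℂ] A) (l : List A) (k : ℕ) :
    (l.map s).getD k 0 = s (l.getD k 0) := by
  simp only [List.getD_eq_getElem?_getD, List.getElem?_map]
  cases l[k]? <;> simp

theorem getD_take (l : List A) (i k : ℕ) (h : k < i) :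
    (l.take i).getD k 0 = l.getD k 0 := by
  simp only [List.getD_eq_getElem?_getD, List.getElem?_take, h, if_true]

theorem getD_drop (l : List A) (i k : ℕ) :
    (l.drop i).getD k 0 = l.getD (i + k) 0 := by
  simp only [List.getD_eq_getElem?_getD, List.getElem?_drop]

theorem getD_append_cons (u w : List A) (x : A) (k : ℕ) :
    (u ++ x :: w).getD k 0
      = if k < u.length then u.getD k 0 else if k = u.length then x
        else w.getD (k - u.length - 1) 0 := by
  simp only [List.getD_eq_getElem?_getD]
  split_ifs with h1 h2
  · rw [List.getElem?_append_left h1]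
  · subst h2; simp
  · rw [List.getElem?_append_right (by omega)]
    obtain ⟨j, hj⟩ := Nat.exists_eq_add_of_lt (lt_of_le_of_ne (not_lt.1 h1) (Ne.symm h2))
    rw [show k - u.length = j + 1 by omega]
    simp

end Convert

section Sgn

variable {A : AInfAlgebra.{u}}

/-- The value `μ^d(a_d, …, a_1)` for the list `[a_1, …, a_d]`. -/
def AInfAlgebra.op (A : AInfAlgebra.{u}) (l : List A.V) : A.V := ev (toFam A.mu) 1 l

theorem AInfAlgebra.apply_eq_op {n i : ℕ} {b : ℕ → A.V} {l : List A.V}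
    (hl : l.length = n) (h : ∀ k, k < n → b (i + k) = l.getD k 0) :
    A.mu n (block i n b) = A.op l := by
  rw [AInfAlgebra.op, ev_toFam, apply_eq_evA A.mu hl h]

@[simp] theorem AInfAlgebra.op_nil : A.op [] = 0 := by
  simp [AInfAlgebra.op, ev_toFam, evA, A.mu_zero]

/-- The signs `(-1)^(|a| - 1)` applied to each entry of a list. -/
noncomputable def AInfAlgebra.sg (A : AInfAlgebra.{u}) (l : List A.V) : List A.V := l.map A.rsgn

@[simp] theorem AInfAlgebra.sg_nil : A.sg [] = [] := rfl

@[simp] theorem AInfAlgebra.sg_cons (x : A.V) (l : List A.V) :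
    A.sg (x :: l) = A.rsgn x :: A.sg l := rfl

@[simp] theorem AInfAlgebra.sg_append (u v : List A.V) : A.sg (u ++ v) = A.sg u ++ A.sg v :=
  List.map_append

@[simp] theorem AInfAlgebra.length_sg (u : List A.V) : (A.sg u).length = u.length :=
  List.length_map _

@[simp] theorem AInfAlgebra.sg_sg (u : List A.V) : A.sg (A.sg u) = u := by
  simp [AInfAlgebra.sg, Function.comp_def, A.rsgn_rsgn]

/-- The relations of an `A∞`-algebra. -/
theorem AInfAlgebra.op_relation (l : List A.V) :
    splitSum l (fun u r => splitSum r fun v w => A.op (A.sg u ++ A.op v :: w)) = 0 := by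
  rw [splitSum_splitSum_eq_sum _ (fun u v w => A.op (A.sg u ++ A.op v :: w))
    (by intro u w; simp only [AInfAlgebra.op_nil]; exact ev_zero_mid _ _ _ _),
    ← A.relation l.length (toSeq l)]
  refine Finset.sum_congr rfl fun i hi => Finset.sum_congr rfl fun j hj => ?_
  have hi := mem_range.1 hi
  have hj := mem_Icc.1 hj
  rw [A.apply_eq_op (n := j) (i := i) (l := (l.drop i).take j)]
  · symm
    apply A.apply_eq_op
    · simp; omega
    · intro k hk
      rw [getD_append_cons, AInfAlgebra.length_sg, List.length_take, min_eq_left hi.le, zero_add]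
      simp only [splice]
      split_ifs with h1 h2
      · rw [AInfAlgebra.sg, getD_map, getD_take _ _ _ h1]; simp [mapLow, h1, toSeq]
      · rfl
      · rw [getD_drop]
        simp only [mapLow, toSeq]
        rw [if_neg (by omega)]
        congr 1; omega
  · simp; omega
  · intro k hk
    rw [getD_take _ _ _ hk, getD_drop]; rfl

namespace AInfModule

/-- The module relations for a family, in terms of sequences and in terms of lists. -/
theorem sum_relation_eq {V : Type*} [AddCommGroup V] [Module ℂ V] (μ : Fam A.V V V) (m : V)
    {d : ℕ} {a : ℕ → A.V} {l : List A.V} (hl : l.length = d) (ha : ∀ k < d, a k = l.getD k 0) :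
    ∑ i ∈ range d, ∑ j ∈ Icc 1 (d - i),
      μ (d + 1 - j) m (block 0 (d + 1 - j)
        (splice i j (A.mu j (block i j a)) (mapLow A.rsgn i a)))
    + ∑ i ∈ range (d + 1),
      μ i (μ (d - i) m (block i (d - i) a)) (block 0 i (mapLow A.rsgn i a))
    = splitSum l (fun u r => splitSum r fun v w => ev μ m (A.sg u ++ A.op v :: w))
      + splitSum l (fun u v => ev μ (ev μ m v) (A.sg u)) := by
  subst hl
  rw [splitSum_splitSum_eq_sum _ (fun u v w => ev μ m (A.sg u ++ A.op v :: w))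
    (by intro u w; simp), splitSum_eq_sum]
  congr 1
  · refine Finset.sum_congr rfl fun i hi => Finset.sum_congr rfl fun j hj => ?_
    have hi := mem_range.1 hi
    have hj := mem_Icc.1 hj
    rw [A.apply_eq_op (n := j) (i := i) (l := (l.drop i).take j)]
    · apply apply_eq_ev
      · simp; omega
      · intro k hk
        rw [getD_append_cons, AInfAlgebra.length_sg, List.length_take, min_eq_left hi.le, zero_add]
        simp only [splice]
        split_ifs with h1 h2
        · rw [AInfAlgebra.sg, getD_map, getD_take _ _ _ h1, ← ha _ (by omega)]
          simp [mapLow, h1]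
        · rfl
        · rw [getD_drop]
          simp only [mapLow]
          rw [if_neg (by omega), ha _ (by omega)]
          congr 1; omega
    · simp; omega
    · intro k hk
      rw [getD_take _ _ _ hk, getD_drop, ha _ (by omega)]
  · refine Finset.sum_congr rfl fun i hi => ?_
    have hi := mem_range.1 hi
    rw [apply_eq_ev μ m (n := l.length - i) (l := l.drop i)]
    · apply apply_eq_ev
      · simp; omega
      · intro k hk
        rw [AInfAlgebra.sg, getD_map, getD_take _ _ _ hk, ← ha _ (by omega)]; simp [mapLow, hk]
    · simp
    · intro k hk
      rw [getD_drop, ha _ (by omega)]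

/-- The relations of an `A∞`-module. -/
theorem ev_relation (M : AInfModule A) (m : M.V) (l : List A.V) :
    splitSum l (fun u r => splitSum r fun v w => ev M.mu m (A.sg u ++ A.op v :: w))
      + splitSum l (fun u v => ev M.mu (ev M.mu m v) (A.sg u)) = 0 :=
  (sum_relation_eq M.mu m (a := toSeq l) rfl fun _ _ => rfl).symm.trans (M.relation _ _ _)

/-- The differential of a morphism complex, in terms of lists. -/
theorem ev_diff (M N : AInfModule A) (φ : PreHom M N) (m : M.V) (l : List A.V) :
    ev (M.diff N φ) m l
      = splitSum l (fun u v => ev N.mu (ev φ (M.sgn m) (A.sg v)) u)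
      + splitSum l (fun u v => ev φ (ev M.mu (M.sgn m) (A.sg v)) u)
      + splitSum l (fun u r => splitSum r fun v w =>
          ev φ (M.sgn m) (u ++ A.op (A.sg v) :: A.sg w)) := by
  rw [splitSum_splitSum_eq_sum _
    (fun u v w => ev φ (M.sgn m) (u ++ A.op (A.sg v) :: A.sg w))
    (by intro u w; simp), splitSum_eq_sum, splitSum_eq_sum]
  have h0 : ev (M.diff N φ) m l = M.diffFun N φ l.length m (toSeq l) := by
    change M.diffFun N φ l.length m (pad (block 0 l.length (toSeq l))) = _
    refine M.diffFun_congr N φ _ m fun k hk => ?_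
    simp [pad, block, hk]
  rw [h0]
  have hlow : ∀ {X Y : Type u} [AddCommGroup X] [Module ℂ X] [AddCommGroup Y] [Module ℂ Y]
      (ψ : Fam A.V X Y) (x : X) (i : ℕ), i < l.length + 1 →
      ψ i x (block 0 i (toSeq l)) = ev ψ x (l.take i) := by
    intro X Y _ _ _ _ ψ x i hi
    apply apply_eq_ev
    · simp; omega
    · intro k hk
      rw [getD_take _ _ _ hk, zero_add]; rfl
  have hhigh : ∀ {X Y : Type u} [AddCommGroup X] [Module ℂ X] [AddCommGroup Y] [Module ℂ Y]
      (ψ : Fam A.V X Y) (x : X) (i : ℕ),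
      ψ (l.length - i) x (block i (l.length - i) (mapHigh A.rsgn i (toSeq l)))
        = ev ψ x (A.sg (l.drop i)) := by
    intro X Y _ _ _ _ ψ x i
    apply apply_eq_ev
    · simp
    · intro k hk
      rw [AInfAlgebra.sg, getD_map, getD_drop]; simp [mapHigh, toSeq]
  unfold diffFun
  refine congrArg₂ _ (congrArg₂ _ ?_ ?_) ?_
  · refine Finset.sum_congr rfl fun i hi => ?_
    have hi := mem_range.1 hi
    rw [hhigh φ, hlow N.mu _ _ hi]
  · refine Finset.sum_congr rfl fun i hi => ?_
    have hi := mem_range.1 hi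
    rw [hhigh M.mu, hlow φ _ _ hi]
  · refine Finset.sum_congr rfl fun i hi => Finset.sum_congr rfl fun j hj => ?_
    have hi := mem_range.1 hi
    have hj := mem_Icc.1 hj
    rw [A.apply_eq_op (n := j) (i := i) (l := A.sg ((l.drop i).take j))]
    · apply apply_eq_ev
      · simp; omega
      · intro k hk
        rw [getD_append_cons, List.length_take, min_eq_left hi.le, zero_add]
        simp only [splice]
        split_ifs with h1 h2
        · rw [getD_take _ _ _ h1]; simp [mapHigh, h1, toSeq]
        · rfl
        · rw [AInfAlgebra.sg, getD_map, getD_drop]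
          simp only [mapHigh, toSeq]
          rw [if_pos (by omega)]
          congr 2; omega
    · simp; omega
    · intro k hk
      rw [AInfAlgebra.sg, getD_map, getD_take _ _ _ hk, getD_drop]
      simp [mapHigh, toSeq]

end AInfModule

/-! ### Degrees and signs -/

theorem GradedSpace.span_homogeneous (X : GradedSpace.{u}) :
    Submodule.span ℂ {v : X.V | ∃ n, v ∈ X.deg n} = ⊤ := by
  rw [eq_top_iff]
  rintro v -
  induction v using X.induction with
  | h n v hv => exact Submodule.subset_span ⟨n, hv⟩
  | hadd v w hv hw => exact add_mem hv hw

/-- `HasDeg l N` says that the entries of `l` are homogeneous, with reduced degrees `|a| - 1`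
adding up to `N`. -/
inductive AInfAlgebra.HasDeg (A : AInfAlgebra.{u}) : List A.V → ℤ → Prop
  | nil : A.HasDeg [] 0
  | cons {a : A.V} {n : ℤ} {l : List A.V} {N : ℤ} : a ∈ A.deg n → A.HasDeg l N →
      A.HasDeg (a :: l) (n - 1 + N)

theorem AInfAlgebra.HasDeg.append {l l' : List A.V} {n n' : ℤ} (h : A.HasDeg l n)
    (h' : A.HasDeg l' n') : A.HasDeg (l ++ l') (n + n') := by
  induction h with
  | nil => simpa
  | cons ha _ ih => rw [List.cons_append, add_assoc]; exact .cons ha ih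

theorem AInfAlgebra.HasDeg.of_append {l l' : List A.V} {n : ℤ} (h : A.HasDeg (l ++ l') n) :
    ∃ p q, A.HasDeg l p ∧ A.HasDeg l' q ∧ n = p + q := by
  induction l generalizing n with
  | nil => exact ⟨0, n, .nil, h, by simp⟩
  | cons a l ih =>
    cases h with
    | cons ha h =>
      obtain ⟨p, q, hp, hq, rfl⟩ := ih h
      exact ⟨_, q, .cons ha hp, hq, by ring⟩

theorem AInfAlgebra.HasDeg.sg {l : List A.V} {n : ℤ} (h : A.HasDeg l n) :
    A.HasDeg (A.sg l) n := by
  induction h with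
  | nil => exact .nil
  | cons ha _ ih => exact .cons (neg_mem (A.sgn_mem ha)) ih

theorem AInfAlgebra.exists_hasDeg {l : List A.V} (h : ∀ a ∈ l, a ∈ {v : A.V | ∃ n, v ∈ A.deg n}) :
    ∃ n, A.HasDeg l n := by
  induction l with
  | nil => exact ⟨0, .nil⟩
  | cons a l ih =>
    obtain ⟨n, hn⟩ := h a (by simp)
    obtain ⟨N, hN⟩ := ih fun b hb => h b (by simp [hb])
    exact ⟨_, .cons hn hN⟩

theorem AInfAlgebra.HasDeg.exists_fun {l : List A.V} {N : ℤ} (h : A.HasDeg l N) :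
    ∃ n : Fin l.length → ℤ, (∀ k, block 0 l.length (toSeq l) k ∈ A.deg (n k)) ∧
      ∑ k, n k - l.length = N := by
  induction h with
  | nil => exact ⟨Fin.elim0, fun k => k.elim0, by simp⟩
  | @cons a n l N ha _ ih =>
    obtain ⟨f, hf, e⟩ := ih
    refine ⟨Fin.cons n f, fun k => ?_, ?_⟩
    · refine Fin.cases ?_ (fun k => ?_) k
      · simpa [block, toSeq] using ha
      · simpa [block, toSeq] using hf k
    · change ∑ k, (Fin.cons n f : Fin (l.length + 1) → ℤ) k - ((l.length + 1 : ℕ) : ℤ) = _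
      rw [Fin.sum_univ_succ]
      simp only [Fin.cons_zero, Fin.cons_succ]
      push_cast
      linarith

theorem AInfAlgebra.hasDeg_ofFn {d : ℕ} (a : Fin d → A.V) (n : Fin d → ℤ)
    (h : ∀ k, a k ∈ A.deg (n k)) : A.HasDeg (List.ofFn a) (∑ k, n k - d) := by
  induction d with
  | zero => simpa using AInfAlgebra.HasDeg.nil
  | succ d ih =>
    rw [List.ofFn_succ, Fin.sum_univ_succ]
    have := AInfAlgebra.HasDeg.cons (h 0) (ih (fun k => a k.succ) (fun k => n k.succ)
      fun k => h k.succ)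
    convert this using 1
    push_cast; ring

theorem AInfAlgebra.op_mem {l : List A.V} {N : ℤ} (h : A.HasDeg l N) :
    A.op l ∈ A.deg (N + 2) := by
  obtain ⟨n, hn, e⟩ := h.exists_fun
  have := A.mu_deg _ _ _ hn
  rw [AInfAlgebra.op, ev_toFam, evA, ← e]
  convert this using 2
  ring

theorem AInfModule.ev_mu_mem (M : AInfModule A) {m : M.V} {p : ℤ} {l : List A.V} {N : ℤ}
    (hm : m ∈ M.deg p) (h : A.HasDeg l N) : ev M.mu m l ∈ M.deg (p + N + 1) := by
  obtain ⟨n, hn, e⟩ := h.exists_fun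
  have := M.mu_deg _ m p _ _ hm hn
  rw [ev, ← e]
  convert this using 2
  ring

theorem AInfModule.mem_hom_iff {M N : AInfModule A} {k : ℤ} {φ : PreHom M N} :
    φ ∈ M.hom N k ↔ ∀ m p l n, m ∈ M.deg p → A.HasDeg l n → ev φ m l ∈ N.deg (p + n + k) := by
  constructor
  · intro hφ m p l n hm h
    obtain ⟨n, hn, e⟩ := h.exists_fun
    have := hφ _ m p _ _ hm hn
    rw [ev, ← e]
    convert this using 2
    ring
  · intro hφ d m p a n hm ha
    have := hφ m p _ _ hm (A.hasDeg_ofFn a n ha)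
    rw [apply_eq_ev_ofFn]
    convert this using 2
    ring

theorem sg_isMultilin {V W : Type*} [AddCommGroup V] [Module ℂ V] [AddCommGroup W] [Module ℂ W]
    {F : V → List A.V → W} (h : IsMultilin F) (s : V →ₗ[ℂ] V) :
    IsMultilin fun m l => F (s m) (A.sg l) := by
  constructor
  · intro m m' l; rw [map_add, h.add_left]
  · intro c m l; rw [map_smul, h.smul_left]
  · intro m u v x y
    simp only [AInfAlgebra.sg_append, AInfAlgebra.sg_cons, map_add, h.add_mid]
  · intro m u v c x
    simp only [AInfAlgebra.sg_append, AInfAlgebra.sg_cons, map_smul, h.smul_mid]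

theorem comp_isMultilin {V W X : Type*} [AddCommGroup V] [Module ℂ V] [AddCommGroup W]
    [Module ℂ W] [AddCommGroup X] [Module ℂ X] {A : Type*} [AddCommGroup A] [Module ℂ A]
    {F : V → List A → W} (h : IsMultilin F) (s : W →ₗ[ℂ] X) :
    IsMultilin fun m l => s (F m l) := by
  constructor
  · intro m m' l; rw [h.add_left, map_add]
  · intro c m l; rw [h.smul_left, map_smul]
  · intro m u v x y; rw [h.add_mid, map_add]
  · intro m u v c x; rw [h.smul_mid, map_smul]

theorem neg_one_zpow_succ (n : ℤ) : (-1 : ℂ) ^ (n + 1) = -(-1 : ℂ) ^ n := by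
  rw [zpow_add₀ (by norm_num)]; simp

theorem ev_sg_of_hasDeg {V W : Type*} [AddCommGroup V] [Module ℂ V] [AddCommGroup W] [Module ℂ W]
    (φ : Fam A.V V W) (m : V) {l : List A.V} {n : ℤ} (h : A.HasDeg l n) :
    ev φ m (A.sg l) = (-1 : ℂ) ^ n • ev φ m l := by
  suffices H : ∀ u, ev φ m (u ++ A.sg l) = (-1 : ℂ) ^ n • ev φ m (u ++ l) from H []
  induction h with
  | nil => simp
  | @cons a n l N ha _ ih =>
    intro u
    have e : A.rsgn a = (-1 : ℂ) ^ (n - 1) • a := by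
      have := neg_one_zpow_succ (n - 1)
      rw [sub_add_cancel] at this
      simp only [GradedSpace.rsgn, LinearMap.neg_apply, A.sgn_apply ha, this, neg_smul, neg_neg]
    have h := ih (u ++ [A.rsgn a])
    simp only [List.append_assoc, List.singleton_append] at h
    rw [AInfAlgebra.sg_cons, h, e, ev_smul_mid, smul_smul, ← zpow_add₀ (by norm_num)]
    congr 2; ring

/-- A family of degree `k` commutes with the signs up to `(-1)^k`. -/
theorem AInfModule.sgn_ev {M N : AInfModule A} {k : ℤ} {φ : PreHom M N} (hφ : φ ∈ M.hom N k)
    (m : M.V) (l : List A.V) :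
    N.sgn (ev φ (M.sgn m) (A.sg l)) = (-1 : ℂ) ^ k • ev φ m l := by
  induction m using M.induction with
  | h p m hm =>
    refine IsMultilin.eq_of_span
      (F := fun m l => N.sgn (ev φ (M.sgn m) (A.sg l))) (G := fun m l => (-1 : ℂ) ^ k • ev φ m l)
      (comp_isMultilin (sg_isMultilin (ev_isMultilin φ) M.sgn) N.sgn)
      (comp_isMultilin (ev_isMultilin φ) ((-1 : ℂ) ^ k • LinearMap.id))
      A.span_homogeneous m (fun l hl => ?_) l
    obtain ⟨n, hn⟩ := A.exists_hasDeg hl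
    have hmem := AInfModule.mem_hom_iff.1 hφ m p l n hm hn
    simp only [M.sgn_apply hm, ev_smul_left, ev_sg_of_hasDeg φ m hn, map_smul, N.sgn_apply hmem,
      smul_smul]
    congr 1
    rw [zpow_add₀ (by norm_num), zpow_add₀ (by norm_num)]
    have h2 : ∀ q : ℤ, (-1 : ℂ) ^ q * (-1 : ℂ) ^ q = 1 := by
      intro q; rw [← mul_zpow]; simp
    linear_combination ((-1 : ℂ) ^ n * (-1 : ℂ) ^ n * (-1 : ℂ) ^ k) * h2 p
      + (-1 : ℂ) ^ k * h2 n
  | hadd m m' h h' => simp only [map_add, ev_add_left, h, h', smul_add]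

theorem AInfModule.mu_mem_hom (M : AInfModule A) : M.mu ∈ M.hom M 1 :=
  AInfModule.mem_hom_iff.2 fun _ _ _ _ hm hl => M.ev_mu_mem hm hl

theorem AInfModule.sgn_ev_mu (M : AInfModule A) (m : M.V) (l : List A.V) :
    M.sgn (ev M.mu m l) = -ev M.mu (M.sgn m) (A.sg l) := by
  have := AInfModule.sgn_ev M.mu_mem_hom (M.sgn m) (A.sg l)
  rw [M.sgn_sgn, AInfAlgebra.sg_sg] at this
  rw [this]; simp

theorem AInfAlgebra.rsgn_op (l : List A.V) : A.rsgn (A.op l) = -A.op (A.sg l) := by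
  refine IsMultilin.eq_of_span
    (F := fun m l => A.rsgn (ev (toFam A.mu) m l))
    (G := fun m l => -ev (toFam A.mu) m (A.sg l))
    (comp_isMultilin (ev_isMultilin _) A.rsgn)
    (comp_isMultilin (sg_isMultilin (ev_isMultilin (toFam A.mu)) LinearMap.id) (-LinearMap.id))
    A.span_homogeneous 1 (fun l hl => ?_) l
  obtain ⟨n, hn⟩ := A.exists_hasDeg hl
  have hmem := A.op_mem hn
  rw [ev_sg_of_hasDeg _ _ hn]
  change -A.sgn (A.op l) = _
  rw [A.sgn_apply hmem, zpow_add₀ (by norm_num)]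
  simp [AInfAlgebra.op]

end Sgn

end AInf

namespace AInf

/-! ### The differential of the morphism complexes squares to zero -/

section NestedSplit

variable {α : Type*} {W : Type*} [AddCommGroup W] [Module ℂ W]

theorem splitSum_comm (l l' : List α) (f : List α → List α → List α → List α → W) :
    splitSum l (fun u v => splitSum l' fun u' v' => f u v u' v')
      = splitSum l' fun u' v' => splitSum l fun u v => f u v u' v' := by
  simp only [splitSum_eq_sum]
  exact Finset.sum_comm

theorem splitSum_assoc_first (l : List α) (f : List α → List α → List α → List α → W) :
    splitSum l (fun u r => splitSum r fun v w => splitSum u fun u₁ u₂ => f u₁ u₂ v w)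
      = splitSum l fun u₁ r => splitSum r fun u₂ r => splitSum r fun v w => f u₁ u₂ v w := by
  simp only [fun (r u : List α) => splitSum_comm r u fun v w u₁ u₂ => f u₁ u₂ v w]
  rw [splitSum_assoc l fun u₁ u₂ r => splitSum r fun v w => f u₁ u₂ v w]

theorem splitSum_assoc_triple (l : List α) (f : List α → List α → List α → List α → W) :
    splitSum l (fun p w => splitSum p fun u r => splitSum r fun v w₁ => f u v w₁ w)
      = splitSum l fun u r => splitSum r fun v r => splitSum r fun w₁ w => f u v w₁ w := by
  rw [splitSum_assoc l fun u r w => splitSum r fun v w₁ => f u v w₁ w]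
  refine splitSum_congr fun u s _ => ?_
  rw [splitSum_assoc s fun v w₁ w => f u v w₁ w]

theorem splitSum_assoc_two_first (l : List α)
    (f : List α → List α → List α → List α → List α → W) :
    splitSum l (fun u r => splitSum r fun v w => splitSum u fun u₁ u₂ =>
        splitSum u₂ fun a b => f u₁ a b v w)
      = splitSum l fun u₁ r => splitSum r fun a r => splitSum r fun b r =>
        splitSum r fun v w => f u₁ a b v w := by
  rw [splitSum_assoc_first l fun u₁ u₂ v w => splitSum u₂ fun a b => f u₁ a b v w]
  refine splitSum_congr fun u₁ r _ => ?_
  rw [splitSum_assoc_first r fun a b v w => f u₁ a b v w]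

end NestedSplit

variable {A : AInfAlgebra.{u}}

theorem AInfAlgebra.splitSum_sg {W : Type*} [AddCommGroup W] [Module ℂ W] (l : List A.V)
    (f : List A.V → List A.V → W) :
    splitSum (A.sg l) f = splitSum l fun u v => f (A.sg u) (A.sg v) := splitSum_map _ _ _

@[simp] theorem AInfAlgebra.rsgn_op_sg (l : List A.V) : A.rsgn (A.op (A.sg l)) = -A.op l := by
  rw [A.rsgn_op, A.sg_sg]

@[simp] theorem AInfAlgebra.op_neg_mid (u w : List A.V) (x : A.V) :
    A.op (u ++ (-x) :: w) = -A.op (u ++ x :: w) := ev_neg_mid _ _ _ _ _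

theorem ev_neg_mid_right {V W : Type*} [AddCommGroup V] [Module ℂ V] [AddCommGroup W]
    [Module ℂ W] (φ : Fam A.V V W) (m : V) (u s w : List A.V) (x y : A.V) :
    ev φ m (u ++ x :: (s ++ (-y) :: w)) = -ev φ m (u ++ x :: (s ++ y :: w)) := by
  have := ev_neg_mid φ m (u ++ x :: s) w y
  simpa using this

namespace AInfModule

@[simp] theorem sgn_sgn' (M : AInfModule A) (m : M.V) : M.sgn (M.sgn m) = m := M.sgn_sgn m

@[simp] theorem sgn_ev_mu_sg (M : AInfModule A) (m : M.V) (l : List A.V) :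
    M.sgn (ev M.mu (M.sgn m) (A.sg l)) = -ev M.mu m l := by
  rw [M.sgn_ev_mu, A.sg_sg, M.sgn_sgn]

theorem ev_relation_sg (N : AInfModule A) (n : N.V) (L : List A.V) :
    splitSum L (fun u r => splitSum r fun v w => ev N.mu n (u ++ A.op (A.sg v) :: A.sg w))
      + splitSum L (fun u v => ev N.mu (ev N.mu n (A.sg v)) u) = 0 := by
  simpa only [A.splitSum_sg, A.sg_sg] using N.ev_relation n (A.sg L)

theorem diff_diff (M N : AInfModule A) (φ : PreHom M N) : M.diff N (M.diff N φ) = 0 := by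
  refine fam_ext fun m l => ?_
  rw [ev_zero_fam]
  have hM := M.ev_relation m
  have hA : ∀ u w (L : List A.V), splitSum L (fun u' r => splitSum r fun v w' =>
      ev φ m (u ++ A.op (A.sg u' ++ A.op v :: w') :: w)) = 0 := by
    intro u w L
    rw [← ev_zero_mid φ m u w, ← A.op_relation L]
    simp only [ev_splitSum_mid]
  -- The terms cancel in groups: those of `c1`, `c2`, `c5`, `c6` because two disjoint or nested
  -- operations are carried out in either order, those of `c3`, `c4`, `c7` by the relations of
  -- `N`, `M` and `A`.
  have c1 : splitSum l (fun u v => splitSum v fun v₁ v₂ =>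
        ev N.mu (ev φ (ev M.mu m v₂) (A.sg v₁)) u)
      = splitSum l fun u v => splitSum u fun u₁ u₂ =>
        ev N.mu (ev φ (ev M.mu m v) (A.sg u₂)) u₁ :=
    (splitSum_assoc l fun u₁ u₂ v => ev N.mu (ev φ (ev M.mu m v) (A.sg u₂)) u₁).symm
  have c2 := splitSum_assoc_first l fun u₁ u₂ v w =>
    ev N.mu (ev φ m (A.sg u₂ ++ A.op v :: w)) u₁
  have c3 : splitSum l (fun u v => splitSum v fun v₁ v₂ =>
        ev N.mu (ev N.mu (ev φ m v₂) (A.sg v₁)) u)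
      + splitSum l (fun u r => splitSum r fun v w => splitSum w fun w₁ w₂ =>
        ev N.mu (ev φ m w₂) (u ++ A.op (A.sg v) :: A.sg w₁)) = 0 := by
    rw [← splitSum_assoc l fun u v₁ v₂ => ev N.mu (ev N.mu (ev φ m v₂) (A.sg v₁)) u,
      ← splitSum_assoc_triple l fun u v w₁ w₂ =>
        ev N.mu (ev φ m w₂) (u ++ A.op (A.sg v) :: A.sg w₁), ← splitSum_add]
    exact splitSum_eq_zero fun L w _ => by rw [add_comm]; exact N.ev_relation_sg _ _
  have c4 : splitSum l (fun u v => splitSum u fun u₁ u₂ =>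
        ev φ (ev M.mu (ev M.mu m v) (A.sg u₂)) u₁)
      + splitSum l (fun u r => splitSum r fun v w => splitSum u fun u₁ u₂ =>
        ev φ (ev M.mu m (A.sg u₂ ++ A.op v :: w)) u₁) = 0 := by
    rw [splitSum_assoc l fun u₁ u₂ v => ev φ (ev M.mu (ev M.mu m v) (A.sg u₂)) u₁,
      splitSum_assoc_first l fun u₁ u₂ v w => ev φ (ev M.mu m (A.sg u₂ ++ A.op v :: w)) u₁,
      ← splitSum_add]
    refine splitSum_eq_zero fun u L _ => ?_
    rw [add_comm, ← ev_zero_left φ u, ← hM L]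
    simp only [ev_add_left, ev_splitSum_left]
  have c5 := splitSum_assoc_triple l fun u v w₁ w₂ =>
    ev φ (ev M.mu m w₂) (u ++ A.op (A.sg v) :: A.sg w₁)
  have c6 := splitSum_assoc_two_first l fun u₁ a b v w =>
    ev φ m (u₁ ++ A.op (A.sg a) :: (A.sg b ++ A.op v :: w))
  have c7 : splitSum l (fun u r => splitSum r fun v w => splitSum u fun u₁ u₂ =>
      splitSum w fun w₁ w₂ => ev φ m (u₁ ++ A.op (A.sg u₂ ++ A.op v :: w₁) :: w₂)) = 0 := by
    rw [splitSum_assoc_first l fun u₁ u₂ v w => splitSum w fun w₁ w₂ =>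
      ev φ m (u₁ ++ A.op (A.sg u₂ ++ A.op v :: w₁) :: w₂)]
    refine splitSum_eq_zero fun u₁ r _ => ?_
    rw [← splitSum_assoc_triple r fun u₂ v w₁ w₂ =>
      ev φ m (u₁ ++ A.op (A.sg u₂ ++ A.op v :: w₁) :: w₂)]
    exact splitSum_eq_zero fun L w₂ _ => hA _ _ _
  simp only [ev_diff, ev_add_left, splitSum_append_cons, A.splitSum_sg, A.sg_sg, sgn_sgn',
    sgn_ev_mu_sg, splitSum_add, ev_splitSum_left, ev_neg_left, A.sg_append, A.sg_cons,
    A.rsgn_op_sg, ev_neg_mid, splitSum_neg, List.append_assoc, List.cons_append,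
    A.op_neg_mid, ev_neg_mid_right]
  linear_combination (norm := abel) c1 - c2 + c3 - c4 - c5 - c6 - c7

end AInfModule
end AInf

namespace AInf

/-! ### Degree and locality of the differential -/

theorem splitSum_mem {α W : Type*} [AddCommGroup W] [Module ℂ W] (p : Submodule ℂ W)
    {l : List α} {f : List α → List α → W} (h : ∀ u v, u ++ v = l → f u v ∈ p) :
    splitSum l f ∈ p := by
  rw [splitSum_eq_sum]
  exact Submodule.sum_mem _ fun i _ => h _ _ (List.take_append_drop i l)

theorem splitSum_eq_left {α W : Type*} [AddCommGroup W] [Module ℂ W]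
    {l : List α} {f : List α → List α → W} (h : ∀ u v, u ++ v = l → u ≠ [] → f u v = 0) :
    splitSum l f = f [] l := by
  cases l with
  | nil => rfl
  | cons a l =>
    rw [splitSum_cons, splitSum_eq_zero fun u v e => h (a :: u) v (by simp [e]) (by simp), add_zero]

theorem splitSum_eq_right {α W : Type*} [AddCommGroup W] [Module ℂ W]
    {l : List α} {f : List α → List α → W} (h : ∀ u v, u ++ v = l → v ≠ [] → f u v = 0) :
    splitSum l f = f l [] := by
  induction l generalizing f with
  | nil => rfl
  | cons a l ih =>
    rw [splitSum_cons, h [] (a :: l) rfl (by simp), zero_add]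
    exact ih fun u v e hv => h _ _ (by simp [e]) hv

variable {A : AInfAlgebra.{u}}

namespace AInfModule

theorem diff_mem_hom {M N : AInfModule A} {φ : PreHom M N} {k : ℤ} (hφ : φ ∈ M.hom N k) :
    M.diff N φ ∈ M.hom N (k + 1) := by
  rw [mem_hom_iff] at hφ ⊢
  intro m p l n hm hl
  have hm' := M.sgn_mem hm
  rw [ev_diff]
  refine add_mem (add_mem ?_ ?_) ?_
  · refine splitSum_mem _ fun u v e => ?_
    subst e
    obtain ⟨a, b, ha, hb, rfl⟩ := hl.of_append
    convert N.ev_mu_mem (hφ _ _ _ _ hm' hb.sg) ha using 2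
    ring
  · refine splitSum_mem _ fun u v e => ?_
    subst e
    obtain ⟨a, b, ha, hb, rfl⟩ := hl.of_append
    convert hφ _ _ _ _ (M.ev_mu_mem hm' hb.sg) ha using 2
    ring
  · refine splitSum_mem _ fun u r e => splitSum_mem _ fun v w e' => ?_
    subst e'; subst e
    obtain ⟨a, b, ha, hb, rfl⟩ := hl.of_append
    obtain ⟨b, c, hv, hc, rfl⟩ := hb.of_append
    convert hφ _ _ _ _ hm' (ha.append (.cons (A.op_mem hv.sg) hc.sg)) using 2
    ring

/-- The component `(diff φ)^{d+1}` only depends on the components `φ^{i+1}` with `i ≤ d`. -/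
theorem ev_diff_congr {M N : AInfModule A} {φ ψ : PreHom M N} {d : ℕ}
    (h : ∀ m l, l.length < d → ev φ m l = ev ψ m l) (m : M.V) (l : List A.V)
    (hl : l.length < d) : ev (M.diff N φ) m l = ev (M.diff N ψ) m l := by
  rw [ev_diff, ev_diff]
  refine congrArg₂ _ (congrArg₂ _ ?_ ?_) ?_
  · refine splitSum_congr fun u v e => ?_
    subst e
    rw [h _ _ (by simp at hl ⊢; omega)]
  · refine splitSum_congr fun u v e => ?_
    subst e
    rw [h _ _ (by simp at hl ⊢; omega)]
  · refine splitSum_congr fun u r e => splitSum_congr fun v w e' => ?_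
    subst e'; subst e
    cases v with
    | nil => simp
    | cons x v => rw [h _ _ (by simp at hl ⊢; omega)]

/-- The limit of a sequence of families in which each component eventually stabilises. -/
def limFam {M N : AInfModule A} (η : ℕ → PreHom M N) : PreHom M N := fun d => η (d + 1) d

theorem ev_limFam {M N : AInfModule A} {η : ℕ → PreHom M N}
    (hη : ∀ n m l, l.length < n → ev (η (n + 1)) m l = ev (η n) m l) {n : ℕ} (m : M.V)
    {l : List A.V} (hl : l.length < n) : ev (limFam η) m l = ev (η n) m l := by
  have h0 : ev (limFam η) m l = ev (η (l.length + 1)) m l := rfl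
  rw [h0]
  induction n, hl using Nat.le_induction with
  | base => rfl
  | succ n hn ih => rw [ih, hη n m l hn]

theorem limFam_mem_hom {M N : AInfModule A} {η : ℕ → PreHom M N} {k : ℤ}
    (h : ∀ n, η n ∈ M.hom N k) : limFam η ∈ M.hom N k :=
  fun d => h (d + 1) d

theorem ev_diff_limFam {M N : AInfModule A} {η : ℕ → PreHom M N}
    (hη : ∀ n m l, l.length < n → ev (η (n + 1)) m l = ev (η n) m l) {n : ℕ} (m : M.V)
    {l : List A.V} (hl : l.length < n) :
    ev (M.diff N (limFam η)) m l = ev (M.diff N (η n)) m l :=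
  ev_diff_congr (fun m _ h => ev_limFam hη m h) m l hl

/-! ### Morphisms into acyclic modules -/

theorem _root_.AInf.GradedSpace.exists_linearMap (X : GradedSpace.{u}) {W : Type*}
    [AddCommGroup W] [Module ℂ W] (f : ∀ n, X.deg n →ₗ[ℂ] W) :
    ∃ L : X.V →ₗ[ℂ] W, ∀ n (x : X.V) (hx : x ∈ X.deg n), L x = f n ⟨x, hx⟩ := by
  refine ⟨(DirectSum.toModule ℂ ℤ W f) ∘ₗ
    (LinearEquiv.ofBijective (DirectSum.coeLinearMap X.deg) X.internal).symm.toLinearMap,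
    fun n x hx => ?_⟩
  have : (LinearEquiv.ofBijective (DirectSum.coeLinearMap X.deg) X.internal).symm x
      = DirectSum.lof ℂ ℤ (fun n => X.deg n) n ⟨x, hx⟩ := by
    rw [LinearEquiv.symm_apply_eq]
    exact (DirectSum.coeLinearMap_lof X.deg n ⟨x, hx⟩).symm
  simp [this]

@[simp] theorem ev_mu_nil (M : AInfModule A) (m : M.V) : ev M.mu m [] = M.mu1 m :=
  congrArg (M.mu 0 m) (Subsingleton.elim _ _)

theorem mu1_mu1 (M : AInfModule A) (m : M.V) : M.mu1 (M.mu1 m) = 0 := by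
  have := M.ev_relation m []
  have h0 := ev_zero_mid M.mu m [] []
  simp only [List.nil_append] at h0
  simpa [h0] using this

/-- An acyclic module is contractible as a complex, because complements exist over a field. -/
theorem exists_contraction (N : AInfModule A)
    (hN : ∀ n, ∀ x ∈ N.deg n, N.mu1 x = 0 → ∃ y ∈ N.deg (n - 1), N.mu1 y = x) :
    ∃ h : N.V →ₗ[ℂ] N.V, (∀ n, ∀ x ∈ N.deg n, h x ∈ N.deg (n - 1)) ∧
      ∀ x, N.mu1 (h x) + h (N.mu1 x) = x := by
  have hσ : ∀ n, ∃ σ : ↥(N.deg n ⊓ LinearMap.ker N.mu1) →ₗ[ℂ] N.deg (n - 1),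
      ∀ z, N.mu1 (σ z) = z := by
    intro n
    let d : N.deg (n - 1) →ₗ[ℂ] ↥(N.deg n ⊓ LinearMap.ker N.mu1) :=
      N.mu1.restrict fun x hx => ⟨by simpa using N.mu1_mem hx, N.mu1_mu1 x⟩
    have hd : Function.Surjective d := by
      rintro ⟨x, hx, hx'⟩
      obtain ⟨y, hy, e⟩ := hN n x hx hx'
      exact ⟨⟨y, hy⟩, Subtype.ext e⟩
    obtain ⟨σ, hσ⟩ := d.exists_rightInverse_of_surjective (LinearMap.range_eq_top.2 hd)
    exact ⟨σ, fun z => congrArg Subtype.val (LinearMap.congr_fun hσ z)⟩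
  choose σ hσ using hσ
  let D : ∀ n, N.deg n →ₗ[ℂ] ↥(N.deg (n + 1) ⊓ LinearMap.ker N.mu1) := fun n =>
    N.mu1.restrict fun x hx => ⟨N.mu1_mem hx, N.mu1_mu1 x⟩
  have hs : ∀ n (z : ↥(N.deg (n + 1) ⊓ LinearMap.ker N.mu1)), (σ (n + 1) z : N.V) ∈ N.deg n := by
    intro n z
    simpa using (σ (n + 1) z).2
  let P : ∀ n, N.deg n →ₗ[ℂ] ↥(N.deg n ⊓ LinearMap.ker N.mu1) := fun n =>
    LinearMap.codRestrict _ ((N.deg n).subtype - (N.deg (n + 1 - 1)).subtype ∘ₗ σ (n + 1) ∘ₗ D n)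
      (fun x => ⟨sub_mem x.2 (hs n _), by
        change N.mu1 (x - σ (n + 1) (D n x)) = 0
        rw [map_sub]
        exact sub_eq_zero.2 (hσ (n + 1) (D n x)).symm⟩)
  obtain ⟨h, hh⟩ := N.exists_linearMap fun n => (N.deg (n - 1)).subtype ∘ₗ σ n ∘ₗ P n
  refine ⟨h, fun n x hx => ?_, fun x => ?_⟩
  · rw [hh n x hx]
    exact (σ n (P n ⟨x, hx⟩)).2
  · induction x using N.induction with
    | h n x hx =>
      have e1 : N.mu1 (h x) = x - σ (n + 1) (D n ⟨x, hx⟩) := by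
        rw [hh n x hx]
        exact hσ n _
      have e2 : h (N.mu1 x) = σ (n + 1) (D n ⟨x, hx⟩) := by
        rw [hh (n + 1) _ (N.mu1_mem hx)]
        have : P (n + 1) ⟨N.mu1 x, N.mu1_mem hx⟩ = D n ⟨x, hx⟩ := by
          refine Subtype.ext ?_
          have h0 : D (n + 1) ⟨N.mu1 x, N.mu1_mem hx⟩ = 0 := Subtype.ext (N.mu1_mu1 x)
          change N.mu1 x - (σ (n + 1 + 1) (D (n + 1) ⟨N.mu1 x, N.mu1_mem hx⟩) : N.V) = N.mu1 x
          rw [h0]; simp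
        simp [this]
      rw [e1, e2]; abel
    | hadd x y hx hy =>
      simp only [map_add]
      rw [add_add_add_comm, hx, hy]

/-- Postcomposition of a family with a linear map. -/
def postFam {A V W X : Type*} [AddCommGroup A] [Module ℂ A] [AddCommGroup V] [Module ℂ V]
    [AddCommGroup W] [Module ℂ W] [AddCommGroup X] [Module ℂ X]
    (L : W →ₗ[ℂ] X) (φ : Fam A V W) : Fam A V X :=
  mkFam (fun m l => L (ev φ m l)) (comp_isMultilin (ev_isMultilin φ) L)

@[simp] theorem ev_postFam {A V W X : Type*} [AddCommGroup A] [Module ℂ A] [AddCommGroup V]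
    [Module ℂ V] [AddCommGroup W] [Module ℂ W] [AddCommGroup X] [Module ℂ X]
    (L : W →ₗ[ℂ] X) (φ : Fam A V W) (m : V) (l : List A) :
    ev (postFam L φ) m l = L (ev φ m l) := ev_mkFam _ _ _ _

/-- A closed family whose first `n` components vanish is changed by a coboundary so that one more
component vanishes. -/
theorem ev_sub_diff_post {M N : AInfModule A} {h : N.V →ₗ[ℂ] N.V}
    (hh : ∀ x, N.mu1 (h x) + h (N.mu1 x) = x) {k : ℤ} {φ : PreHom M N} (hφ : φ ∈ M.hom N k)
    (hd : M.diff N φ = 0) {n : ℕ} (h0 : ∀ m l, l.length < n → ev φ m l = 0)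
    (m : M.V) (l : List A.V) (hl : l.length < n + 1) :
    ev (φ - (-1 : ℂ) ^ k • M.diff N (postFam (h ∘ₗ N.sgn) φ)) m l = 0 := by
  have e1 := congrArg (h ∘ₗ N.sgn) (ev_diff M N φ m l)
  rw [hd, ev_zero_fam, map_zero, map_add, map_add] at e1
  simp only [map_splitSum] at e1
  have e2 := ev_diff M N (postFam (h ∘ₗ N.sgn) φ) m l
  simp only [ev_postFam] at e2
  have e3 : splitSum l (fun u v => ev N.mu ((h ∘ₗ N.sgn) (ev φ (M.sgn m) (A.sg v))) u)
      - splitSum l (fun u v => (h ∘ₗ N.sgn) (ev N.mu (ev φ (M.sgn m) (A.sg v)) u))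
      = (-1 : ℂ) ^ k • ev φ m l := by
    rw [← splitSum_sub, splitSum_eq_left]
    · rw [← sgn_ev hφ, ev_mu_nil, ev_mu_nil, LinearMap.comp_apply, LinearMap.comp_apply,
        N.sgn_mu1, map_neg, sub_neg_eq_add, hh]
    · intro u v e hu
      subst e
      rw [h0 _ (A.sg v) (by
        have := List.length_pos_iff.2 hu
        simp at hl ⊢; omega)]
      simp
  have e4 : ev (M.diff N (postFam (h ∘ₗ N.sgn) φ)) m l = (-1 : ℂ) ^ k • ev φ m l := by
    rw [← e3, e2, ← sub_zero (_ + _ + _), e1]; abel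
  rw [ev_sub_fam, ev_smul_fam, e4, smul_smul, ← mul_zpow]
  simp

/-- The morphism complex into an acyclic module is acyclic: a closed family is corrected by
coboundaries one component at a time, and the corrections stabilise in each component. -/
theorem exists_diff_eq_of_acyclic {M N : AInfModule A}
    (hN : ∀ n, ∀ x ∈ N.deg n, N.mu1 x = 0 → ∃ y ∈ N.deg (n - 1), N.mu1 y = x)
    {k : ℤ} {φ : PreHom M N} (hφ : φ ∈ M.hom N k) (hd : M.diff N φ = 0) :
    ∃ η ∈ M.hom N (k - 1), M.diff N η = φ := by
  obtain ⟨h, hdeg, hh⟩ := N.exists_contraction hN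
  let K : PreHom M N → PreHom M N := fun φ => (-1 : ℂ) ^ k • postFam (h ∘ₗ N.sgn) φ
  have hK : ∀ φ ∈ M.hom N k, K φ ∈ M.hom N (k - 1) := by
    intro φ hφ
    refine Submodule.smul_mem _ _ (mem_hom_iff.2 fun m p l n hm hl => ?_)
    rw [ev_postFam]
    rw [← add_sub_assoc]
    exact hdeg _ _ (N.sgn_mem (mem_hom_iff.1 hφ m p l n hm hl))
  let f : ℕ → PreHom M N := fun n => Nat.rec φ (fun _ φ => φ - M.diff N (K φ)) n
  have hf : ∀ n, f n ∈ M.hom N k ∧ M.diff N (f n) = 0 ∧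
      ∀ m l, l.length < n → ev (f n) m l = 0 := by
    intro n
    induction n with
    | zero => exact ⟨hφ, hd, fun m l hl => absurd hl (by omega)⟩
    | succ n ih =>
      obtain ⟨h1, h2, h3⟩ := ih
      refine ⟨sub_mem h1 ?_, ?_, fun m l hl => ?_⟩
      · have := diff_mem_hom (hK _ h1)
        rwa [sub_add_cancel] at this
      · change M.diff N (f n - M.diff N (K (f n))) = 0
        rw [map_sub, h2, diff_diff, sub_zero]
      · change ev (f n - M.diff N (K (f n))) m l = 0
        rw [map_smul]
        exact ev_sub_diff_post hh h1 h2 h3 m l hl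
  let η : ℕ → PreHom M N := fun n => ∑ i ∈ range n, K (f i)
  have hη : ∀ n m l, l.length < n → ev (η (n + 1)) m l = ev (η n) m l := by
    intro n m l hl
    change ev (∑ i ∈ range (n + 1), K (f i)) m l = _
    rw [Finset.sum_range_succ, ev_add_fam]
    simp only [K, ev_smul_fam, ev_postFam, (hf n).2.2 m l hl]
    simp [η, K]
  have hsum : ∀ n, M.diff N (η n) = φ - f n := by
    intro n
    induction n with
    | zero => simp [η, f]
    | succ n ih =>
      have e : η (n + 1) = η n + K (f n) := Finset.sum_range_succ _ _
      have e' : f (n + 1) = f n - M.diff N (K (f n)) := rfl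
      rw [e, map_add, ih, e']; abel
  refine ⟨limFam η, limFam_mem_hom fun n => Submodule.sum_mem _ fun i _ => hK _ (hf i).1, ?_⟩
  refine fam_ext fun m l => ?_
  rw [ev_diff_limFam hη m (Nat.lt_succ_self _), hsum, ev_sub_fam,
    (hf _).2.2 m l (Nat.lt_succ_self _), sub_zero]

end AInfModule
end AInf

namespace AInf

variable {A : AInfAlgebra.{u}}

namespace AInfModule

/-! ### Strict morphisms -/

/-- The family whose only component is a linear map `L` in the module variable. -/
def strictFam {A V W : Type*} [AddCommGroup A] [Module ℂ A] [AddCommGroup V] [Module ℂ V]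
    [AddCommGroup W] [Module ℂ W] (L : V →ₗ[ℂ] W) : Fam A V W
  | 0 =>
    { toFun := fun m => MultilinearMap.constOfIsEmpty ℂ _ (L m)
      map_add' := by intro m m'; ext a; simp
      map_smul' := by intro c m; ext a; simp }
  | _ + 1 => 0

section

variable {A V W : Type*} [AddCommGroup A] [Module ℂ A] [AddCommGroup V] [Module ℂ V]
  [AddCommGroup W] [Module ℂ W] (L : V →ₗ[ℂ] W) (m : V)

@[simp] theorem ev_strictFam_nil : ev (strictFam (A := A) L) m [] = L m := rfl

@[simp] theorem ev_strictFam_cons (x : A) (l : List A) : ev (strictFam L) m (x :: l) = 0 := rfl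

theorem ev_strictFam_of_ne {l : List A} (h : l ≠ []) : ev (strictFam L) m l = 0 := by
  cases l with
  | nil => exact absurd rfl h
  | cons x l => rfl

end

theorem strictFam_mem_hom {M N : AInfModule A} {L : M.V →ₗ[ℂ] N.V} {k : ℤ}
    (h : ∀ n, ∀ m ∈ M.deg n, L m ∈ N.deg (n + k)) : strictFam L ∈ M.hom N k := by
  rw [mem_hom_iff]
  intro m p l n hm hl
  cases hl with
  | nil => simpa using h p m hm
  | cons _ _ => exact zero_mem _

theorem ev_diff_strictFam {M N : AInfModule A} (L : M.V →ₗ[ℂ] N.V) (m : M.V) (l : List A.V) :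
    ev (M.diff N (strictFam (L ∘ₗ M.sgn))) m l = ev N.mu (L m) l - L (ev M.mu m l) := by
  rw [ev_diff, splitSum_eq_right, splitSum_eq_left, splitSum_eq_zero (f := fun u r => splitSum r _)]
  · simp [sub_eq_add_neg]
  · exact fun u r _ => splitSum_eq_zero fun v w _ => ev_strictFam_of_ne _ _ (by simp)
  · exact fun u v _ hu => ev_strictFam_of_ne _ _ hu
  · intro u v _ hv
    rw [ev_strictFam_of_ne _ _ (by simpa [AInfAlgebra.sg] using hv), ev_zero_left]

theorem diff_strictFam {M N : AInfModule A} {L : M.V →ₗ[ℂ] N.V}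
    (h : ∀ m l, ev N.mu (L m) l = L (ev M.mu m l)) :
    M.diff N (strictFam (L ∘ₗ M.sgn)) = 0 := by
  refine fam_ext fun m l => ?_
  rw [ev_diff_strictFam, h, sub_self, ev_zero_fam]

theorem diff_postFam {M N P : AInfModule A} {L : N.V →ₗ[ℂ] P.V}
    (h : ∀ m l, ev P.mu (L m) l = L (ev N.mu m l)) (φ : PreHom M N) :
    M.diff P (postFam L φ) = postFam L (M.diff N φ) := by
  refine fam_ext fun m l => ?_
  simp only [ev_diff, ev_postFam, h, map_add, map_splitSum]

/-! ### Quasi-isomorphisms -/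

/-- Injectivity and surjectivity on cohomology, in terms of cocycles. -/
theorem isQuasiIso_iff {M N : AInfModule A} (f : Closed M N) :
    IsQuasiIso f ↔
      (∀ n, ∀ x ∈ M.deg n, M.mu1 x = 0 → ∀ y ∈ N.deg (n - 1), N.mu1 y = linearPart f.1 x →
        ∃ z ∈ M.deg (n - 1), M.mu1 z = x) ∧
      (∀ n, ∀ y ∈ N.deg n, N.mu1 y = 0 → ∃ x ∈ M.deg n, M.mu1 x = 0 ∧
        ∃ z ∈ N.deg (n - 1), N.mu1 z = linearPart f.1 x - y) := by
  have key : ∀ n, Function.Bijective (mapH f n) ↔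
      (∀ x ∈ M.deg n, M.mu1 x = 0 → ∀ y ∈ N.deg (n - 1), N.mu1 y = linearPart f.1 x →
        ∃ z ∈ M.deg (n - 1), M.mu1 z = x) ∧
      (∀ y ∈ N.deg n, N.mu1 y = 0 → ∃ x ∈ M.deg n, M.mu1 x = 0 ∧
        ∃ z ∈ N.deg (n - 1), N.mu1 z = linearPart f.1 x - y) := by
    intro n
    refine and_congr ?_ ?_
    · rw [injective_iff_map_eq_zero]
      constructor
      · intro H x hx hx' y hy e
        have := H (Submodule.Quotient.mk ⟨x, hx, hx'⟩)
          ((Submodule.Quotient.mk_eq_zero _).2 ⟨y, hy, e⟩)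
        obtain ⟨z, hz, e⟩ := (Submodule.Quotient.mk_eq_zero _).1 this
        exact ⟨z, hz, e⟩
      · rintro H ⟨x, hx, hx'⟩ h
        obtain ⟨y, hy, e⟩ := (Submodule.Quotient.mk_eq_zero _).1 h
        obtain ⟨z, hz, e⟩ := H x hx hx' y hy e
        exact (Submodule.Quotient.mk_eq_zero _).2 ⟨z, hz, e⟩
    · constructor
      · intro H y hy hy'
        obtain ⟨⟨x, hx, hx'⟩, e⟩ := H (Submodule.Quotient.mk ⟨y, hy, hy'⟩)
        obtain ⟨z, hz, e⟩ := (Submodule.Quotient.eq _).1 e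
        exact ⟨x, hx, hx', z, hz, e⟩
      · rintro H ⟨y, hy, hy'⟩
        obtain ⟨x, hx, hx', z, hz, e⟩ := H y hy hy'
        exact ⟨Submodule.Quotient.mk ⟨x, hx, hx'⟩, (Submodule.Quotient.eq _).2 ⟨z, hz, e⟩⟩
  rw [IsQuasiIso, forall_congr' key, forall_and]

theorem ev_nil_eq {M N : AInfModule A} (φ : PreHom M N) (m : M.V) :
    ev φ m [] = linearPart φ (M.sgn m) := by
  change _ = φ 0 (M.sgn (M.sgn m)) ![]
  rw [M.sgn_sgn]
  exact congrArg (φ 0 m) (Subsingleton.elim _ _)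

theorem linearPart_apply {M N : AInfModule A} (φ : PreHom M N) (m : M.V) :
    linearPart φ m = ev φ (M.sgn m) [] := by
  rw [ev_nil_eq, M.sgn_sgn]

theorem ev_cone_mu {M N : AInfModule A} (f : Closed M N) (z : M.V × N.V) (l : List A.V) :
    ev (cone f).mu z l = (ev M.mu z.1 l, ev N.mu z.2 l + ev f.1 z.1 l) := rfl

theorem cone_mu1 {M N : AInfModule A} (f : Closed M N) (z : M.V × N.V) :
    (cone f).mu1 z = (M.mu1 z.1, N.mu1 z.2 + linearPart f.1 (M.sgn z.1)) := by
  rw [← ev_nil_eq, ← ev_mu_nil, ← ev_mu_nil]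
  exact (ev_mu_nil (cone f) z).symm

theorem cone_acyclic {M N : AInfModule A} {f : Closed M N} (hf : IsQuasiIso f) (n : ℤ)
    (z : M.V × N.V) (hz : z ∈ (cone f).deg n) (hz' : (cone f).mu1 z = 0) :
    ∃ w ∈ (cone f).deg (n - 1), (cone f).mu1 w = z := by
  obtain ⟨hinj, hsurj⟩ := (isQuasiIso_iff f).1 hf
  obtain ⟨x, y⟩ := z
  obtain ⟨hx, hy⟩ := hz
  change x ∈ M.deg (n + 1) at hx
  change y ∈ N.deg n at hy
  rw [cone_mu1] at hz'
  obtain ⟨h1, h2⟩ := Prod.ext_iff.1 hz'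
  change M.mu1 x = 0 at h1
  change N.mu1 y + linearPart f.1 (M.sgn x) = 0 at h2
  obtain ⟨t, ht, et⟩ := hinj (n + 1) (M.sgn x) (M.sgn_mem hx)
    (by have := M.sgn_mu1 x; rw [h1, map_zero] at this; exact neg_eq_zero.1 this.symm)
    (-y) (by rw [add_sub_cancel_right]; exact neg_mem hy)
    (by rw [map_neg]; exact neg_eq_of_add_eq_zero_right h2)
  rw [add_sub_cancel_right] at ht
  obtain ⟨x₂, hx₂, hx₂', s, hs, es⟩ := hsurj n (y + linearPart f.1 t)
    (add_mem hy (linearPart_mem f ht)) (by rw [map_add, ← linearPart_mu1, et]; exact h2)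
  refine ⟨(-M.sgn t + M.sgn x₂, -s), ⟨?_, ?_⟩, ?_⟩
  · change _ ∈ M.deg (n - 1 + 1)
    rw [sub_add_cancel]
    exact add_mem (neg_mem (M.sgn_mem ht)) (M.sgn_mem hx₂)
  · exact neg_mem hs
  · rw [cone_mu1]
    have e1 : ∀ m, M.mu1 (M.sgn m) = -M.sgn (M.mu1 m) := fun m => by rw [M.sgn_mu1, neg_neg]
    refine Prod.ext ?_ ?_
    · change M.mu1 (-M.sgn t + M.sgn x₂) = x
      rw [map_add, map_neg, e1, e1, et, hx₂', map_zero, M.sgn_sgn]; simp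
    · change N.mu1 (-s) + linearPart f.1 (M.sgn (-M.sgn t + M.sgn x₂)) = y
      rw [map_neg, es, map_add, map_neg, M.sgn_sgn, M.sgn_sgn, map_add, map_neg]; abel

/-- Quasi-isomorphisms can be inverted: if `f : M → N` is a quasi-isomorphism, the inclusion of `N`
in the acyclic module `cone f` is a coboundary, and the first component of a primitive is a
quasi-isomorphism `N → M`. -/
theorem exists_inverse_quasiIso {M N : AInfModule A} {f : Closed M N} (hf : IsQuasiIso f) :
    ∃ g : Closed N M, IsQuasiIso g := by
  let L : N.V →ₗ[ℂ] (cone f).V := LinearMap.inr ℂ M.V N.V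
  have hL : ∀ m l, ev (cone f).mu (L m) l = L (ev N.mu m l) := by
    intro m l
    change ev (cone f).mu ((0, m) : M.V × N.V) l = (0, ev N.mu m l)
    rw [ev_cone_mu]
    refine Prod.ext (ev_zero_left M.mu l) ?_
    change ev N.mu m l + ev f.1 0 l = ev N.mu m l
    rw [ev_zero_left, add_zero]
  have hj : strictFam (L ∘ₗ N.sgn) ∈ N.hom (cone f) 0 := strictFam_mem_hom fun n m hm =>
    ⟨zero_mem _, by
      have := N.sgn_mem hm
      rw [add_zero]; exact this⟩
  obtain ⟨η, hη, e⟩ := exists_diff_eq_of_acyclic (cone_acyclic hf) hj (diff_strictFam hL)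
  let P : (cone f).V →ₗ[ℂ] M.V := LinearMap.fst ℂ M.V N.V
  have hP : ∀ m l, ev M.mu (P m) l = P (ev (cone f).mu m l) := fun m l => rfl
  have hηm := mem_hom_iff.1 hη
  have hg : postFam P η ∈ N.hom M 0 := by
    rw [mem_hom_iff]
    intro m p l n hm hl
    rw [ev_postFam]
    have : P (ev η m l) ∈ M.deg (p + n + (0 - 1) + 1) := (hηm m p l n hm hl).1
    convert this using 2
    ring
  have hg' : N.diff M (postFam P η) = 0 := by
    rw [diff_postFam hP, e]
    refine fam_ext fun m l => ?_
    rw [ev_postFam, ev_zero_fam]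
    cases l with
    | nil => rfl
    | cons x l => rw [ev_strictFam_cons, map_zero]
  let g : Closed N M := ⟨postFam P η, hg, hg'⟩
  have hgev : ∀ m l, ev g.1 m l = (ev η m l : M.V × N.V).1 := fun m l => ev_postFam P η m l
  -- The second component of the primitive is a homotopy from `f ∘ g` to the identity.
  let s : N.V → N.V := fun m => (ev η m [] : M.V × N.V).2
  have hs : ∀ n, ∀ m ∈ N.deg n, s m ∈ N.deg (n - 1) := by
    intro n m hm
    have := (hηm m n [] 0 hm .nil).2
    rw [show n + 0 + (0 - 1) = n - 1 by ring] at this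
    exact this
  have hfg : ∀ n, ∀ m ∈ N.deg n,
      linearPart f.1 (linearPart g.1 m) + N.mu1 (s m) + s (N.mu1 m) = m := by
    intro n m hm
    have h0 := ev_diff N (cone f) η (N.sgn m) []
    rw [e] at h0
    simp only [splitSum_nil, AInfAlgebra.sg_nil, N.sgn_sgn, List.nil_append,
      AInfAlgebra.op_nil, ev_strictFam_nil] at h0
    rw [show ev η m [(0 : A.V)] = 0 from ev_zero_mid η m [] [], add_zero] at h0
    have h1 : N.sgn (N.sgn m) = ev N.mu (s m) [] + ev f.1 (ev η m [] : M.V × N.V).1 []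
      + s (ev N.mu m []) := congrArg (fun z : M.V × N.V => z.2) h0
    replace h1 := h1.symm
    rw [N.sgn_sgn, ← hgev, ev_mu_nil, ev_nil_eq f.1, ev_mu_nil] at h1
    have h2 : M.sgn (ev g.1 m []) = linearPart g.1 m := by
      have := mem_hom_iff.1 g.2.1 m n [] 0 hm .nil
      rw [add_zero, add_zero] at this
      rw [M.sgn_apply this, linearPart_apply, N.sgn_apply hm, ev_smul_left]
    rw [h2] at h1
    rw [add_comm (linearPart f.1 _)]
    exact h1
  obtain ⟨hinj, hsurj⟩ := (isQuasiIso_iff f).1 hf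
  refine ⟨g, (isQuasiIso_iff g).2 ⟨fun n x hx hx' y hy ey => ?_, fun n y hy hy' => ?_⟩⟩
  · refine ⟨linearPart f.1 y + s x, add_mem (linearPart_mem f hy) (hs n x hx), ?_⟩
    have := hfg n x hx
    have hs0 : s 0 = 0 := congrArg (Prod.snd : M.V × N.V → N.V) (ev_zero_left η [])
    rw [hx', hs0, add_zero] at this
    rw [map_add, ← linearPart_mu1, ey, this]
  · have h1 := linearPart_mem f hy
    have h2 : N.mu1 (linearPart f.1 y) = 0 := by rw [← linearPart_mu1, hy', map_zero]
    refine ⟨linearPart f.1 y, h1, h2, ?_⟩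
    refine hinj n _ (sub_mem (linearPart_mem g h1) hy) ?_ (-s (linearPart f.1 y))
      (neg_mem (hs n _ h1)) ?_
    · rw [map_sub, ← linearPart_mu1, h2, map_zero, hy', sub_zero]
    · have := hfg n _ h1
      have hs0 : s 0 = 0 := congrArg (Prod.snd : M.V × N.V → N.V) (ev_zero_left η [])
      rw [h2, hs0, add_zero] at this
      rw [map_neg, map_sub, eq_sub_iff_add_eq]
      nth_rewrite 2 [← this]
      abel

end AInfModule
end AInf

namespace AInf

variable {A : AInfAlgebra.{u}}

/-! ### Units -/

theorem block_toSeq_append_cons (u v : List A.V) (x : A.V) :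
    block 0 (u ++ x :: v).length (toSeq (u ++ x :: v)) ⟨u.length, by simp⟩ = x := by
  simp [block, toSeq]

theorem AInfAlgebra.op_unit_eq_zero {u v : List A.V} (h : u.length + v.length ≠ 1) :
    A.op (u ++ A.e :: v) = 0 := by
  rw [AInfAlgebra.op, ev_toFam]
  exact A.mu_unit _ (by simp; omega) _ ⟨_, block_toSeq_append_cons u v A.e⟩

@[simp] theorem AInfAlgebra.op_unit_left (x : A.V) : A.op [A.e, x] = x := by
  rw [AInfAlgebra.op, ev_toFam]
  refine Eq.trans (congrArg (A.mu 2) ?_) (A.mu_two_right x)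
  funext k
  fin_cases k <;> rfl

@[simp] theorem AInfAlgebra.op_unit_right (x : A.V) : A.op [x, A.e] = A.sgn x := by
  rw [AInfAlgebra.op, ev_toFam]
  refine Eq.trans (congrArg (A.mu 2) ?_) (A.mu_two_left x)
  funext k
  fin_cases k <;> rfl

@[simp] theorem AInfAlgebra.rsgn_unit : A.rsgn A.e = -A.e := by
  have := A.sgn_apply A.e_deg
  rw [GradedSpace.rsgn, LinearMap.neg_apply, this]; simp

namespace AInfModule

theorem StrictlyUnital.ev_unit {M : AInfModule A} (hM : M.StrictlyUnital) (m : M.V) :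
    ev M.mu m [A.e] = m := by
  refine Eq.trans (congrArg (M.mu 1 m) ?_) (hM.mu_one m)
  funext k
  fin_cases k; rfl

theorem StrictlyUnital.ev_eq_zero {M : AInfModule A} (hM : M.StrictlyUnital) (m : M.V)
    {u v : List A.V} (h : u ≠ [] ∨ v ≠ []) : ev M.mu m (u ++ A.e :: v) = 0 := by
  refine hM.mu_unit _ ?_ m _ ⟨_, block_toSeq_append_cons u v A.e⟩
  rcases h with h | h
  · have := List.length_pos_iff.2 h
    simp; omega
  · have := List.length_pos_iff.2 h
    simp; omega

/-- A family is reduced if it vanishes whenever one of its algebra inputs is the unit. -/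
def IsReduced {V W : Type*} [AddCommGroup V] [Module ℂ V] [AddCommGroup W] [Module ℂ W]
    (φ : Fam A.V V W) : Prop :=
  ∀ m u v, ev φ m (u ++ A.e :: v) = 0

/-- A family vanishes on units below `p` if it vanishes whenever the unit is one of the inputs
`a_1, …, a_p`. -/
def VanishesOnUnits {V W : Type*} [AddCommGroup V] [Module ℂ V] [AddCommGroup W] [Module ℂ W]
    (p : ℕ) (φ : Fam A.V V W) : Prop :=
  ∀ m u v, u.length < p → ev φ m (u ++ A.e :: v) = 0

/-- The family `φ` precomposed with all signs. -/
noncomputable def twist {M N : AInfModule A} (φ : PreHom M N) : PreHom M N :=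
  mkFam (fun m l => ev φ (M.sgn m) (A.sg l)) (sg_isMultilin (ev_isMultilin φ) M.sgn)

@[simp] theorem ev_twist {M N : AInfModule A} (φ : PreHom M N) (m : M.V) (l : List A.V) :
    ev (twist φ) m l = ev φ (M.sgn m) (A.sg l) := ev_mkFam _ _ _ _

theorem twist_twist {M N : AInfModule A} (φ : PreHom M N) : twist (twist φ) = φ :=
  fam_ext fun m l => by simp

theorem twist_mem_hom {M N : AInfModule A} {φ : PreHom M N} {k : ℤ} (h : φ ∈ M.hom N k) :
    twist φ ∈ M.hom N k := by
  rw [mem_hom_iff] at h ⊢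
  intro m p l n hm hl
  rw [ev_twist]
  exact h _ _ _ _ (M.sgn_mem hm) hl.sg

theorem VanishesOnUnits.twist {M N : AInfModule A} {φ : PreHom M N} {p : ℕ}
    (h : VanishesOnUnits p φ) : VanishesOnUnits p (twist φ) := by
  intro m u v hu
  simp [h (M.sgn m) (A.sg u) (A.sg v) (by simpa using hu)]

theorem ev_diff_twist {M N : AInfModule A} (F : PreHom M N) (m : M.V) (l : List A.V) :
    ev (M.diff N (twist F)) m l
      = splitSum l (fun u v => ev N.mu (ev F m v) u)
      - splitSum l (fun u v => ev F (ev M.mu m v) (A.sg u))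
      - splitSum l (fun u r => splitSum r fun v w => ev F m (A.sg u ++ A.op v :: w)) := by
  rw [ev_diff]
  simp only [ev_twist, M.sgn_sgn, A.sg_sg, sgn_ev_mu_sg, ev_neg_left, A.sg_append, A.sg_cons,
    A.rsgn_op_sg, ev_neg_mid, splitSum_neg]
  abel

/-- The terms in which the unit is multiplied with a neighbouring input. -/
theorem splitSum_op_unit {M N : AInfModule A} (F : PreHom M N) (m : M.V) (u v : List A.V) :
    splitSum u (fun p s => splitSum v fun q t => ev F m (A.sg p ++ A.op (s ++ A.e :: q) :: t))
      = (if v = [] then 0 else ev F m (A.sg u ++ v))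
        - (if u = [] then 0 else ev F m (A.sg u ++ v)) := by
  have h0 : ∀ p, splitSum v (fun q t => ev F m (A.sg p ++ A.op ([] ++ A.e :: q) :: t))
      = if v = [] then 0 else ev F m (A.sg p ++ v) := by
    intro p
    cases v with
    | nil => rw [splitSum_nil, A.op_unit_eq_zero (by simp)]; simp
    | cons y v =>
      rw [splitSum_cons, A.op_unit_eq_zero (by simp), ev_zero_mid, zero_add,
        splitSum_eq_left]
      · simp
      · intro a b _ ha
        have := List.length_pos_iff.2 ha
        rw [A.op_unit_eq_zero (by simp; omega), ev_zero_mid]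
  have h1 : ∀ p x, splitSum v (fun q t => ev F m (A.sg p ++ A.op ([x] ++ A.e :: q) :: t))
      = -ev F m (A.sg (p ++ [x]) ++ v) := by
    intro p x
    rw [splitSum_eq_left]
    · have : A.sgn x = -A.rsgn x := by simp [GradedSpace.rsgn]
      rw [List.singleton_append, A.op_unit_right, this, ev_neg_mid]
      simp
    · intro a b _ ha
      have := List.length_pos_iff.2 ha
      rw [A.op_unit_eq_zero (by simp; omega), ev_zero_mid]
  rcases List.eq_nil_or_concat u with rfl | ⟨u, x, rfl⟩
  · rw [splitSum_nil, h0]; simp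
  · rw [List.concat_eq_append, splitSum_append_cons, splitSum_nil, h0, splitSum_eq_right]
    · rw [List.nil_append, h1]
      rw [if_neg (show ¬(u ++ [x] = []) by simp)]; abel
    · intro a b _ hb
      have := List.length_pos_iff.2 hb
      exact splitSum_eq_zero fun q t _ => by
        rw [A.op_unit_eq_zero (by simp; omega), ev_zero_mid]

/-- In the differential evaluated on a list containing the unit, the terms in which the unit is an
input of a structure map cancel. -/
theorem ev_diff_twist_unit {M N : AInfModule A} (hM : M.StrictlyUnital) (hN : N.StrictlyUnital)
    (F : PreHom M N) (m : M.V) (u v : List A.V) :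
    ev (M.diff N (twist F)) m (u ++ A.e :: v)
      = splitSum u (fun p s => ev N.mu (ev F m (s ++ A.e :: v)) p)
      + splitSum v (fun p s => ev F (ev M.mu m s) (A.sg u ++ A.e :: A.sg p))
      - splitSum u (fun p r => splitSum r fun q s =>
          ev F m (A.sg p ++ A.op q :: (s ++ A.e :: v)))
      + splitSum v (fun p r => splitSum r fun q s =>
          ev F m (A.sg u ++ A.e :: (A.sg p ++ A.op q :: s))) := by
  have h1 : splitSum v (fun p s => ev N.mu (ev F m s) (u ++ A.e :: p))
      = if u = [] then ev F m (A.sg u ++ v) else 0 := by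
    split_ifs with hu
    · subst hu
      rw [splitSum_eq_left]
      · rw [List.nil_append, hN.ev_unit]; rfl
      · exact fun p s _ hp => hN.ev_eq_zero _ (Or.inr hp)
    · exact splitSum_eq_zero fun p s _ => hN.ev_eq_zero _ (Or.inl hu)
  have h2 : splitSum u (fun p s => ev F (ev M.mu m (s ++ A.e :: v)) (A.sg p))
      = if v = [] then ev F m (A.sg u ++ v) else 0 := by
    split_ifs with hv
    · subst hv
      rw [splitSum_eq_right]
      · rw [List.nil_append, hM.ev_unit, List.append_nil]
      · exact fun p s _ hs => by rw [hM.ev_eq_zero _ (Or.inl hs), ev_zero_left]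
    · exact splitSum_eq_zero fun p s _ => by rw [hM.ev_eq_zero _ (Or.inr hv), ev_zero_left]
  have h3 := splitSum_op_unit F m u v
  rw [ev_diff_twist]
  simp only [splitSum_append_cons, splitSum_add, A.sg_append, A.sg_cons, A.rsgn_unit, ev_neg_mid,
    List.append_assoc, List.cons_append, splitSum_neg, h1, h2, h3]
  split_ifs <;> abel

/-- Insertion of the unit after the inputs `a_p, …, a_1`, with signs on the inputs that it
passes. -/
noncomputable def insertUnit {M N : AInfModule A} (p : ℕ) (F : PreHom M N) : PreHom M N :=
  mkFam (fun m l => ev F (M.sgn m) (l.take p ++ A.e :: A.sg (l.drop p))) (by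
    have key : ∀ u v : List A.V, ∃ u' v' : List A.V, ∃ s : A.V →ₗ[ℂ] A.V, ∀ x,
        (u ++ x :: v).take p ++ A.e :: A.sg ((u ++ x :: v).drop p) = u' ++ s x :: v' := by
      intro u v
      rcases lt_or_ge u.length p with h | h
      · obtain ⟨q, rfl⟩ := Nat.exists_eq_add_of_lt h
        refine ⟨u, v.take q ++ A.e :: A.sg (v.drop q), LinearMap.id, fun x => ?_⟩
        rw [show u.length + q + 1 = u.length + (q + 1) by ring, List.take_length_add_append,
          List.drop_length_add_append]
        simp
      · refine ⟨u.take p ++ A.e :: A.sg (u.drop p), A.sg v, A.rsgn, fun x => ?_⟩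
        rw [List.take_append_of_le_length h, List.drop_append_of_le_length h]
        simp
    constructor
    · intro m m' l; rw [map_add, ev_add_left]
    · intro c m l; rw [map_smul, ev_smul_left]
    · intro m u v x y
      obtain ⟨u', v', s, e⟩ := key u v
      simp only [e, map_add, ev_add_mid]
    · intro m u v c x
      obtain ⟨u', v', s, e⟩ := key u v
      simp only [e, map_smul, ev_smul_mid])

theorem ev_insertUnit {M N : AInfModule A} (p : ℕ) (F : PreHom M N) (m : M.V) (l : List A.V) :
    ev (insertUnit p F) m l = ev F (M.sgn m) (l.take p ++ A.e :: A.sg (l.drop p)) :=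
  ev_mkFam _ _ _ _

theorem ev_insertUnit_append {M N : AInfModule A} {p : ℕ} (F : PreHom M N) (m : M.V)
    {u : List A.V} (hu : u.length = p) (v : List A.V) :
    ev (insertUnit p F) m (u ++ v) = ev F (M.sgn m) (u ++ A.e :: A.sg v) := by
  subst hu
  rw [ev_insertUnit, List.take_left, List.drop_left]

theorem insertUnit_mem_hom {M N : AInfModule A} {p : ℕ} {F : PreHom M N} {k : ℤ}
    (hF : F ∈ M.hom N k) : insertUnit p F ∈ M.hom N (k - 1) := by
  rw [mem_hom_iff] at hF ⊢
  intro m q l n hm hl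
  rw [← List.take_append_drop p l] at hl
  obtain ⟨a, b, ha, hb, rfl⟩ := hl.of_append
  rw [ev_insertUnit]
  convert hF _ _ _ _ (M.sgn_mem hm) (ha.append (.cons A.e_deg hb.sg)) using 2
  ring

theorem VanishesOnUnits.insertUnit {M N : AInfModule A} {p : ℕ} {F : PreHom M N}
    (hF : VanishesOnUnits p F) : VanishesOnUnits p (insertUnit p F) := by
  intro m u v h
  obtain ⟨q, rfl⟩ := Nat.exists_eq_add_of_lt h
  rw [ev_insertUnit, show u.length + q + 1 = u.length + (q + 1) by ring,
    List.take_length_add_append, List.drop_length_add_append, List.take_succ_cons,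
    List.append_assoc, List.cons_append]
  exact hF _ _ _ h

theorem VanishesOnUnits.ev_insertUnit_of_lt {M N : AInfModule A} {p : ℕ} {F : PreHom M N}
    (hF : VanishesOnUnits p F) (m : M.V) {l : List A.V} (hl : l.length < p) :
    ev (AInfModule.insertUnit p F) m l = 0 := by
  rw [ev_insertUnit, List.take_of_length_le hl.le, List.drop_eq_nil_of_le hl.le]
  exact hF _ _ _ hl

theorem VanishesOnUnits.diff_twist {M N : AInfModule A} (hM : M.StrictlyUnital)
    (hN : N.StrictlyUnital) {p : ℕ} {F : PreHom M N} (hF : VanishesOnUnits p F) :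
    VanishesOnUnits p (M.diff N (AInfModule.twist F)) := by
  intro m u v hu
  rw [ev_diff_twist_unit hM hN, splitSum_eq_zero, splitSum_eq_zero, splitSum_eq_zero,
    splitSum_eq_zero]
  · simp
  · exact fun a r _ => splitSum_eq_zero fun q s _ => hF _ _ _ (by simpa using hu)
  · refine fun a r e => splitSum_eq_zero fun q s e' => ?_
    subst e'; subst e
    cases q with
    | nil => simp
    | cons x q =>
      have := hF m (A.sg a ++ A.op (x :: q) :: s) v (by simp at hu ⊢; omega)
      simpa using this
  · exact fun a s _ => hF _ _ _ (by simpa using hu)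
  · intro a s e
    subst e
    rw [hF m s v (by simp at hu; omega), ev_zero_left]

/-- The contracting homotopy of the unreduced inputs: if `F` vanishes on units below `p` and its
differential is reduced, then inserting the unit at position `p` gives a family whose differential
is the value of `F` with the unit at that position. -/
theorem ev_diff_twist_insertUnit {M N : AInfModule A} (hM : M.StrictlyUnital)
    (hN : N.StrictlyUnital) {F : PreHom M N} {u : List A.V} (hF : VanishesOnUnits u.length F)
    (hd : IsReduced (M.diff N (twist F))) (m : M.V) (v : List A.V) :
    ev (M.diff N (twist (insertUnit u.length F))) m (u ++ A.e :: v)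
      = ev F (M.sgn m) (A.sg u ++ A.e :: A.sg v) := by
  have H := hd (M.sgn m) u (A.e :: A.sg v)
  rw [ev_diff_twist_unit hM hN] at H ⊢
  have a1 : splitSum u (fun p s => ev N.mu (ev (insertUnit u.length F) m (s ++ A.e :: v)) p)
      = -N.mu1 (ev F (M.sgn m) (u ++ A.e :: A.e :: A.sg v)) := by
    rw [splitSum_eq_left, ev_insertUnit_append F m rfl, ev_mu_nil]
    · simp only [A.sg_cons, A.rsgn_unit]
      have := ev_neg_mid F (M.sgn m) (u ++ [A.e]) (A.sg v) A.e
      simp only [List.append_assoc, List.cons_append, List.nil_append] at this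
      rw [this, map_neg]
    · intro p s e hp
      have := List.length_pos_iff.2 hp
      subst e
      rw [hF.insertUnit m s v (by simp; omega), ev_zero_left]
  have a2 : splitSum u (fun p s => ev N.mu (ev F (M.sgn m) (s ++ A.e :: A.e :: A.sg v)) p)
      = N.mu1 (ev F (M.sgn m) (u ++ A.e :: A.e :: A.sg v)) := by
    rw [splitSum_eq_left, ev_mu_nil]
    intro p s e hp
    have := List.length_pos_iff.2 hp
    subst e
    rw [hF _ s _ (by simp; omega), ev_zero_left]
  have neg2 : ∀ x (s t : List A.V), ev F x (s ++ A.e :: -A.e :: t)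
      = -ev F x (s ++ A.e :: A.e :: t) := by
    intro x s t
    have := ev_neg_mid F x (s ++ [A.e]) t A.e
    simpa using this
  have b1 : ∀ p s, ev (insertUnit u.length F) (ev M.mu m s) (A.sg u ++ A.e :: A.sg p)
      = ev F (ev M.mu (M.sgn m) (A.sg s)) (A.sg u ++ A.e :: A.e :: p) := by
    intro p s
    rw [ev_insertUnit_append F _ (by simp)]
    simp only [A.sg_cons, A.rsgn_unit, A.sg_sg, neg2, M.sgn_ev_mu, ev_neg_left, neg_neg]
  have b2 : splitSum (A.e :: A.sg v) (fun p s =>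
        ev F (ev M.mu (M.sgn m) s) (A.sg u ++ A.e :: A.sg p))
      = (if v = [] then ev F (M.sgn m) (A.sg u ++ A.e :: A.sg v) else 0)
        - splitSum v (fun p s =>
          ev F (ev M.mu (M.sgn m) (A.sg s)) (A.sg u ++ A.e :: A.e :: p)) := by
    rw [splitSum_cons, A.splitSum_sg]
    simp only [A.sg_cons, A.rsgn_unit, A.sg_sg, neg2, splitSum_neg, A.sg_nil]
    rw [sub_eq_add_neg]
    congr 1
    split_ifs with hv
    · subst hv
      rw [A.sg_nil, hM.ev_unit]
    · have := hM.ev_eq_zero (M.sgn m) (u := []) (v := A.sg v)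
        (Or.inr (by simpa [AInfAlgebra.sg] using hv))
      rw [List.nil_append] at this
      rw [this, ev_zero_left]
  have c1 : splitSum u (fun p r => splitSum r fun q s =>
        ev (insertUnit u.length F) m (A.sg p ++ A.op q :: (s ++ A.e :: v)))
      = -splitSum u (fun p r => splitSum r fun q s =>
        ev F (M.sgn m) (A.sg p ++ A.op q :: (s ++ A.e :: A.e :: A.sg v))) := by
    rw [← splitSum_neg]
    refine splitSum_congr fun p r e => ?_
    rw [← splitSum_neg]
    refine splitSum_congr fun q s e' => ?_
    subst e'
    rw [show A.sg p ++ A.op q :: (s ++ A.e :: v) = (A.sg p ++ A.op q :: s) ++ A.e :: v by simp,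
      show A.sg p ++ A.op q :: (s ++ A.e :: A.e :: A.sg v)
        = (A.sg p ++ A.op q :: s) ++ A.e :: A.e :: A.sg v by simp]
    match q, e with
    | [], _ => simp
    | [x], e =>
      rw [ev_insertUnit_append F m (by rw [← e]; simp)]
      simp only [A.sg_cons, A.rsgn_unit, neg2]
    | x :: y :: q, e =>
      have hlt : (A.sg p ++ A.op (x :: y :: q) :: s).length < u.length := by
        rw [← e]; simp
      rw [hF.insertUnit m _ v hlt, hF _ _ _ hlt, neg_zero]
  have d1 : ∀ p q s, ev (insertUnit u.length F) m (A.sg u ++ A.e :: (A.sg p ++ A.op q :: s))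
      = ev F (M.sgn m) (A.sg u ++ A.e :: A.e :: (p ++ A.op (A.sg q) :: A.sg s)) := by
    intro p q s
    rw [ev_insertUnit_append F _ (by simp)]
    have h := ev_neg_mid F (M.sgn m) (A.sg u ++ A.e :: A.e :: p) (A.sg s) (A.op (A.sg q))
    simp only [List.append_assoc, List.cons_append] at h
    simp only [A.sg_cons, A.rsgn_unit, A.sg_append, A.sg_sg, A.rsgn_op, neg2, h, neg_neg]
  have d2 : splitSum (A.e :: A.sg v) (fun p r => splitSum r fun q s =>
        ev F (M.sgn m) (A.sg u ++ A.e :: (A.sg p ++ A.op q :: s)))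
      = (if v = [] then 0 else ev F (M.sgn m) (A.sg u ++ A.e :: A.sg v))
        - splitSum v (fun p r => splitSum r fun q s =>
          ev F (M.sgn m) (A.sg u ++ A.e :: A.e :: (p ++ A.op (A.sg q) :: A.sg s))) := by
    rw [splitSum_cons, A.splitSum_sg]
    simp only [A.splitSum_sg, A.sg_cons, A.rsgn_unit, A.sg_sg, List.cons_append, neg2,
      splitSum_neg, A.sg_nil, List.nil_append]
    rw [sub_eq_add_neg]
    congr 1
    have h := splitSum_op_unit F (M.sgn m) [] (A.sg v)
    have hz := ev_zero_mid F (M.sgn m) (A.sg u ++ [A.e]) (A.e :: A.sg v)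
    simp only [List.append_assoc, List.cons_append, List.nil_append] at hz
    rw [splitSum_cons, A.op_nil, hz, zero_add, A.splitSum_sg]
    match v with
    | [] =>
      have := AInfAlgebra.op_unit_eq_zero (A := A) (u := []) (v := []) (by simp)
      have hz := ev_zero_mid F (M.sgn m) (A.sg u ++ [A.e]) []
      simp only [List.append_assoc, List.cons_append, List.nil_append] at hz this
      simp [this, hz]
    | y :: v =>
      have hop : ∀ q : List A.V, q.length ≠ 1 → ∀ t,
          ev F (M.sgn m) (A.sg u ++ A.e :: A.op (A.e :: q) :: t) = 0 := by
        intro q hq t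
        have h := AInfAlgebra.op_unit_eq_zero (A := A) (u := []) (v := q) (by simpa using hq)
        have hz := ev_zero_mid F (M.sgn m) (A.sg u ++ [A.e]) t
        simp only [List.append_assoc, List.cons_append, List.nil_append] at hz h
        rw [h, hz]
      rw [splitSum_cons, hop _ (by simp), zero_add, splitSum_eq_left]
      · simp
      · intro a b _ ha
        have := List.length_pos_iff.2 ha
        exact hop _ (by simp; omega) _
  simp only [a1, b1, c1, d1]
  simp only [a2, b2, d2] at H
  have hu : (if v = [] then ev F (M.sgn m) (A.sg u ++ A.e :: A.sg v) else 0)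
      + (if v = [] then 0 else ev F (M.sgn m) (A.sg u ++ A.e :: A.sg v))
      = ev F (M.sgn m) (A.sg u ++ A.e :: A.sg v) := by
    split_ifs <;> simp
  linear_combination (norm := abel) hu - H

/-- One more input is made to ignore units, by a coboundary which does not affect the components
with fewer than `p` algebra inputs. -/
theorem exists_vanishesOnUnits_succ {M N : AInfModule A} (hM : M.StrictlyUnital)
    (hN : N.StrictlyUnital) {p : ℕ} {k : ℤ} {φ : PreHom M N} (hk : φ ∈ M.hom N k)
    (hφ : VanishesOnUnits p φ) (hd : IsReduced (M.diff N φ)) :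
    ∃ η ∈ M.hom N (k - 1), (∀ m l, l.length < p → ev η m l = 0) ∧
      VanishesOnUnits (p + 1) (φ + M.diff N η) := by
  refine ⟨twist (insertUnit p (twist φ)), twist_mem_hom (insertUnit_mem_hom (twist_mem_hom hk)),
    fun m l hl => ?_, fun m u v hu => ?_⟩
  · rw [ev_twist, hφ.twist.ev_insertUnit_of_lt _ (by simpa using hl)]
  · rw [ev_add_fam]
    rcases Nat.lt_succ_iff_lt_or_eq.1 hu with h | h
    · rw [hφ m u v h, hφ.twist.insertUnit.diff_twist hM hN m u v h, add_zero]
    · subst h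
      rw [ev_diff_twist_insertUnit hM hN hφ.twist (by rwa [twist_twist])]
      simp

/-- Inclusion of the reduced morphism complex is injective on cohomology: a family with reduced
differential can be replaced by a reduced family with the same differential. -/
theorem exists_reduced {M N : AInfModule A} (hM : M.StrictlyUnital)
    (hN : N.StrictlyUnital) {k : ℤ} {φ : PreHom M N} (hk : φ ∈ M.hom N k)
    (hd : IsReduced (M.diff N φ)) :
    ∃ ψ ∈ M.hom N k, IsReduced ψ ∧ M.diff N ψ = M.diff N φ := by
  let S : ℕ → Type u := fun p => {ψ : PreHom M N // ψ ∈ M.hom N k ∧ VanishesOnUnits p ψ ∧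
    M.diff N ψ = M.diff N φ}
  have step : ∀ p (ψ : S p), ∃ ψ' : S (p + 1), ∀ m l, l.length < p →
      ev ψ'.1 m l = ev ψ.1 m l := by
    rintro p ⟨ψ, h1, h2, h3⟩
    obtain ⟨η, hη, h0, hv⟩ := exists_vanishesOnUnits_succ hM hN h1 h2 (by rwa [h3])
    refine ⟨⟨ψ + M.diff N η, add_mem h1 ?_, hv, ?_⟩, fun m l hl => ?_⟩
    · have := diff_mem_hom hη
      rwa [sub_add_cancel] at this
    · rw [map_add, diff_diff, add_zero, h3]
    · rw [ev_add_fam, ev_diff_congr (ψ := 0) (fun m l hl => by rw [h0 m l hl, ev_zero_fam]) m l hl,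
        map_zero, ev_zero_fam, add_zero]
  choose next hnext using step
  let f : ∀ p, S p := fun p => Nat.rec
    (⟨φ, hk, fun _ _ _ h => absurd h (Nat.not_lt_zero _), rfl⟩ : S 0) (fun p ψ => next p ψ) p
  have hf : ∀ n m l, l.length < n → ev (f (n + 1)).1 m l = ev (f n).1 m l :=
    fun n => hnext n (f n)
  refine ⟨limFam fun n => (f n).1, limFam_mem_hom fun n => (f n).2.1, fun m u v => ?_,
    fam_ext fun m l => ?_⟩
  · rw [ev_limFam hf m (Nat.lt_succ_self _)]
    exact (f ((u ++ A.e :: v).length + 1)).2.2.1 m u v (by simp)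
  · exact (ev_diff_limFam hf m (Nat.lt_succ_self _)).trans
      (congrArg (fun ψ => ev ψ m l) (f (l.length + 1)).2.2.2)

end AInfModule
end AInf

namespace AInf

/-! ### Weights of a rational action -/

section Weights

variable {V : Type*} [AddCommGroup V] [Module ℂ V]

/-- The vectors of weight `n`. -/
def weightSpace (ρ : Representation ℂ ℂˣ V) (n : ℤ) : Submodule ℂ V where
  carrier := {v | ∀ g, ρ g v = (g : ℂ) ^ n • v}
  add_mem' := fun h h' g => by rw [map_add, h g, h' g, smul_add]
  zero_mem' := fun g => by simp
  smul_mem' := fun c v h g => by rw [map_smul, h g, smul_comm]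

/-- The character `g ↦ g^n` of `ℂ*`. -/
noncomputable def powChar (n : ℤ) : ℂˣ →* ℂ := (Units.coeHom ℂ).comp (zpowGroupHom n)

theorem powChar_apply (n : ℤ) (g : ℂˣ) : powChar n g = (g : ℂ) ^ n := by
  simp [powChar]

theorem powChar_injective : Function.Injective powChar := by
  intro m n h
  have := DFunLike.congr_fun h (Units.mk0 (2 : ℂ) (by norm_num))
  simp only [powChar_apply, Units.val_mk0] at this
  have h2 : ((2 : ℝ) ^ m) = (2 : ℝ) ^ n := by simpa using congrArg norm this
  exact (zpow_right_injective₀ (by norm_num) (by norm_num)) h2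

/-- Laurent polynomials with vector coefficients are determined by their values. -/
theorem laurent_eq_zero {c : ℤ →₀ V}
    (h : ∀ g : ℂˣ, (c.sum fun n w => (g : ℂ) ^ n • w) = 0) : c = 0 := by
  have hli := (linearIndependent_monoidHom ℂˣ ℂ).comp _ powChar_injective
  ext n
  refine (Module.forall_dual_apply_eq_zero_iff ℂ (c n)).1 fun f => ?_
  have := linearIndependent_iff.1 hli (c.mapRange f (map_zero f)) (by
    ext g
    have hg := congrArg f (h g)
    rw [map_zero, Finsupp.sum, map_sum] at hg
    rw [Finsupp.linearCombination_apply, Finsupp.sum_mapRange_index (by simp), Finsupp.sum,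
      Finset.sum_apply, Pi.zero_apply, ← hg]
    refine Finset.sum_congr rfl fun m _ => ?_
    simp [powChar_apply, mul_comm])
  exact DFunLike.congr_fun this n

variable {ρ : Representation ℂ ℂˣ V}

/-- The decomposition of a vector into its weight components. -/
noncomputable def weightMap (h : IsRational ρ) : V →ₗ[ℂ] (ℤ →₀ V) := by
  choose c hc using h
  have huniq : ∀ v (c' : ℤ →₀ V), (∀ g : ℂˣ, ρ g v = c'.sum fun n w => (g : ℂ) ^ n • w) →
      c v = c' := by
    intro v c' hc'
    refine sub_eq_zero.1 (laurent_eq_zero fun g => ?_)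
    rw [Finsupp.sum_sub_index (by intros; rw [smul_sub]), ← hc, ← hc', sub_self]
  exact
    { toFun := c
      map_add' := fun v w => huniq _ _ fun g => by
        rw [map_add, hc, hc, Finsupp.sum_add_index' (by simp) (by intros; rw [smul_add])]
      map_smul' := fun a v => huniq _ _ fun g => by
        rw [map_smul, hc, Finsupp.sum_smul_index' (by simp), RingHom.id_apply, Finsupp.smul_sum]
        exact Finsupp.sum_congr fun n _ => smul_comm _ _ _ }

theorem rep_eq_sum_weightMap (h : IsRational ρ) (g : ℂˣ) (v : V) :
    ρ g v = (weightMap h v).sum fun n w => (g : ℂ) ^ n • w :=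
  Classical.choose_spec (h v) g

theorem weightMap_eq (h : IsRational ρ) {v : V} {c : ℤ →₀ V}
    (hc : ∀ g : ℂˣ, ρ g v = c.sum fun n w => (g : ℂ) ^ n • w) : weightMap h v = c := by
  refine sub_eq_zero.1 (laurent_eq_zero fun g => ?_)
  rw [Finsupp.sum_sub_index (by intros; rw [smul_sub]), ← hc, ← rep_eq_sum_weightMap, sub_self]

theorem weightMap_of_mem (h : IsRational ρ) {v : V} {n : ℤ} (hv : v ∈ weightSpace ρ n) :
    weightMap h v = Finsupp.single n v :=
  weightMap_eq h fun g => by rw [hv g, Finsupp.sum_single_index (by simp)]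

theorem weightMap_mem (h : IsRational ρ) (v : V) (n : ℤ) :
    weightMap h v n ∈ weightSpace ρ n := by
  intro g
  have h1 : weightMap h (ρ g v)
      = (weightMap h v).mapRange (ρ g) (map_zero _) := by
    refine weightMap_eq h fun k => ?_
    rw [← Module.End.mul_apply, ← map_mul, mul_comm, map_mul, Module.End.mul_apply,
      rep_eq_sum_weightMap h k v, Finsupp.sum_mapRange_index (by simp), Finsupp.sum, Finsupp.sum,
      map_sum]
    simp only [map_smul]
  have h2 : weightMap h (ρ g v)
      = Finsupp.onFinset (weightMap h v).support (fun n => (g : ℂ) ^ n • weightMap h v n) (by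
          intro a ha
          rw [Finsupp.mem_support_iff]
          rintro h0
          rw [h0, smul_zero] at ha
          exact ha rfl) := by
    refine weightMap_eq h fun k => ?_
    rw [← Module.End.mul_apply, ← map_mul, rep_eq_sum_weightMap h (k * g) v]
    rw [Finsupp.onFinset_sum _ (by simp), Finsupp.sum]
    refine Finset.sum_congr rfl fun n _ => ?_
    rw [smul_smul, Units.val_mul, mul_zpow]
  have := DFunLike.congr_fun (h1.symm.trans h2) n
  simpa using this

theorem sum_weightMap (h : IsRational ρ) (v : V) :
    ((weightMap h v).sum fun _ w => w) = v := by
  have := rep_eq_sum_weightMap h 1 v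
  simpa using this.symm

theorem span_weightSpace (h : IsRational ρ) :
    Submodule.span ℂ {v | ∃ n, v ∈ weightSpace ρ n} = ⊤ := by
  rw [eq_top_iff]
  rintro v -
  rw [← sum_weightMap h v]
  exact Submodule.sum_mem _ fun n _ => Submodule.subset_span ⟨n, weightMap_mem h v n⟩

/-- Weight components of vectors in an invariant subspace lie in that subspace. -/
theorem weightMap_mem_of_invariant (h : IsRational ρ) {p : Submodule ℂ V}
    (hp : ∀ g, ∀ v ∈ p, ρ g v ∈ p) {v : V} (hv : v ∈ p) (n : ℤ) : weightMap h v n ∈ p := by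
  have := laurent_eq_zero (c := (weightMap h v).mapRange p.mkQ (map_zero _)) fun g => by
    rw [Finsupp.sum_mapRange_index (by simp)]
    have h1 : p.mkQ (ρ g v) = 0 := (Submodule.Quotient.mk_eq_zero _).2 (hp g v hv)
    rw [rep_eq_sum_weightMap h, Finsupp.sum, map_sum] at h1
    simpa only [Finsupp.sum, map_smul] using h1
  have := DFunLike.congr_fun this n
  exact (Submodule.Quotient.mk_eq_zero _).1 (by simpa using this)

end Weights

/-! ### Total weight components of multilinear maps -/

section Laurent

variable {V : Type*} [AddCommGroup V] [Module ℂ V] {ρ : Representation ℂ ℂˣ V}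
  {W X : Type*} [AddCommGroup W] [Module ℂ W] [AddCommGroup X] [Module ℂ X]

open Classical in
/-- The multilinear map `a ↦ ∑_w f_w(a) z^w`, where `f_w(a)` is the part of `f(a)` coming from
inputs of total weight `w`; this is the Laurent polynomial `z ↦ f(z a)`. -/
noncomputable def laurentMap (h : IsRational ρ) {d : ℕ}
    (f : MultilinearMap ℂ (fun _ : Fin d => V) W) :
    MultilinearMap ℂ (fun _ : Fin d => V) (ℤ →₀ W) :=
  (MultilinearMap.fromDFinsuppEquiv (fun _ : Fin d => ℤ) ℂ (M := fun _ _ => V)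
    fun p => (Finsupp.lsingle (∑ i, p i)).compMultilinearMap f).compLinearMap
      fun _ => (finsuppLequivDFinsupp ℂ).toLinearMap ∘ₗ weightMap h

theorem laurentMap_apply (h : IsRational ρ) {d : ℕ}
    (f : MultilinearMap ℂ (fun _ : Fin d => V) W) (a : Fin d → V) :
    laurentMap h f a = ∑ p ∈ Fintype.piFinset (fun i => (weightMap h (a i)).support),
      Finsupp.single (∑ i, p i) (f fun i => weightMap h (a i) (p i)) := by
  classical
  rw [laurentMap, MultilinearMap.compLinearMap_apply, MultilinearMap.fromDFinsuppEquiv_apply]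
  refine Finset.sum_congr ?_ fun p _ => rfl
  congr 1
  funext i
  ext n
  simp

theorem laurentMap_of_mem (h : IsRational ρ) {d : ℕ}
    (f : MultilinearMap ℂ (fun _ : Fin d => V) W) (a : Fin d → V) (n : Fin d → ℤ)
    (ha : ∀ i, a i ∈ weightSpace ρ (n i)) :
    laurentMap h f a = Finsupp.single (∑ i, n i) (f a) := by
  classical
  rw [laurentMap, MultilinearMap.compLinearMap_apply]
  have : ∀ i, ((finsuppLequivDFinsupp ℂ).toLinearMap ∘ₗ weightMap h) (a i)
      = DFinsupp.single (n i) (a i) := by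
    intro i
    rw [LinearMap.comp_apply, weightMap_of_mem h (ha i)]
    exact Finsupp.toDFinsupp_single _ _
  simp only [this]
  rw [MultilinearMap.fromDFinsuppEquiv_single]
  rfl

/-- The decomposition of a family according to the total weight of the algebra inputs. -/
noncomputable def laurentFam (h : IsRational ρ) (φ : Fam V X W) : Fam V X (ℤ →₀ W) := fun d =>
  { toFun := fun m => laurentMap h (φ d m)
    map_add' := by
      intro m m'
      ext1 a
      rw [_root_.add_apply]
      simp only [laurentMap_apply, map_add, _root_.add_apply, Finsupp.single_add,
        Finset.sum_add_distrib]
    map_smul' := by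
      intro c m
      ext1 a
      rw [RingHom.id_apply, _root_.smul_apply]
      simp only [laurentMap_apply, map_smul, _root_.smul_apply, Finset.smul_sum,
        Finsupp.smul_single] }

theorem ev_laurentFam (h : IsRational ρ) (φ : Fam V X W) (m : X) (l : List V) :
    ev (laurentFam h φ) m l
      = laurentMap h (φ l.length m) (block 0 l.length (toSeq l)) := rfl

end Laurent

variable {A : AInfAlgebra.{u}} (α : A.Action)

/-- `α.HasWeight l w` says that the entries of `l` are weight vectors, of total weight `w`. -/
inductive AInfAlgebra.Action.HasWeight : List A.V → ℤ → Prop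
  | nil : HasWeight [] 0
  | cons {a : A.V} {n : ℤ} {l : List A.V} {w : ℤ} : a ∈ weightSpace α.rep n → HasWeight l w →
      HasWeight (a :: l) (n + w)

variable {α}

namespace AInfAlgebra.Action

theorem HasWeight.append {l l' : List A.V} {n n' : ℤ} (h : α.HasWeight l n)
    (h' : α.HasWeight l' n') : α.HasWeight (l ++ l') (n + n') := by
  induction h with
  | nil => simpa
  | cons ha _ ih => rw [List.cons_append, add_assoc]; exact .cons ha ih

theorem HasWeight.of_append {l l' : List A.V} {n : ℤ} (h : α.HasWeight (l ++ l') n) :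
    ∃ p q, α.HasWeight l p ∧ α.HasWeight l' q ∧ n = p + q := by
  induction l generalizing n with
  | nil => exact ⟨0, n, .nil, h, by simp⟩
  | cons a l ih =>
    cases h with
    | cons ha h =>
      obtain ⟨p, q, hp, hq, rfl⟩ := ih h
      exact ⟨_, q, .cons ha hp, hq, by ring⟩

theorem rep_sgn (α : A.Action) (g : ℂˣ) (a : A.V) : α.rep g (A.sgn a) = A.sgn (α.rep g a) := by
  induction a using A.induction with
  | h n a ha => rw [A.sgn_apply ha, A.sgn_apply (α.rep_deg g n a ha), map_smul]
  | hadd a b ha hb => simp only [map_add, ha, hb]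

theorem rsgn_mem {a : A.V} {n : ℤ} (ha : a ∈ weightSpace α.rep n) :
    A.rsgn a ∈ weightSpace α.rep n := by
  refine neg_mem fun g => ?_
  rw [α.rep_sgn, ha g, map_smul]

theorem HasWeight.sg {l : List A.V} {n : ℤ} (h : α.HasWeight l n) : α.HasWeight (A.sg l) n := by
  induction h with
  | nil => exact .nil
  | cons ha _ ih => exact .cons (rsgn_mem ha) ih

theorem exists_hasWeight {l : List A.V}
    (h : ∀ a ∈ l, a ∈ {v : A.V | ∃ n, v ∈ weightSpace α.rep n}) : ∃ n, α.HasWeight l n := by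
  induction l with
  | nil => exact ⟨0, .nil⟩
  | cons a l ih =>
    obtain ⟨n, hn⟩ := h a (by simp)
    obtain ⟨N, hN⟩ := ih fun b hb => h b (by simp [hb])
    exact ⟨_, .cons hn hN⟩

theorem HasWeight.exists_fun {l : List A.V} {w : ℤ} (h : α.HasWeight l w) :
    ∃ n : Fin l.length → ℤ,
      (∀ k, block 0 l.length (toSeq l) k ∈ weightSpace α.rep (n k)) ∧ ∑ k, n k = w := by
  induction h with
  | nil => exact ⟨Fin.elim0, fun k => k.elim0, by simp⟩
  | @cons a n l w ha _ ih =>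
    obtain ⟨f, hf, e⟩ := ih
    refine ⟨Fin.cons n f, fun k => ?_, ?_⟩
    · refine Fin.cases ?_ (fun k => ?_) k
      · simpa [block, toSeq] using ha
      · simpa [block, toSeq] using hf k
    · change ∑ k, (Fin.cons n f : Fin (l.length + 1) → ℤ) k = _
      rw [Fin.sum_univ_succ]
      simp only [Fin.cons_zero, Fin.cons_succ, e]

theorem ev_map_rep {V W : Type*} [AddCommGroup V] [Module ℂ V] [AddCommGroup W] [Module ℂ W]
    (φ : Fam A.V V W) (m : V) {l : List A.V} {w : ℤ} (h : α.HasWeight l w) (g : ℂˣ) :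
    ev φ m (l.map (α.rep g)) = (g : ℂ) ^ w • ev φ m l := by
  suffices H : ∀ u, ev φ m (u ++ l.map (α.rep g)) = (g : ℂ) ^ w • ev φ m (u ++ l) from H []
  induction h with
  | nil => simp
  | @cons a n l w ha _ ih =>
    intro u
    have h := ih (u ++ [α.rep g a])
    simp only [List.append_assoc, List.singleton_append] at h
    rw [List.map_cons, h, ha g, ev_smul_mid, smul_smul, ← zpow_add₀ g.ne_zero, add_comm w]

theorem rep_op (α : A.Action) (g : ℂˣ) (l : List A.V) :
    α.rep g (A.op l) = A.op (l.map (α.rep g)) := by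
  rw [op, op, ev_toFam, ev_toFam, evA, α.equivariant]
  refine Eq.trans (congrArg (A.mu l.length) (funext fun k => ?_))
    (apply_eq_evA (n := l.length) (i := 0) (b := toSeq (l.map (α.rep g))) A.mu (by simp)
      fun k _ => by rw [zero_add]; rfl)
  simp only [block, toSeq, zero_add]
  exact (getD_map (α.rep g) l k).symm

theorem op_mem_weightSpace {l : List A.V} {w : ℤ} (h : α.HasWeight l w) :
    A.op l ∈ weightSpace α.rep w := fun g => by
  rw [α.rep_op, op, ev_map_rep _ _ h]; rfl

theorem rep_unit (α : A.Action) (g : ℂˣ) : α.rep g A.e = A.e := by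
  have h := α.rep_op g [A.e, α.rep g⁻¹ A.e]
  have h1 : α.rep g (α.rep g⁻¹ A.e) = A.e := by
    rw [← Module.End.mul_apply, ← map_mul, mul_inv_cancel, map_one, Module.End.one_apply]
  rw [A.op_unit_left, List.map_cons, List.map_cons, List.map_nil, h1, A.op_unit_right,
    A.sgn_apply (α.rep_deg g 0 _ A.e_deg)] at h
  simpa using h.symm

theorem unit_mem (α : A.Action) : A.e ∈ weightSpace α.rep 0 := fun g => by
  rw [α.rep_unit]; simp

theorem span_weight (α : A.Action) :
    Submodule.span ℂ {v : A.V | ∃ n, v ∈ weightSpace α.rep n} = ⊤ := span_weightSpace α.rational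

variable {V W : Type*} [AddCommGroup V] [Module ℂ V] [AddCommGroup W] [Module ℂ W]

theorem ev_laurentFam_of_hasWeight (φ : Fam A.V V W) (m : V) {l : List A.V} {w : ℤ}
    (h : α.HasWeight l w) : ev (laurentFam α.rational φ) m l = Finsupp.single w (ev φ m l) := by
  obtain ⟨n, hn, rfl⟩ := h.exists_fun
  rw [ev_laurentFam, laurentMap_of_mem _ _ _ n hn, ev]

theorem ev_laurentFam_mem {M N : AInfModule A} {φ : AInfModule.PreHom M N} {k : ℤ}
    (hφ : φ ∈ M.hom N k) {m : M.V} {p n : ℤ} {l : List A.V} (hm : m ∈ M.deg p)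
    (hl : A.HasDeg l n) (w : ℤ) : ev (laurentFam α.rational φ) m l w ∈ N.deg (p + n + k) := by
  classical
  obtain ⟨f, hf, e⟩ := hl.exists_fun
  rw [ev_laurentFam, laurentMap_apply, Finsupp.finsetSum_apply]
  refine Submodule.sum_mem _ fun q _ => ?_
  rw [Finsupp.single_apply]
  split_ifs
  · have := hφ l.length m p _ f hm fun i =>
      weightMap_mem_of_invariant α.rational (fun g v hv => α.rep_deg g _ v hv) (hf i) (q i)
    rw [← e]
    convert this using 2
    ring
  · exact zero_mem _

theorem laurentMap_unit {d : ℕ} (f : MultilinearMap ℂ (fun _ : Fin d => A.V) W)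
    (hf : ∀ a : Fin d → A.V, (∃ k, a k = A.e) → f a = 0) (a : Fin d → A.V)
    (ha : ∃ k, a k = A.e) : laurentMap α.rational f a = 0 := by
  rw [laurentMap_apply]
  refine Finset.sum_eq_zero fun p hp => ?_
  obtain ⟨k, hk⟩ := ha
  have h1 := (Fintype.mem_piFinset.1 hp) k
  rw [hk, weightMap_of_mem α.rational α.unit_mem, Finsupp.mem_support_iff,
    Finsupp.single_apply] at h1
  have h2 : (0 : ℤ) = p k := by
    by_contra h
    rw [if_neg h] at h1
    exact h1 rfl
  rw [hf _ ⟨k, by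
    simp only [hk, weightMap_of_mem α.rational α.unit_mem, ← h2, Finsupp.single_eq_same]⟩,
    Finsupp.single_zero]

end AInfAlgebra.Action

end AInf

namespace AInf

variable {A : AInfAlgebra.{u}} {α : A.Action}

namespace AInfModule

/-! ### The infinitesimal action -/

/-- The linear map `∑_w v_w z^w ↦ ∑_w w v_w`. -/
noncomputable def weightSum (W : Type*) [AddCommGroup W] [Module ℂ W] : (ℤ →₀ W) →ₗ[ℂ] W :=
  Finsupp.lsum ℂ fun w => (w : ℂ) • LinearMap.id

@[simp] theorem weightSum_single {W : Type*} [AddCommGroup W] [Module ℂ W] (w : ℤ) (v : W) :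
    weightSum W (Finsupp.single w v) = (w : ℂ) • v := by
  simp [weightSum]

/-- The infinitesimal deformation of a module along the action on the algebra: its value on algebra
inputs of total weight `w` is `w` times that of the structure maps. -/
noncomputable def deformation (α : A.Action) (M : AInfModule A) : PreHom M M :=
  postFam (weightSum M.V) (laurentFam α.rational M.mu)

theorem ev_deformation (M : AInfModule A) (m : M.V) {l : List A.V} {w : ℤ}
    (h : α.HasWeight l w) : ev (deformation α M) m l = (w : ℂ) • ev M.mu m l := by
  rw [deformation, ev_postFam, AInfAlgebra.Action.ev_laurentFam_of_hasWeight _ _ h,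
    weightSum_single]

theorem deformation_mem_hom (M : AInfModule A) : deformation α M ∈ M.hom M 1 := by
  rw [mem_hom_iff]
  intro m p l n hm hl
  rw [deformation, ev_postFam, weightSum, Finsupp.lsum_apply]
  exact Submodule.sum_mem _ fun w _ => Submodule.smul_mem _ _
    (AInfAlgebra.Action.ev_laurentFam_mem M.mu_mem_hom hm hl w)

/-- Every term of the relations of `M` is homogeneous for the total weight of the inputs, which is
why the deformation is closed. -/
theorem diff_deformation (M : AInfModule A) : M.diff M (deformation α M) = 0 := by
  refine fam_ext fun m l => ?_
  refine IsMultilin.eq_of_span (ev_isMultilin _) (ev_isMultilin _) α.span_weight m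
    (fun l hl => ?_) l
  obtain ⟨w, hw⟩ := AInfAlgebra.Action.exists_hasWeight hl
  have h1 : splitSum l (fun u v => ev M.mu (ev (deformation α M) (M.sgn m) (A.sg v)) u)
      + splitSum l (fun u v => ev (deformation α M) (ev M.mu (M.sgn m) (A.sg v)) u)
      = (w : ℂ) • splitSum l (fun u v => ev M.mu (ev M.mu (M.sgn m) (A.sg v)) u) := by
    rw [← splitSum_add, ← splitSum_smul]
    refine splitSum_congr fun u v e => ?_
    subst e
    obtain ⟨a, b, ha, hb, rfl⟩ := hw.of_append
    rw [ev_deformation M _ hb.sg, ev_deformation M _ ha, ev_smul_left, ← add_smul]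
    push_cast
    rw [add_comm]
  have h2 : splitSum l (fun u r => splitSum r fun v w =>
        ev (deformation α M) (M.sgn m) (u ++ A.op (A.sg v) :: A.sg w))
      = (w : ℂ) • splitSum l (fun u r => splitSum r fun v w =>
        ev M.mu (M.sgn m) (u ++ A.op (A.sg v) :: A.sg w)) := by
    rw [← splitSum_smul]
    refine splitSum_congr fun u r e => ?_
    rw [← splitSum_smul]
    refine splitSum_congr fun v s e' => ?_
    subst e'; subst e
    obtain ⟨a, b, ha, hb, rfl⟩ := hw.of_append
    obtain ⟨b, c, hv, hc, rfl⟩ := hb.of_append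
    rw [ev_deformation M _
      (ha.append (.cons (AInfAlgebra.Action.op_mem_weightSpace hv.sg) hc.sg))]
  rw [ev_diff, h1, h2, ← smul_add, add_comm, ev_relation_sg, smul_zero, ev_zero_fam]

theorem IsReduced.apply_eq_zero {V W : Type*} [AddCommGroup V] [Module ℂ V] [AddCommGroup W]
    [Module ℂ W] {φ : Fam A.V V W} (hφ : IsReduced φ) (d : ℕ) (m : V) (a : Fin d → A.V)
    (ha : ∃ k, a k = A.e) : φ d m a = 0 := by
  obtain ⟨k, hk⟩ := ha
  obtain ⟨u, v, -, e⟩ := ofFn_update a k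
  rw [apply_eq_ev_ofFn, ← Function.update_eq_self k a, e, hk, hφ]

theorem deformation_isReduced {M : AInfModule A} (hM : M.StrictlyUnital) :
    IsReduced (deformation α M) := by
  intro m u v
  by_cases h : u = [] ∧ v = []
  · obtain ⟨rfl, rfl⟩ := h
    rw [List.nil_append, ev_deformation M m (.cons α.unit_mem .nil)]
    simp
  · rw [deformation, ev_postFam, ev_laurentFam, AInfAlgebra.Action.laurentMap_unit, map_zero]
    · intro a ha
      refine hM.mu_unit _ (fun h1 => h ?_) m a ha
      simp only [List.length_append, List.length_cons] at h1
      exact ⟨List.length_eq_zero_iff.1 (by omega), List.length_eq_zero_iff.1 (by omega)⟩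
    · exact ⟨⟨u.length, by simp⟩, block_toSeq_append_cons u v A.e⟩

/-- A rigid module carries an infinitesimal action of `ℂ*` compatible with that on `A`, up to
homotopies which may be chosen to be reduced. -/
theorem exists_connection (α : A.Action) {M : AInfModule A} (hM : M.StrictlyUnital)
    (hr : Subsingleton (M.HomH M 1)) :
    ∃ D ∈ M.hom M 0, IsReduced D ∧ M.diff M D = deformation α M := by
  have := Subsingleton.elim (α := M.HomH M 1)
    (Submodule.Quotient.mk ⟨deformation α M, deformation_mem_hom M, diff_deformation M⟩) 0
  obtain ⟨D, hD, e⟩ := (Submodule.Quotient.mk_eq_zero _).1 this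
  have e : M.diff M D = deformation α M := e
  rw [← e]
  rw [sub_self] at hD
  exact exists_reduced hM hM hD (by rw [e]; exact deformation_isReduced hM)

end AInfModule

/-! ### Extension of scalars to polar parts -/

section Polar

variable {V W X : Type*} [AddCommGroup V] [Module ℂ V] [AddCommGroup W] [Module ℂ W]
  [AddCommGroup X] [Module ℂ X]

/-- The map `∑_w v_w z^w ↦ ∑_w v_w (t - λ - w)^{-k-1}` for `p = (λ, k)`.

Polar parts are the elements of `ℂ(t)/ℂ[t]`, which has the basis `(t - λ)^{-k-1}` for
`(λ, k) ∈ ℂ × ℕ`; its tensor product with `W` is modelled by `ℂ × ℕ →₀ W`. -/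
noncomputable def translate (W : Type*) [AddCommGroup W] [Module ℂ W] (p : ℂ × ℕ) :
    (ℤ →₀ W) →ₗ[ℂ] (ℂ × ℕ →₀ W) :=
  Finsupp.lmapDomain W ℂ fun w => (p.1 + w, p.2)

@[simp] theorem translate_single (p : ℂ × ℕ) (w : ℤ) (v : W) :
    translate W p (Finsupp.single w v) = Finsupp.single (p.1 + (w : ℂ), p.2) v := by
  simp [translate]

/-- The extension of a family to polar parts, on which inputs of total weight `w` translate poles
by `w`. -/
noncomputable def extFam (α : A.Action) (φ : Fam A.V V W) :
    Fam A.V (ℂ × ℕ →₀ V) (ℂ × ℕ →₀ W) := fun d =>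
  Finsupp.lsum ℂ fun p => (translate W p).compMultilinearMapₗ ℂ ∘ₗ laurentFam α.rational φ d

theorem extFam_single (φ : Fam A.V V W) (d : ℕ) (p : ℂ × ℕ) (m : V) (a : Fin d → A.V) :
    extFam α φ d (Finsupp.single p m) a = translate W p (laurentMap α.rational (φ d m) a) := by
  rw [extFam, Finsupp.lsum_single]; rfl

theorem ev_extFam_single (φ : Fam A.V V W) (p : ℂ × ℕ) (m : V) {l : List A.V} {w : ℤ}
    (h : α.HasWeight l w) :
    ev (extFam α φ) (Finsupp.single p m) l = Finsupp.single (p.1 + (w : ℂ), p.2) (ev φ m l) := by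
  rw [ev, extFam_single, ← ev_laurentFam, AInfAlgebra.Action.ev_laurentFam_of_hasWeight _ _ h,
    translate_single]

/-- Two multilinear functions on polar parts agree if they agree on `m (t - λ)^{-k-1}` and weight
vectors. -/
theorem IsMultilin.eq_of_polar (α : A.Action) {F G : (ℂ × ℕ →₀ V) → List A.V → X}
    (hF : IsMultilin F) (hG : IsMultilin G)
    (h : ∀ p m l w, α.HasWeight l w → F (Finsupp.single p m) l = G (Finsupp.single p m) l)
    (x : ℂ × ℕ →₀ V) (l : List A.V) : F x l = G x l := by
  induction x using Finsupp.induction_linear with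
  | zero =>
    have h1 := hF.smul_left 0 0 l
    have h2 := hG.smul_left 0 0 l
    rw [zero_smul, zero_smul] at h1 h2
    rw [h1, h2]
  | add x y hx hy => rw [hF.add_left, hG.add_left, hx, hy]
  | single p m =>
    refine hF.eq_of_span hG α.span_weight _ (fun l hl => ?_) l
    obtain ⟨w, hw⟩ := AInfAlgebra.Action.exists_hasWeight hl
    exact h p m l w hw

theorem IsMultilin.add {F G : V → List A.V → W} (hF : IsMultilin F) (hG : IsMultilin G) :
    IsMultilin fun m l => F m l + G m l := by
  constructor
  · intro m m' l; rw [hF.add_left, hG.add_left]; abel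
  · intro c m l; rw [hF.smul_left, hG.smul_left, smul_add]
  · intro m u v x y; rw [hF.add_mid, hG.add_mid]; abel
  · intro m u v c x; rw [hF.smul_mid, hG.smul_mid, smul_add]

theorem isMultilin_comp (φ : Fam A.V W X) (ψ : Fam A.V V W) :
    IsMultilin fun m l => splitSum l fun u v => ev φ (ev ψ m v) (A.sg u) := by
  constructor
  · intro m m' l; simp only [ev_add_left, splitSum_add]
  · intro c m l; simp only [ev_smul_left, splitSum_smul]
  · intro m u v x y
    simp only [splitSum_append_cons, A.sg_append, A.sg_cons, map_add, ev_add_mid, ev_add_left,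
      splitSum_add]
    abel
  · intro m u v c x
    simp only [splitSum_append_cons, A.sg_append, A.sg_cons, map_smul, ev_smul_mid, ev_smul_left,
      splitSum_smul, smul_add]

theorem isMultilin_comp_op (φ : Fam A.V V W) :
    IsMultilin fun m l => splitSum l fun u r => splitSum r fun v w =>
      ev φ m (A.sg u ++ A.op v :: w) := by
  have hadd : ∀ m (u s w : List A.V) z x y, ev φ m (u ++ z :: (s ++ (x + y) :: w))
      = ev φ m (u ++ z :: (s ++ x :: w)) + ev φ m (u ++ z :: (s ++ y :: w)) := by
    intro m u s w z x y
    simpa using ev_add_mid φ m (u ++ z :: s) w x y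
  have hsmul : ∀ m (u s w : List A.V) z (c : ℂ) x, ev φ m (u ++ z :: (s ++ (c • x) :: w))
      = c • ev φ m (u ++ z :: (s ++ x :: w)) := by
    intro m u s w z c x
    simpa using ev_smul_mid φ m (u ++ z :: s) w c x
  have oadd : ∀ (u w : List A.V) x y, A.op (u ++ (x + y) :: w)
      = A.op (u ++ x :: w) + A.op (u ++ y :: w) := fun u w x y => ev_add_mid _ _ _ _ _ _
  have osmul : ∀ (u w : List A.V) (c : ℂ) x, A.op (u ++ (c • x) :: w)
      = c • A.op (u ++ x :: w) := fun u w c x => ev_smul_mid _ _ _ _ _ _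
  constructor
  · intro m m' l; simp only [ev_add_left, splitSum_add]
  · intro c m l; simp only [ev_smul_left, splitSum_smul]
  · intro m u v x y
    simp only [splitSum_append_cons, A.sg_append, A.sg_cons, map_add, ev_add_mid, hadd, oadd,
      splitSum_add, List.append_assoc, List.cons_append]
    abel
  · intro m u v c x
    simp only [splitSum_append_cons, A.sg_append, A.sg_cons, map_smul, ev_smul_mid, hsmul, osmul,
      splitSum_smul, splitSum_add, smul_add, List.append_assoc, List.cons_append]

end Polar

/-- The polar parts with coefficients in `X.deg n`. -/
def GradedSpace.polarDeg (X : GradedSpace.{u}) (n : ℤ) : Submodule ℂ (ℂ × ℕ →₀ X.V) where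
  carrier := {x | ∀ p, x p ∈ X.deg n}
  add_mem' := fun h h' p => add_mem (h p) (h' p)
  zero_mem' := fun _ => zero_mem _
  smul_mem' := fun c _ h p => Submodule.smul_mem _ c (h p)

theorem GradedSpace.single_mem_polarDeg {X : GradedSpace.{u}} {n : ℤ} {v : X.V}
    (hv : v ∈ X.deg n) (p : ℂ × ℕ) : Finsupp.single p v ∈ X.polarDeg n := by
  intro q
  rw [Finsupp.single_apply]
  split_ifs
  · exact hv
  · exact zero_mem _

/-- The graded space of polar parts with coefficients in `X`. -/
noncomputable abbrev GradedSpace.polar (X : GradedSpace.{u}) : GradedSpace.{u} where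
  V := ℂ × ℕ →₀ X.V
  deg := X.polarDeg
  internal := by
    have hX := X.internal
    rw [DirectSum.isInternal_submodule_iff_iSupIndep_and_iSup_eq_top] at hX ⊢
    constructor
    · intro n
      rw [Submodule.disjoint_def]
      intro x hx hs
      ext p
      refine Submodule.disjoint_def.1 (hX.1 n) _ (hx p) ?_
      have h1 := Submodule.mem_map_of_mem (f := Finsupp.lapply (R := ℂ) p) hs
      simp only [Submodule.map_iSup] at h1
      refine (iSup_mono fun j => iSup_mono fun _ => ?_ :
        _ ≤ ⨆ j, ⨆ (_ : j ≠ n), X.deg j) h1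
      rintro _ ⟨y, hy, rfl⟩
      exact hy p
    · rw [eq_top_iff]
      rintro x -
      induction x using Finsupp.induction_linear with
      | zero => exact zero_mem _
      | add x y hx hy => exact add_mem hx hy
      | single p m =>
        have hm : m ∈ ⨆ n, X.deg n := by rw [hX.2]; trivial
        have := Submodule.mem_map_of_mem (f := Finsupp.lsingle (R := ℂ) p) hm
        rw [Submodule.map_iSup] at this
        have hle : (⨆ n, (X.deg n).map (Finsupp.lsingle (R := ℂ) p)) ≤ ⨆ n, X.polarDeg n := by
          refine iSup_mono fun n => ?_
          rintro _ ⟨y, hy, rfl⟩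
          exact X.single_mem_polarDeg hy p
        exact hle this

theorem GradedSpace.polar_sgn_single (X : GradedSpace.{u}) (p : ℂ × ℕ) (v : X.V) :
    X.polar.sgn (Finsupp.single p v) = Finsupp.single p (X.sgn v) := by
  induction v using X.induction with
  | h n v hv =>
    rw [X.sgn_apply hv, X.polar.sgn_apply (X.single_mem_polarDeg hv p), Finsupp.smul_single]
  | hadd v w hv hw => rw [Finsupp.single_add, map_add, hv, hw, map_add, Finsupp.single_add]

namespace AInfModule

/-! ### The module of polar parts -/

theorem ev_extFam_mem {M N : AInfModule A} {φ : PreHom M N} {k : ℤ} (hφ : φ ∈ M.hom N k)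
    {x : ℂ × ℕ →₀ M.V} {p n : ℤ} {l : List A.V} (hx : x ∈ M.polar.deg p)
    (hl : A.HasDeg l n) : ev (extFam α φ) x l ∈ N.polar.deg (p + n + k) := by
  rw [← Finsupp.sum_single x, Finsupp.sum, ← evL_apply, map_sum]
  refine Submodule.sum_mem _ fun q _ => ?_
  rw [evL_apply, ev, extFam_single, ← ev_laurentFam, translate, Finsupp.lmapDomain_apply,
    Finsupp.mapDomain, Finsupp.sum]
  exact Submodule.sum_mem _ fun w _ => GradedSpace.single_mem_polarDeg
    (AInfAlgebra.Action.ev_laurentFam_mem hφ (hx q) hl w) _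

/-- The module of polar parts with coefficients in `M`; an input of weight `w` translates poles
by `w`. -/
noncomputable def polar (α : A.Action) (M : AInfModule A) : AInfModule A where
  toGradedSpace := M.toGradedSpace.polar
  mu := extFam α M.mu
  mu_deg := by
    intro d x p a n hx ha
    have := ev_extFam_mem (α := α) M.mu_mem_hom hx (A.hasDeg_ofFn a n ha)
    rw [apply_eq_ev_ofFn, show p + ∑ k, n k + 1 - d = p + (∑ k, n k - d) + 1 by ring]
    exact this
  relation := by
    intro d x a
    have hl : (List.ofFn fun k : Fin d => a k).length = d := by simp
    rw [sum_relation_eq (extFam α M.mu) x hl fun k hk => by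
      simp [List.getD_eq_getElem?_getD, hk]]
    refine IsMultilin.eq_of_polar α ((isMultilin_comp_op (extFam α M.mu)).add
      (isMultilin_comp (extFam α M.mu) (extFam α M.mu))) (G := fun _ _ => 0) ⟨by simp, by simp,
        by simp, by simp⟩ (fun p m l w hw => ?_) x _
    have h1 : splitSum l (fun u r => splitSum r fun v s =>
          ev (extFam α M.mu) (Finsupp.single p m) (A.sg u ++ A.op v :: s))
        = Finsupp.lsingle (R := ℂ) (p.1 + (w : ℂ), p.2) (splitSum l fun u r => splitSum r fun v s =>
          ev M.mu m (A.sg u ++ A.op v :: s)) := by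
      rw [map_splitSum]
      refine splitSum_congr fun u r e => ?_
      rw [map_splitSum]
      refine splitSum_congr fun v s e' => ?_
      subst e'; subst e
      obtain ⟨a, b, ha, hb, rfl⟩ := hw.of_append
      obtain ⟨b, c, hv, hc, rfl⟩ := hb.of_append
      exact ev_extFam_single M.mu p m
        (ha.sg.append (.cons (AInfAlgebra.Action.op_mem_weightSpace hv) hc))
    have h2 : splitSum l (fun u v =>
          ev (extFam α M.mu) (ev (extFam α M.mu) (Finsupp.single p m) v) (A.sg u))
        = Finsupp.lsingle (R := ℂ) (p.1 + (w : ℂ), p.2) (splitSum l fun u v =>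
          ev M.mu (ev M.mu m v) (A.sg u)) := by
      rw [map_splitSum]
      refine splitSum_congr fun u v e => ?_
      subst e
      obtain ⟨a, b, ha, hb, rfl⟩ := hw.of_append
      rw [ev_extFam_single M.mu p m hb, ev_extFam_single M.mu _ _ ha.sg]
      simp only [Finsupp.lsingle_apply]
      congr 2
      push_cast; ring
    rw [h1, h2, ← map_add, ev_relation, map_zero]

/-- The element `m (t - λ)^{-k-1}` for `p = (λ, k)`. -/
noncomputable def pole (α : A.Action) {M : AInfModule A} (p : ℂ × ℕ) :
    M.V →ₗ[ℂ] (M.polar α).V := Finsupp.lsingle p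

theorem polar_induction {M : AInfModule A} {P : (M.polar α).V → Prop} (x : (M.polar α).V)
    (h0 : P 0) (hadd : ∀ x y, P x → P y → P (x + y)) (h : ∀ p (m : M.V), P (pole α p m)) : P x :=
  Finsupp.induction_linear (motive := P) x h0 (fun x y hx hy => hadd x y hx hy) h

theorem pole_mem {M : AInfModule A} {n : ℤ} {m : M.V} (hm : m ∈ M.deg n) (p : ℂ × ℕ) :
    pole α p m ∈ (M.polar α).deg n :=
  GradedSpace.single_mem_polarDeg hm p

theorem ev_polar_pole {M : AInfModule A} (p : ℂ × ℕ) (m : M.V) {l : List A.V} {w : ℤ}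
    (h : α.HasWeight l w) :
    ev (M.polar α).mu (pole α p m) l = pole α (p.1 + (w : ℂ), p.2) (ev M.mu m l) :=
  ev_extFam_single M.mu p m h

theorem polar_sgn_pole {M : AInfModule A} (p : ℂ × ℕ) (m : M.V) :
    (M.polar α).sgn (pole α p m) = pole α p (M.sgn m) :=
  M.toGradedSpace.polar_sgn_single p m

/-- Two multilinear functions on polar parts agree if they agree on `m (t - λ)^{-k-1}` and weight
vectors. -/
theorem polar_multilin_ext {X : Type*} [AddCommGroup X] [Module ℂ X] {M : AInfModule A}
    {F G : (M.polar α).V → List A.V → X} (hF : IsMultilin F) (hG : IsMultilin G)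
    (h : ∀ p (m : M.V) l w, α.HasWeight l w → F (pole α p m) l = G (pole α p m) l)
    (x : (M.polar α).V) (l : List A.V) : F x l = G x l :=
  IsMultilin.eq_of_polar α hF hG h x l

theorem extFam_isReduced {M N : AInfModule A} {φ : PreHom M N} (hφ : IsReduced φ) (d : ℕ)
    (x : ℂ × ℕ →₀ M.V) (a : Fin d → A.V) (ha : ∃ k, a k = A.e) : extFam α φ d x a = 0 := by
  induction x using Finsupp.induction_linear with
  | zero => simp
  | add x y hx hy => rw [map_add, _root_.add_apply, hx, hy, add_zero]
  | single p m =>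
    rw [extFam_single, AInfAlgebra.Action.laurentMap_unit _ (hφ.apply_eq_zero d m) _ ha, map_zero]

theorem polar_strictlyUnital {M : AInfModule A} (hM : M.StrictlyUnital) :
    (M.polar α).StrictlyUnital where
  mu_one := by
    intro x
    change extFam α M.mu 1 (x : ℂ × ℕ →₀ M.V) ![A.e] = x
    induction x using Finsupp.induction_linear with
    | zero => simp
    | add x y hx hy => rw [map_add, _root_.add_apply, hx, hy]
    | single p m =>
      rw [apply_eq_ev_ofFn, show List.ofFn ![A.e] = [A.e] by simp,
        ev_extFam_single M.mu p m (.cons α.unit_mem .nil), hM.ev_unit]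
      simp
  mu_unit := by
    intro d hd x a ha
    change extFam α M.mu d (x : ℂ × ℕ →₀ M.V) a = 0
    induction x using Finsupp.induction_linear with
    | zero => simp
    | add x y hx hy => rw [map_add, _root_.add_apply, hx, hy, add_zero]
    | single p m =>
      rw [extFam_single, AInfAlgebra.Action.laurentMap_unit _ (hM.mu_unit d hd m) _ ha, map_zero]

/-- The extension of a family of maps `M ⊗ A^{⊗d} → N` to polar parts. -/
noncomputable def polarMap (α : A.Action) {M N : AInfModule A} (φ : PreHom M N) :
    PreHom (M.polar α) (N.polar α) := extFam α φ

theorem ev_polarMap_pole {M N : AInfModule A} (φ : PreHom M N) (p : ℂ × ℕ) (m : M.V)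
    {l : List A.V} {w : ℤ} (h : α.HasWeight l w) :
    ev (polarMap α φ) (pole α p m) l = pole α (p.1 + (w : ℂ), p.2) (ev φ m l) :=
  ev_extFam_single φ p m h

/-- Extension to polar parts is a chain map of morphism complexes. -/
theorem diff_polarMap {M N : AInfModule A} (φ : PreHom M N) :
    (M.polar α).diff (N.polar α) (polarMap α φ) = polarMap α (M.diff N φ) := by
  refine fam_ext fun x l => ?_
  refine polar_multilin_ext (ev_isMultilin _) (ev_isMultilin _) (fun p m l w hw => ?_) x l
  rw [ev_polarMap_pole _ _ _ hw, ev_diff, ev_diff, polar_sgn_pole,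
    map_add, map_add, map_splitSum, map_splitSum, map_splitSum]
  refine congrArg₂ _ (congrArg₂ _ ?_ ?_) ?_
  · refine splitSum_congr fun u v e => ?_
    subst e
    obtain ⟨a, b, ha, hb, rfl⟩ := hw.of_append
    rw [ev_polarMap_pole _ _ _ hb.sg, ev_polar_pole _ _ ha]
    refine congrArg (fun q => pole α q _) (Prod.ext ?_ rfl)
    push_cast; ring
  · refine splitSum_congr fun u v e => ?_
    subst e
    obtain ⟨a, b, ha, hb, rfl⟩ := hw.of_append
    rw [ev_polar_pole _ _ hb.sg, ev_polarMap_pole _ _ _ ha]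
    refine congrArg (fun q => pole α q _) (Prod.ext ?_ rfl)
    push_cast; ring
  · refine splitSum_congr fun u r e => ?_
    rw [map_splitSum]
    refine splitSum_congr fun v s e' => ?_
    subst e'; subst e
    obtain ⟨a, b, ha, hb, rfl⟩ := hw.of_append
    obtain ⟨b, c, hv, hc, rfl⟩ := hb.of_append
    exact ev_polarMap_pole φ p _
      (ha.append (.cons (AInfAlgebra.Action.op_mem_weightSpace hv.sg) hc.sg))

end AInfModule
end AInf

namespace AInf

/-! ### Linear algebra of polar parts -/

section PoleOp

variable {V W : Type*} [AddCommGroup V] [Module ℂ V] [AddCommGroup W] [Module ℂ W]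

/-- Lowering the pole order by one. -/
noncomputable def singlePred (V : Type*) [AddCommGroup V] [Module ℂ V] (c : ℂ) :
    ℕ → (V →ₗ[ℂ] (ℂ × ℕ →₀ V))
  | 0 => 0
  | k + 1 => Finsupp.lsingle (c, k)

/-- The endomorphism `t - T` of polar parts with coefficients in `V`, for an endomorphism `T`
of `V`. -/
noncomputable def poleOp (T : Module.End ℂ V) : Module.End ℂ (ℂ × ℕ →₀ V) :=
  Finsupp.lsum ℂ fun p =>
    p.1 • Finsupp.lsingle p + singlePred V p.1 p.2 - Finsupp.lsingle p ∘ₗ T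

/-- The residue on polar parts with coefficients in `V`. -/
noncomputable def poleRes (V : Type*) [AddCommGroup V] [Module ℂ V] : (ℂ × ℕ →₀ V) →ₗ[ℂ] V :=
  Finsupp.lsum ℂ fun p => if p.2 = 0 then LinearMap.id else 0

theorem poleOp_single (T : Module.End ℂ V) (c : ℂ) (k : ℕ) (v : V) :
    poleOp T (Finsupp.single (c, k) v)
      = singlePred V c k v - Finsupp.single (c, k) ((T - c • (1 : Module.End ℂ V)) v) := by
  rw [poleOp, Finsupp.lsum_single]
  simp [Finsupp.single_sub]
  abel

theorem poleRes_single (c : ℂ) (k : ℕ) (v : V) :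
    poleRes V (Finsupp.single (c, k) v) = if k = 0 then v else 0 := by
  rw [poleRes, Finsupp.lsum_single]
  split_ifs <;> rfl

theorem poleOp_map {T : Module.End ℂ V} {T' : Module.End ℂ W} {g : V →ₗ[ℂ] W}
    (h : ∀ v, g (T v) = T' (g v)) (x : ℂ × ℕ →₀ V) :
    Finsupp.mapRange.linearMap g (poleOp T x) = poleOp T' (Finsupp.mapRange.linearMap g x) := by
  induction x using Finsupp.induction_linear with
  | zero => simp only [map_zero]
  | add x y hx hy => simp only [map_add, hx, hy]
  | single p v =>
    obtain ⟨c, k⟩ := p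
    have e : ∀ (p : ℂ × ℕ) v, Finsupp.mapRange.linearMap g (Finsupp.single p v)
        = Finsupp.single p (g v) := fun p v => by simp
    have e' : Finsupp.mapRange.linearMap g (singlePred V c k v) = singlePred W c k (g v) := by
      cases k with
      | zero => exact map_zero _
      | succ k => exact e _ _
    rw [poleOp_single, map_sub, e', e, e, poleOp_single]
    simp [h]

theorem poleRes_map (g : V →ₗ[ℂ] W) (x : ℂ × ℕ →₀ V) :
    g (poleRes V x) = poleRes W (Finsupp.mapRange.linearMap g x) := by
  induction x using Finsupp.induction_linear with
  | zero => simp only [map_zero]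
  | add x y hx hy => simp only [map_add, hx, hy]
  | single p v =>
    obtain ⟨c, k⟩ := p
    rw [Finsupp.mapRange.linearMap_apply, Finsupp.mapRange_single, poleRes_single, poleRes_single]
    split_ifs <;> simp

theorem poleOp_apply (T : Module.End ℂ V) (x : ℂ × ℕ →₀ V) (c : ℂ) (k : ℕ) :
    poleOp T x (c, k) = x (c, k + 1) - (T - c • (1 : Module.End ℂ V)) (x (c, k)) := by
  induction x using Finsupp.induction_linear with
  | zero => simp
  | add x y hx hy => simp only [map_add, Finsupp.add_apply, hx, hy]; abel
  | single p v =>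
    obtain ⟨c', k'⟩ := p
    rw [poleOp_single, Finsupp.sub_apply]
    congr 1
    · cases k' with
      | zero => simp [singlePred]
      | succ k' => simp [singlePred, Finsupp.single_apply]
    · by_cases h : (c', k') = (c, k)
      · obtain ⟨rfl, rfl⟩ := Prod.mk.inj h
        rw [Finsupp.single_eq_same, Finsupp.single_eq_same]
      · rw [Finsupp.single_eq_of_ne (Ne.symm h), Finsupp.single_eq_of_ne (Ne.symm h), map_zero]

theorem poleRes_eq_sum (x : ℂ × ℕ →₀ V) :
    poleRes V x = ∑ c ∈ x.support.image Prod.fst, x (c, 0) := by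
  have e : poleRes V x = x.sum fun p v => if p.2 = 0 then v else 0 := by
    rw [poleRes, Finsupp.lsum_apply]
    refine Finsupp.sum_congr fun p _ => ?_
    split_ifs <;> rfl
  rw [e, Finsupp.sum_of_support_subset (s := x.support.image Prod.fst ×ˢ
    insert 0 (x.support.image Prod.snd)) _ _ _ (by simp), Finset.sum_product]
  · refine Finset.sum_congr rfl fun c _ => ?_
    simp
  · intro p hp
    rw [Finset.mem_product]
    exact ⟨Finset.mem_image_of_mem _ hp, Finset.mem_insert_of_mem (Finset.mem_image_of_mem _ hp)⟩

/-- Preimages are found by induction on the nilpotency order of `T - μ` on generalised eigenvectors.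
For poles at `c = μ` the pole order is raised by one; for poles at `c ≠ μ` the operator `t - T` is
`c - μ` up to nilpotent terms. -/
theorem poleOp_surjective [FiniteDimensional ℂ V] (T : Module.End ℂ V) :
    Function.Surjective (poleOp T) := by
  rw [← LinearMap.range_eq_top, eq_top_iff]
  have key : ∀ (μ : ℂ) (j : ℕ) (v : V), ((T - μ • (1 : Module.End ℂ V)) ^ j) v = 0 →
      ∀ c k, Finsupp.single (c, k) v ∈ LinearMap.range (poleOp T) := by
    intro μ j
    induction j with
    | zero =>
      intro v hv c k
      rw [pow_zero, Module.End.one_apply] at hv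
      rw [hv, Finsupp.single_zero]
      exact zero_mem _
    | succ j ih =>
      intro v hv c k
      have ih := ih ((T - μ • (1 : Module.End ℂ V)) v) (by rwa [pow_succ] at hv)
      by_cases hc : μ = c
      · subst hc
        have h := poleOp_single T μ (k + 1) v
        rw [eq_sub_iff_add_eq] at h
        change _ = Finsupp.single (μ, k) v at h
        rw [← h]
        exact add_mem (LinearMap.mem_range_self _ _) (ih _ _)
      · have hs : ∀ k, singlePred V c k v ∈ LinearMap.range (poleOp T) →
            Finsupp.single (c, k) v ∈ LinearMap.range (poleOp T) := by
          intro k hk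
          have h : (μ - c) • Finsupp.single (c, k) v = singlePred V c k v
              - Finsupp.single (c, k) ((T - μ • (1 : Module.End ℂ V)) v)
              - poleOp T (Finsupp.single (c, k) v) := by
            rw [poleOp_single, sub_sub_sub_comm, sub_self, zero_sub, ← Finsupp.single_sub,
              ← Finsupp.single_neg, Finsupp.smul_single]
            congr 1
            simp [sub_smul]
          rw [← Submodule.smul_mem_iff _ (sub_ne_zero.2 hc), h]
          exact sub_mem (sub_mem hk (ih _ _)) (LinearMap.mem_range_self _ _)
        induction k with
        | zero => exact hs 0 (zero_mem _)
        | succ k ihk => exact hs (k + 1) ihk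
  rintro x -
  induction x using Finsupp.induction_linear with
  | zero => exact zero_mem _
  | add x y hx hy => exact add_mem hx hy
  | single p v =>
    have hv : v ∈ ⨆ μ, T.maxGenEigenspace μ := by
      rw [Module.End.iSup_maxGenEigenspace_eq_top]; trivial
    refine Submodule.iSup_induction _
      (motive := fun v => Finsupp.single p v ∈ LinearMap.range (poleOp T)) hv
      (fun μ v hv => ?_) (by simp) (fun v w hv hw => by
        rw [Finsupp.single_add]; exact add_mem hv hw)
    obtain ⟨j, hj⟩ := (Module.End.mem_maxGenEigenspace T μ v).1 hv
    exact key μ j v hj p.1 p.2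

theorem exists_poleOp_eq_zero [FiniteDimensional ℂ V] (T : Module.End ℂ V) (v : V) :
    ∃ x, poleOp T x = 0 ∧ poleRes V x = v := by
  have hv : v ∈ ⨆ μ, T.maxGenEigenspace μ := by
    rw [Module.End.iSup_maxGenEigenspace_eq_top]; trivial
  refine Submodule.iSup_induction _ (motive := fun v => ∃ x, poleOp T x = 0 ∧ poleRes V x = v) hv
    (fun c v hv => ?_) ⟨0, map_zero _, map_zero _⟩ ?_
  · obtain ⟨j, hj⟩ := (Module.End.mem_maxGenEigenspace T c v).1 hv
    set N := T - c • (1 : Module.End ℂ V) with hN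
    -- The kernel element `∑ (T - c)^i v (t - c)^{-i-1}` is the polar part of `(t - T)⁻¹ v`.
    have hsum : ∀ j, poleOp T (∑ i ∈ range (j + 1), Finsupp.single (c, i) ((N ^ i) v))
        = -Finsupp.single (c, j) ((N ^ (j + 1)) v) := by
      intro j
      induction j with
      | zero =>
        rw [zero_add, Finset.sum_range_one, poleOp_single, pow_zero, pow_one]
        exact zero_sub _
      | succ j ih =>
        rw [Finset.sum_range_succ, map_add, ih, poleOp_single, ← hN, pow_succ' N (j + 1)]
        change -Finsupp.single (c, j) ((N ^ (j + 1)) v)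
          + (Finsupp.single (c, j) ((N ^ (j + 1)) v) - _) = _
        rw [add_sub, neg_add_cancel, zero_sub]
        rfl
    refine ⟨∑ i ∈ range (j + 1), Finsupp.single (c, i) ((N ^ i) v), ?_, ?_⟩
    · rw [hsum, pow_succ', Module.End.mul_apply, hj, map_zero, Finsupp.single_zero, neg_zero]
    · rw [map_sum, Finset.sum_range_succ', Finset.sum_eq_zero]
      · rw [poleRes_single, if_pos rfl, pow_zero, zero_add, Module.End.one_apply]
      · intro i _
        rw [poleRes_single, if_neg (Nat.succ_ne_zero i)]
  · rintro v w ⟨x, hx, hv⟩ ⟨y, hy, hw⟩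
    exact ⟨x + y, by rw [map_add, hx, hy, add_zero], by rw [map_add, hv, hw]⟩

/-- The coefficients at the poles `c` of an element of the kernel of `t - T` lie in the generalised
eigenspace for `c`, and these are independent. -/
theorem eq_zero_of_poleOp_of_poleRes (T : Module.End ℂ V) {x : ℂ × ℕ →₀ V}
    (hx : poleOp T x = 0) (hr : poleRes V x = 0) : x = 0 := by
  have h1 : ∀ c k, x (c, k) = ((T - c • (1 : Module.End ℂ V)) ^ k) (x (c, 0)) := by
    intro c k
    induction k with
    | zero => rw [pow_zero, Module.End.one_apply]
    | succ k ih =>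
      have h := poleOp_apply T x c k
      rw [hx, Finsupp.zero_apply, eq_comm, sub_eq_zero] at h
      rw [h, ih, pow_succ', Module.End.mul_apply]
  have h2 : ∀ c, x (c, 0) ∈ T.maxGenEigenspace c := by
    intro c
    rw [Module.End.mem_maxGenEigenspace]
    obtain ⟨k, hk⟩ := Infinite.exists_notMem_finset (x.support.image Prod.snd)
    refine ⟨k, ?_⟩
    rw [← h1]
    by_contra h
    exact hk (Finset.mem_image.2 ⟨(c, k), Finsupp.mem_support_iff.2 h, rfl⟩)
  have h3 := (iSupIndep_iff_finsetSum_eq_zero_imp_eq_zero _).1 T.independent_maxGenEigenspace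
    (x.support.image Prod.fst) (fun c => x (c, 0)) (fun c _ => h2 c)
    (by rw [← poleRes_eq_sum, hr])
  ext ⟨c, k⟩
  rw [Finsupp.zero_apply]
  by_contra h
  refine h ?_
  rw [h1, h3 c (Finset.mem_image.2 ⟨(c, k), Finsupp.mem_support_iff.2 h, rfl⟩), map_zero]

end PoleOp

end AInf

namespace AInf

variable {A : AInfAlgebra.{u}} {α : A.Action}

/-! ### Criteria for rationality -/

theorem IsRational.of_span {V : Type*} [AddCommGroup V] [Module ℂ V]
    {ρ : Representation ℂ ℂˣ V} (h : ∀ v, v ∈ ⨆ n, weightSpace ρ n) : IsRational ρ := by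
  intro v
  refine Submodule.iSup_induction _ (motive := fun v => ∃ c : ℤ →₀ V, ∀ g : ℂˣ,
    ρ g v = c.sum fun n w => ((g : ℂ) ^ n) • w) (h v) (fun n v hv => ?_) ?_ ?_
  · exact ⟨Finsupp.single n v, fun g => by rw [hv g, Finsupp.sum_single_index]; simp⟩
  · exact ⟨0, fun g => by simp⟩
  · rintro v w ⟨c, hc⟩ ⟨d, hd⟩
    refine ⟨c + d, fun g => ?_⟩
    rw [map_add, hc, hd, Finsupp.sum_add_index' (by simp) (by simp)]

theorem IsRational.prodMap {V W : Type*} [AddCommGroup V] [Module ℂ V] [AddCommGroup W]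
    [Module ℂ W] {ρ : Representation ℂ ℂˣ V} {σ : Representation ℂ ℂˣ W} (hρ : IsRational ρ)
    (hσ : IsRational σ) {τ : Representation ℂ ℂˣ (V × W)}
    (h : ∀ g z, τ g z = (ρ g z.1, σ g z.2)) : IsRational τ := by
  rintro ⟨x, y⟩
  obtain ⟨c, hc⟩ := hρ x
  obtain ⟨d, hd⟩ := hσ y
  refine ⟨c.mapRange (LinearMap.inl ℂ V W) (map_zero _)
    + d.mapRange (LinearMap.inr ℂ V W) (map_zero _), fun g => ?_⟩
  rw [Finsupp.sum_add_index' (by simp) (by simp), Finsupp.sum_mapRange_index (by simp),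
    Finsupp.sum_mapRange_index (by simp), h, hc, hd]
  simp only [← map_smul]
  rw [← map_finsuppSum, ← map_finsuppSum]
  simp

namespace AInfModule

variable {M : AInfModule A}

/-! ### The graded model -/

theorem polar_linearMap_ext {X : Type*} [AddCommGroup X] [Module ℂ X]
    {f g : (M.polar α).V →ₗ[ℂ] X} (h : ∀ p (m : M.V), f (pole α p m) = g (pole α p m)) : f = g :=
  LinearMap.ext fun x => polar_induction (P := fun x => f x = g x) x (by rw [map_zero, map_zero])
    (fun x y hx hy => by rw [map_add, map_add, hx, hy]) h

/-- The linear map on polar parts with prescribed values on poles. -/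
noncomputable def poleLift {X : Type*} [AddCommGroup X] [Module ℂ X] (α : A.Action)
    (f : ℂ × ℕ → M.V →ₗ[ℂ] X) : (M.polar α).V →ₗ[ℂ] X :=
  Finsupp.lsum ℂ f

@[simp] theorem poleLift_pole {X : Type*} [AddCommGroup X] [Module ℂ X]
    (f : ℂ × ℕ → M.V →ₗ[ℂ] X) (p : ℂ × ℕ) (m : M.V) :
    poleLift α f (pole α p m) = f p m := by
  rw [poleLift, pole]
  exact Finsupp.lsum_single ..

theorem poleLift_mem {X : GradedSpace.{u}} {f : ℂ × ℕ → M.V →ₗ[ℂ] X.V} {k : ℤ}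
    (h : ∀ p n, ∀ m ∈ M.deg n, f p m ∈ X.deg (n + k)) {n : ℤ} {x : (M.polar α).V}
    (hx : x ∈ (M.polar α).deg n) : poleLift α f x ∈ X.deg (n + k) := by
  have e : poleLift α f x = Finsupp.sum (show ℂ × ℕ →₀ M.V from x) fun p m => f p m :=
    Finsupp.lsum_apply ..
  rw [e]
  exact Submodule.sum_mem _ fun p _ => h p n _ (hx p)

/-- Lowering the pole order by one: the nilpotent part of multiplication by `t`. -/
noncomputable def lowerPole (α : A.Action) (M : AInfModule A) (c : ℂ) (k : ℕ) :
    M.V →ₗ[ℂ] (M.polar α).V := singlePred M.V c k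

/-- Multiplication by `t` on polar parts. -/
noncomputable def mulT (α : A.Action) (M : AInfModule A) : (M.polar α).V →ₗ[ℂ] (M.polar α).V :=
  poleLift α fun p => p.1 • pole α p + lowerPole α M p.1 p.2

theorem mulT_pole (c : ℂ) (k : ℕ) (m : M.V) :
    mulT α M (pole α (c, k) m) = c • pole α (c, k) m + lowerPole α M c k m := by
  simp [mulT]

theorem lowerPole_mem {n : ℤ} {m : M.V} (hm : m ∈ M.deg n) (c : ℂ) (k : ℕ) :
    lowerPole α M c k m ∈ (M.polar α).deg n := by
  cases k with
  | zero => exact zero_mem _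
  | succ k => exact pole_mem hm _

theorem mulT_mem {n : ℤ} {x : (M.polar α).V} (hx : x ∈ (M.polar α).deg n) :
    mulT α M x ∈ (M.polar α).deg n := by
  have := poleLift_mem (α := α) (X := (M.polar α).toGradedSpace) (k := 0)
    (f := fun p => p.1 • pole α p + lowerPole α M p.1 p.2) (fun p n m hm => by
      rw [add_zero]
      exact add_mem (Submodule.smul_mem _ _ (pole_mem hm p)) (lowerPole_mem hm _ _)) hx
  rwa [add_zero] at this

/-- The residue: the sum over all `λ` of the coefficients of `(t - λ)^{-1}`. -/
noncomputable def residue (α : A.Action) (M : AInfModule A) : (M.polar α).V →ₗ[ℂ] M.V :=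
  poleRes M.V

theorem residue_pole (c : ℂ) (k : ℕ) (m : M.V) :
    residue α M (pole α (c, k) m) = if k = 0 then m else 0 := by
  exact poleRes_single c k m

theorem residue_mem {n : ℤ} {x : (M.polar α).V} (hx : x ∈ (M.polar α).deg n) :
    residue α M x ∈ M.deg n := by
  have := poleLift_mem (α := α) (X := M.toGradedSpace) (k := 0)
    (f := fun p => if p.2 = 0 then LinearMap.id else 0) (fun p n m hm => by
      rw [add_zero]
      split_ifs
      · exact hm
      · exact zero_mem _) hx
  rwa [add_zero] at this

theorem isMultilin_ev_linearMap {V V' W : Type*} [AddCommGroup V] [Module ℂ V] [AddCommGroup V']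
    [Module ℂ V'] [AddCommGroup W] [Module ℂ W] (φ : Fam A.V V' W) (L : V →ₗ[ℂ] V') :
    IsMultilin fun m l => ev φ (L m) l := by
  constructor
  · intro m m' l; rw [map_add, ev_add_left]
  · intro c m l; rw [map_smul, ev_smul_left]
  · intro m u v x y; rw [ev_add_mid]
  · intro m u v c x; rw [ev_smul_mid]

theorem isMultilin_linearMap_ev {V W W' : Type*} [AddCommGroup V] [Module ℂ V] [AddCommGroup W']
    [Module ℂ W'] [AddCommGroup W] [Module ℂ W] (L : W →ₗ[ℂ] W') (φ : Fam A.V V W) :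
    IsMultilin fun m l => L (ev φ m l) := by
  constructor
  · intro m m' l; rw [ev_add_left, map_add]
  · intro c m l; rw [ev_smul_left, map_smul]
  · intro m u v x y; rw [ev_add_mid, map_add]
  · intro m u v c x; rw [ev_smul_mid, map_smul]

theorem ev_mu_residue (x : (M.polar α).V) (l : List A.V) :
    ev M.mu (residue α M x) l = residue α M (ev (M.polar α).mu x l) := by
  refine polar_multilin_ext (isMultilin_ev_linearMap _ _) (isMultilin_linearMap_ev _ _)
    (fun p m l w hw => ?_) x l
  obtain ⟨c, k⟩ := p
  rw [ev_polar_pole _ _ hw, residue_pole, residue_pole]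
  split_ifs
  · rfl
  · simp

/-- Multiplication by `t` fails to be a strict homomorphism by the infinitesimal deformation. -/
theorem diff_mulT : (M.polar α).diff (M.polar α) (strictFam (mulT α M ∘ₗ (M.polar α).sgn))
    = -polarMap α (deformation α M) := by
  refine fam_ext fun x l => ?_
  refine polar_multilin_ext (ev_isMultilin _) (ev_isMultilin _) (fun p m l w hw => ?_) x l
  obtain ⟨c, k⟩ := p
  have hlow : ev (M.polar α).mu (lowerPole α M c k m) l
      = lowerPole α M (c + (w : ℂ)) k (ev M.mu m l) := by
    cases k with
    | zero => exact ev_zero_left _ _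
    | succ k => exact ev_polar_pole _ _ hw
  rw [ev_diff_strictFam, ev_neg_fam, ev_polarMap_pole _ _ _ hw, ev_polar_pole _ _ hw, mulT_pole,
    mulT_pole, ev_add_left, hlow, ev_smul_left, ev_polar_pole _ _ hw, ev_deformation _ _ hw,
    map_smul, add_smul]
  abel

variable {D : PreHom M M}

/-- The endomorphism `t + D` of the module of polar parts. -/
noncomputable def theta (α : A.Action) (D : PreHom M M) : PreHom (M.polar α) (M.polar α) :=
  strictFam (mulT α M ∘ₗ (M.polar α).sgn) + polarMap α D

theorem theta_mem (hD : D ∈ M.hom M 0) : theta α D ∈ (M.polar α).hom (M.polar α) 0 := by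
  refine add_mem (strictFam_mem_hom fun n m hm => ?_) ?_
  · rw [add_zero]
    exact mulT_mem ((M.polar α).sgn_mem hm)
  · rw [mem_hom_iff]
    intro x p l n hx hl
    exact ev_extFam_mem hD hx hl

theorem diff_theta (hD : M.diff M D = deformation α M) :
    (M.polar α).diff (M.polar α) (theta α D) = 0 := by
  rw [theta, map_add, diff_mulT, diff_polarMap, hD, neg_add_cancel]

/-- The desuspended cone of `t + D` on the module of polar parts. On cohomology `-D` induces an
endomorphism `T`, and the cone computes the kernel of `t - T`. -/
noncomputable def gradedModel (hD : D ∈ M.hom M 0) (hd : M.diff M D = deformation α M) :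
    AInfModule A :=
  (cone (⟨theta α D, theta_mem hD, diff_theta hd⟩ : Closed (M.polar α) (M.polar α))).shift (-1)

theorem gradedModel_strictlyUnital (hD : D ∈ M.hom M 0) (hd : M.diff M D = deformation α M)
    (hM : M.StrictlyUnital) (hr : IsReduced D) : (gradedModel hD hd).StrictlyUnital := by
  have hp := polar_strictlyUnital (α := α) hM
  have hθ : ∀ (d : ℕ) (x : (M.polar α).V) (a : Fin d → A.V), (∃ k, a k = A.e) →
      theta α D d x a = 0 := by
    rintro (_ | d) x a ha
    · obtain ⟨k, -⟩ := ha
      exact k.elim0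
    · exact (zero_add _).trans (extFam_isReduced (α := α) hr (d + 1) x a ha)
  constructor
  · rintro ⟨x, y⟩
    refine Prod.ext (hp.mu_one x) ?_
    change (M.polar α).mu 1 y ![A.e] + theta α D 1 x ![A.e] = y
    rw [hp.mu_one, hθ 1 x _ ⟨0, rfl⟩, add_zero]
  · rintro d h ⟨x, y⟩ a ha
    refine Prod.ext (hp.mu_unit d h x a ha) ?_
    change (M.polar α).mu d y a + theta α D d x a = 0
    rw [hp.mu_unit d h y a ha, hθ d x a ha, add_zero]

/-- The projection from the graded model to the original module, induced by the residue. -/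
noncomputable def gradedModelProj (hD : D ∈ M.hom M 0) (hd : M.diff M D = deformation α M) :
    Closed (gradedModel hD hd) M :=
  ⟨strictFam ((residue α M ∘ₗ LinearMap.fst ℂ (M.polar α).V (M.polar α).V) ∘ₗ
      (gradedModel hD hd).sgn), by
    constructor
    · refine strictFam_mem_hom fun n z hz => ?_
      have h := (gradedModel hD hd).sgn_mem hz
      have h1 := residue_mem (α := α) (x := ((gradedModel hD hd).sgn z).1) h.1
      rwa [show n + -1 + 1 = n + 0 by ring] at h1
    · exact diff_strictFam fun z l => ev_mu_residue z.1 l⟩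

theorem linearPart_gradedModelProj (hD : D ∈ M.hom M 0) (hd : M.diff M D = deformation α M)
    (z : (M.polar α).V × (M.polar α).V) :
    linearPart (gradedModelProj hD hd).1 z = residue α M z.1 := by
  exact congrArg (fun z : (M.polar α).V × (M.polar α).V => residue α M z.1)
    ((gradedModel hD hd).sgn_sgn z)

theorem gradedModel_mu1 (hD : D ∈ M.hom M 0) (hd : M.diff M D = deformation α M)
    (z : (M.polar α).V × (M.polar α).V) :
    (gradedModel hD hd).mu1 z = ((M.polar α).mu1 z.1,
      (M.polar α).mu1 z.2 + linearPart (theta α D) ((M.polar α).sgn z.1)) :=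
  cone_mu1 (⟨theta α D, theta_mem hD, diff_theta hd⟩ : Closed (M.polar α) (M.polar α)) z

theorem linearPart_theta_pole (c : ℂ) (k : ℕ) (m : M.V) :
    linearPart (theta α D) (pole α (c, k) m)
      = c • pole α (c, k) m + lowerPole α M c k m + pole α (c, k) (linearPart D m) := by
  rw [linearPart_apply, theta, ev_add_fam, ev_strictFam_nil, LinearMap.comp_apply,
    (M.polar α).sgn_sgn, mulT_pole, polar_sgn_pole, ev_polarMap_pole _ _ _ .nil,
    linearPart_apply]
  simp

theorem polar_mu1_pole (p : ℂ × ℕ) (m : M.V) :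
    (M.polar α).mu1 (pole α p m) = pole α p (M.mu1 m) := by
  rw [← ev_mu_nil, ← ev_mu_nil, ev_polar_pole _ _ .nil]
  simp

/-! ### The action on the graded model -/

/-- The action of `ℂ*` on polar parts for which the coefficients of the poles at `λ` have weight
`⌊Re λ⌋`. Any function `ν : ℂ → ℤ` with `ν (λ + 1) = ν λ + 1` would do in place of `⌊Re λ⌋`. -/
noncomputable def polarRep (α : A.Action) (M : AInfModule A) :
    Representation ℂ ℂˣ (M.polar α).V where
  toFun g := poleLift α fun p => ((g : ℂ) ^ ⌊p.1.re⌋) • pole α p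
  map_one' := polar_linearMap_ext fun p m => by simp
  map_mul' g h := polar_linearMap_ext fun p m => by
    rw [Module.End.mul_apply, poleLift_pole, poleLift_pole, LinearMap.smul_apply,
      LinearMap.smul_apply, map_smul, poleLift_pole, LinearMap.smul_apply, smul_smul,
      Units.val_mul, mul_zpow, mul_comm]

@[simp] theorem polarRep_pole (g : ℂˣ) (p : ℂ × ℕ) (m : M.V) :
    polarRep α M g (pole α p m) = ((g : ℂ) ^ ⌊p.1.re⌋) • pole α p m :=
  poleLift_pole _ p m

theorem polarRep_mem (g : ℂˣ) {n : ℤ} {x : (M.polar α).V} (hx : x ∈ (M.polar α).deg n) :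
    polarRep α M g x ∈ (M.polar α).deg n := by
  have := poleLift_mem (α := α) (X := (M.polar α).toGradedSpace) (k := 0)
    (f := fun p => ((g : ℂ) ^ ⌊p.1.re⌋) • pole α p) (fun p n m hm => by
      rw [add_zero]
      exact Submodule.smul_mem _ _ (pole_mem hm p)) hx
  rwa [add_zero] at this

theorem polarRep_rational : IsRational (polarRep α M) :=
  IsRational.of_span fun x => polar_induction x (zero_mem _) (fun _ _ => add_mem) fun p m =>
    Submodule.mem_iSup_of_mem ⌊p.1.re⌋ fun g => polarRep_pole g p m

theorem isMultilin_ev_map {V V' W : Type*} [AddCommGroup V] [Module ℂ V] [AddCommGroup V']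
    [Module ℂ V'] [AddCommGroup W] [Module ℂ W] (φ : Fam A.V V' W) (L : V →ₗ[ℂ] V')
    (s : A.V →ₗ[ℂ] A.V) : IsMultilin fun m l => ev φ (L m) (l.map s) := by
  constructor
  · intro m m' l; rw [map_add, ev_add_left]
  · intro c m l; rw [map_smul, ev_smul_left]
  · intro m u v x y; simp only [List.map_append, List.map_cons, map_add, ev_add_mid]
  · intro m u v c x; simp only [List.map_append, List.map_cons, map_smul, ev_smul_mid]

/-- Families extended to polar parts are equivariant: a pole at `λ` and an input of weight `w` give
a pole at `λ + w`, and `⌊Re (λ + w)⌋ = ⌊Re λ⌋ + w`. -/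
theorem polarRep_ev_polarMap {N : AInfModule A} (φ : PreHom M N) (g : ℂˣ) (x : (M.polar α).V)
    (l : List A.V) : polarRep α N g (ev (polarMap α φ) x l)
      = ev (polarMap α φ) (polarRep α M g x) (l.map (α.rep g)) := by
  refine polar_multilin_ext (isMultilin_linearMap_ev _ _)
    (isMultilin_ev_map _ (polarRep α M g) (α.rep g)) (fun p m l w hw => ?_) x l
  rw [ev_polarMap_pole _ _ _ hw, polarRep_pole, polarRep_pole,
    AInfAlgebra.Action.ev_map_rep _ _ hw, ev_smul_left, ev_polarMap_pole _ _ _ hw, smul_smul,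
    ← zpow_add₀ g.ne_zero]
  congr 2
  simp only [Complex.add_re, Complex.intCast_re, Int.floor_add_intCast]
  ring

theorem polarRep_mulT (g : ℂˣ) (x : (M.polar α).V) :
    polarRep α M g (mulT α M x) = mulT α M (polarRep α M g x) := by
  have : polarRep α M g ∘ₗ mulT α M = mulT α M ∘ₗ polarRep α M g := by
    refine polar_linearMap_ext fun p m => ?_
    obtain ⟨c, k⟩ := p
    rw [LinearMap.comp_apply, LinearMap.comp_apply, mulT_pole, polarRep_pole, map_add, map_smul,
      map_smul, mulT_pole, polarRep_pole, smul_add, smul_comm]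
    congr 1
    cases k with
    | zero => exact (map_zero _).trans (smul_zero _).symm
    | succ k => exact polarRep_pole g _ m
  exact LinearMap.congr_fun this x

theorem polarRep_sgn (g : ℂˣ) (x : (M.polar α).V) :
    polarRep α M g ((M.polar α).sgn x) = (M.polar α).sgn (polarRep α M g x) := by
  induction x using (M.polar α).induction with
  | h n x hx =>
    rw [(M.polar α).sgn_apply hx, (M.polar α).sgn_apply (polarRep_mem g hx), map_smul]
  | hadd x y hx hy => simp only [map_add, hx, hy]

theorem polarRep_ev_theta (g : ℂˣ) (x : (M.polar α).V) (l : List A.V) :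
    polarRep α M g (ev (theta α D) x l)
      = ev (theta α D) (polarRep α M g x) (l.map (α.rep g)) := by
  rw [theta, ev_add_fam, ev_add_fam, map_add, polarRep_ev_polarMap]
  congr 1
  cases l with
  | nil =>
    rw [List.map_nil, ev_strictFam_nil, ev_strictFam_nil, LinearMap.comp_apply,
      LinearMap.comp_apply, polarRep_mulT, polarRep_sgn]
  | cons a l => rw [List.map_cons, ev_strictFam_cons, ev_strictFam_cons, map_zero]

/-- The naive action on the graded model. -/
noncomputable def gradedModelAction (hD : D ∈ M.hom M 0) (hd : M.diff M D = deformation α M) :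
    (gradedModel hD hd).NaiveAction α where
  rep :=
    { toFun := fun g => (polarRep α M g).prodMap (polarRep α M g)
      map_one' := by rw [map_one]; rfl
      map_mul' := fun g h => by rw [map_mul]; rfl }
  rational := IsRational.prodMap polarRep_rational polarRep_rational fun _ _ => rfl
  rep_deg := fun g n v hv => ⟨polarRep_mem g hv.1, polarRep_mem g hv.2⟩
  equivariant := by
    intro g d z a
    have hmu : ∀ x : (M.polar α).V, polarRep α M g ((M.polar α).mu d x a)
        = (M.polar α).mu d (polarRep α M g x) fun k => α.rep g (a k) := by
      intro x
      rw [apply_eq_ev_ofFn, apply_eq_ev_ofFn]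
      refine (polarRep_ev_polarMap M.mu g x _).trans ?_
      rw [List.map_ofFn]
      rfl
    have hθ : ∀ x : (M.polar α).V, polarRep α M g (theta α D d x a)
        = theta α D d (polarRep α M g x) fun k => α.rep g (a k) := by
      intro x
      rw [apply_eq_ev_ofFn, apply_eq_ev_ofFn, polarRep_ev_theta, List.map_ofFn]
      rfl
    refine Prod.ext (hmu z.1) ?_
    change polarRep α M g ((M.polar α).mu d z.2 a + theta α D d z.1 a) = _
    rw [map_add, hmu, hθ]
    rfl

end AInfModule
end AInf

namespace AInf

/-! ### Cohomology with coefficients in polar parts -/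

section Classes

theorem exists_finsupp_lift {I V W : Type*} [AddCommGroup V] [Module ℂ V] [AddCommGroup W]
    [Module ℂ W] {L : V →ₗ[ℂ] W} {S : Submodule ℂ V} {x : I →₀ W} (hx : ∀ p, x p ∈ S.map L) :
    ∃ w : I →₀ V, (∀ p, w p ∈ S) ∧ Finsupp.mapRange.linearMap L w = x := by
  classical
  choose v hv e using hx
  refine ⟨Finsupp.onFinset x.support (fun p => if x p = 0 then 0 else v p) (fun p hp => ?_),
    fun p => ?_, ?_⟩
  · rw [Finsupp.mem_support_iff]
    intro h
    simp [h] at hp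
  · rw [Finsupp.onFinset_apply]
    split_ifs
    · exact zero_mem _
    · exact hv p
  · ext p
    rw [Finsupp.mapRange.linearMap_apply, Finsupp.mapRange_apply, Finsupp.onFinset_apply]
    split_ifs with h
    · rw [h, map_zero]
    · exact e p

variable {V : Type*} [AddCommGroup V] [Module ℂ V] {F : ℤ → Submodule ℂ V} {d T : V →ₗ[ℂ] V}
  {n : ℤ}

/-- The class in `Coh F d n ⊗ ℂ(t)/ℂ[t]` of a polar part with closed coefficients. -/
noncomputable def polarClass (F : ℤ → Submodule ℂ V) (d : V →ₗ[ℂ] V) (n : ℤ) :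
    (ℂ × ℕ →₀ ↥(F n ⊓ LinearMap.ker d)) →ₗ[ℂ] (ℂ × ℕ →₀ Coh F d n) :=
  Finsupp.mapRange.linearMap (Submodule.mkQ _)

theorem polarClass_surjective : Function.Surjective (polarClass F d n) :=
  Finsupp.mapRange_surjective _ (map_zero _) (Submodule.mkQ_surjective _)

/-- The underlying polar part with coefficients in `V`. -/
noncomputable def polarIncl (F : ℤ → Submodule ℂ V) (d : V →ₗ[ℂ] V) (n : ℤ) :
    (ℂ × ℕ →₀ ↥(F n ⊓ LinearMap.ker d)) →ₗ[ℂ] (ℂ × ℕ →₀ V) :=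
  Finsupp.mapRange.linearMap (Submodule.subtype _)

theorem polarIncl_apply_mem (u : ℂ × ℕ →₀ ↥(F n ⊓ LinearMap.ker d)) (p : ℂ × ℕ) :
    polarIncl F d n u p ∈ F n ⊓ LinearMap.ker d :=
  (u p).2

theorem exists_polarIncl_eq {x : ℂ × ℕ →₀ V} (hx : ∀ p, x p ∈ F n ⊓ LinearMap.ker d) :
    ∃ u, polarIncl F d n u = x := by
  obtain ⟨u, -, e⟩ := exists_finsupp_lift (L := (F n ⊓ LinearMap.ker d).subtype) (S := ⊤) (x := x)
    fun p => ⟨⟨x p, hx p⟩, trivial, rfl⟩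
  exact ⟨u, e⟩

theorem polarClass_eq_zero_iff (u : ℂ × ℕ →₀ ↥(F n ⊓ LinearMap.ker d)) :
    polarClass F d n u = 0 ↔ ∃ w : ℂ × ℕ →₀ V, (∀ p, w p ∈ F (n - 1)) ∧
      Finsupp.mapRange.linearMap d w = polarIncl F d n u := by
  rw [Finsupp.ext_iff]
  have h : ∀ p, polarClass F d n u p = (0 : ℂ × ℕ →₀ Coh F d n) p ↔
      polarIncl F d n u p ∈ (F (n - 1)).map d := fun p =>
    Submodule.Quotient.mk_eq_zero _
  simp only [h]
  constructor
  · exact exists_finsupp_lift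
  · rintro ⟨w, hw, e⟩ p
    exact ⟨w p, hw p, DFunLike.congr_fun e p⟩

/-- The endomorphism of closed elements induced by a chain map. -/
def closedEnd (hT : ∀ v ∈ F n, T v ∈ F n) (hd : ∀ v, T (d v) = d (T v)) :
    Module.End ℂ ↥(F n ⊓ LinearMap.ker d) :=
  T.restrict fun v hv => ⟨hT v hv.1, by
    have h : d v = 0 := hv.2
    change d (T v) = 0
    rw [← hd, h, map_zero]⟩

/-- The endomorphism of cohomology induced by a chain map. -/
def cohEnd (hT : ∀ n, ∀ v ∈ F n, T v ∈ F n) (hd : ∀ v, T (d v) = d (T v)) (n : ℤ) :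
    Module.End ℂ (Coh F d n) :=
  Submodule.mapQ _ _ (closedEnd (hT n) hd) (by
    rintro ⟨m, hm⟩ ⟨x, hx, rfl⟩
    exact ⟨T x, hT _ x hx, (hd x).symm⟩)

section

variable (hT : ∀ n, ∀ v ∈ F n, T v ∈ F n) (hd : ∀ v, T (d v) = d (T v))

theorem polarIncl_poleOp (u : ℂ × ℕ →₀ ↥(F n ⊓ LinearMap.ker d)) :
    polarIncl F d n (poleOp (closedEnd (hT n) hd) u) = poleOp T (polarIncl F d n u) :=
  poleOp_map (T := closedEnd (hT n) hd) (T' := T) (g := Submodule.subtype _) (fun _ => rfl) u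

theorem polarClass_poleOp (u : ℂ × ℕ →₀ ↥(F n ⊓ LinearMap.ker d)) :
    polarClass F d n (poleOp (closedEnd (hT n) hd) u)
      = poleOp (cohEnd hT hd n) (polarClass F d n u) :=
  poleOp_map (T := closedEnd (hT n) hd) (T' := cohEnd hT hd n) (g := Submodule.mkQ _)
    (fun _ => rfl) u

end

/-- Every cohomology class is the residue of a class in the kernel of `t - T`. -/
theorem exists_polar_lift
    (hT : ∀ n, ∀ v ∈ F n, T v ∈ F n) (hd : ∀ v, T (d v) = d (T v))
    [FiniteDimensional ℂ (Coh F d n)] {y : V} (hy : y ∈ F n)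
    (hy' : d y = 0) :
    ∃ x : ℂ × ℕ →₀ V, (∀ p, x p ∈ F n ⊓ LinearMap.ker d) ∧
      (∃ w : ℂ × ℕ →₀ V, (∀ p, w p ∈ F (n - 1)) ∧
        Finsupp.mapRange.linearMap d w = poleOp T x) ∧
      ∃ v ∈ F (n - 1), d v = poleRes V x - y := by
  obtain ⟨z, hz, hr⟩ := exists_poleOp_eq_zero (cohEnd hT hd n) (Submodule.Quotient.mk ⟨y, hy, hy'⟩)
  obtain ⟨u, rfl⟩ := polarClass_surjective z
  refine ⟨polarIncl F d n u, polarIncl_apply_mem u, ?_, ?_⟩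
  · rw [← polarIncl_poleOp hT hd, ← polarClass_eq_zero_iff, polarClass_poleOp, hz]
  · rw [polarClass, ← poleRes_map] at hr
    obtain ⟨v, hv, e⟩ := (Submodule.Quotient.eq _).1 hr
    refine ⟨v, hv, e.trans ?_⟩
    rw [polarIncl, ← poleRes_map]
    rfl

/-- A class in the kernel of `t - T` with vanishing residue vanishes. -/
theorem exact_of_poleOp_of_poleRes
    (hT : ∀ n, ∀ v ∈ F n, T v ∈ F n) (hd : ∀ v, T (d v) = d (T v))
    {x : ℂ × ℕ →₀ V} (hx : ∀ p, x p ∈ F n ⊓ LinearMap.ker d)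
    {w : ℂ × ℕ →₀ V} (hw : ∀ p, w p ∈ F (n - 1))
    (h : Finsupp.mapRange.linearMap d w = poleOp T x) {v : V} (hv : v ∈ F (n - 1))
    (h' : d v = poleRes V x) :
    ∃ x' : ℂ × ℕ →₀ V, (∀ p, x' p ∈ F (n - 1)) ∧ Finsupp.mapRange.linearMap d x' = x := by
  obtain ⟨u, rfl⟩ := exists_polarIncl_eq hx
  rw [← polarClass_eq_zero_iff]
  refine eq_zero_of_poleOp_of_poleRes (cohEnd hT hd n) ?_ ?_
  · rw [← polarClass_poleOp, polarClass_eq_zero_iff]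
    exact ⟨w, hw, by rw [h, polarIncl_poleOp]⟩
  · rw [polarClass, ← poleRes_map]
    refine (Submodule.Quotient.mk_eq_zero _).2 ⟨v, hv, h'.trans ?_⟩
    rw [polarIncl, ← poleRes_map]

/-- `t - T` is surjective on cohomology. -/
theorem exists_poleOp_sub_exact
    (hT : ∀ n, ∀ v ∈ F n, T v ∈ F n) (hd : ∀ v, T (d v) = d (T v))
    [FiniteDimensional ℂ (Coh F d n)] {x : ℂ × ℕ →₀ V}
    (hx : ∀ p, x p ∈ F n ⊓ LinearMap.ker d) :
    ∃ s : ℂ × ℕ →₀ V, (∀ p, s p ∈ F n ⊓ LinearMap.ker d) ∧ ∃ w : ℂ × ℕ →₀ V,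
      (∀ p, w p ∈ F (n - 1)) ∧ Finsupp.mapRange.linearMap d w = poleOp T s - x := by
  obtain ⟨u, rfl⟩ := exists_polarIncl_eq hx
  obtain ⟨z, hz⟩ := poleOp_surjective (cohEnd hT hd n) (polarClass F d n u)
  obtain ⟨s, rfl⟩ := polarClass_surjective z
  refine ⟨polarIncl F d n s, polarIncl_apply_mem s, ?_⟩
  rw [← polarIncl_poleOp hT hd, ← map_sub, ← polarClass_eq_zero_iff, map_sub, polarClass_poleOp,
    hz, sub_self]

end Classes

namespace AInfModule

/-! ### The graded model is quasi-isomorphic to the module -/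

variable {A : AInfAlgebra.{u}} {α : A.Action} {M : AInfModule A} {D : PreHom M M}

theorem linearPart_theta (x : ℂ × ℕ →₀ M.V) :
    linearPart (theta α D) (show (M.polar α).V from x) = poleOp (-linearPart D) x := by
  have h : linearPart (theta α D)
      = (poleOp (-linearPart D) : (M.polar α).V →ₗ[ℂ] (M.polar α).V) := by
    refine polar_linearMap_ext fun p m => ?_
    obtain ⟨c, k⟩ := p
    refine (linearPart_theta_pole c k m).trans (Eq.trans ?_ (poleOp_single _ c k m).symm)
    change c • Finsupp.single (c, k) m + singlePred M.V c k m
      + Finsupp.single (c, k) (linearPart D m) = _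
    simp [Finsupp.single_sub]
    abel
  exact LinearMap.congr_fun h x

theorem polar_mu1 (x : ℂ × ℕ →₀ M.V) :
    (M.polar α).mu1 (show (M.polar α).V from x) = Finsupp.mapRange.linearMap M.mu1 x := by
  have h : (M.polar α).mu1
      = (Finsupp.mapRange.linearMap M.mu1 : (M.polar α).V →ₗ[ℂ] (M.polar α).V) := by
    refine polar_linearMap_ext fun p m => (polar_mu1_pole p m).trans ?_
    exact (Finsupp.mapRange_single (f := M.mu1) (hf := map_zero _)).symm
  exact LinearMap.congr_fun h x

theorem linearPart_connection_mem (hD : D ∈ M.hom M 0) {n : ℤ} {m : M.V} (hm : m ∈ M.deg n) :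
    linearPart D m ∈ M.deg n := by
  have := mem_hom_iff.1 hD (M.sgn m) n [] 0 (M.sgn_mem hm) .nil
  rw [linearPart_apply]
  simpa using this

theorem linearPart_connection_mu1 (hd : M.diff M D = deformation α M) (m : M.V) :
    linearPart D (M.mu1 m) = M.mu1 (linearPart D m) := by
  have h : ev (M.diff M D) m [] = 0 := by
    rw [hd, ev_deformation _ _ .nil]
    simp
  rw [ev_diff] at h
  simp only [splitSum_nil, AInfAlgebra.sg_nil, ev_mu_nil, A.op_nil, ev_zero_mid, add_zero] at h
  rw [linearPart_apply, linearPart_apply, sgn_mu1, ev_neg_left, ← eq_neg_of_add_eq_zero_left h]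

section

variable (hD : D ∈ M.hom M 0) (hd : M.diff M D = deformation α M)

/-- The element of the graded model with given components. -/
noncomputable def gradedModelMk (x w : ℂ × ℕ →₀ M.V) : (gradedModel hD hd).V :=
  ((x, w) : (M.polar α).V × (M.polar α).V)

theorem exists_gradedModelMk (z : (gradedModel hD hd).V) :
    ∃ x w, z = gradedModelMk hD hd x w :=
  ⟨_, _, rfl⟩

theorem gradedModelMk_mem {n : ℤ} {x w : ℂ × ℕ →₀ M.V} :
    gradedModelMk hD hd x w ∈ (gradedModel hD hd).deg n ↔
      (∀ p, x p ∈ M.deg n) ∧ ∀ p, w p ∈ M.deg (n - 1) := by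
  change (∀ p, x p ∈ M.deg (n + -1 + 1)) ∧ (∀ p, w p ∈ M.deg (n + -1)) ↔ _
  rw [neg_add_cancel_right, sub_eq_add_neg]

theorem gradedModelMk_inj {x w x' w' : ℂ × ℕ →₀ M.V} :
    gradedModelMk hD hd x w = gradedModelMk hD hd x' w' ↔ x = x' ∧ w = w' :=
  Prod.mk_inj

theorem linearPart_gradedModelMk (x w : ℂ × ℕ →₀ M.V) :
    linearPart (gradedModelProj hD hd).1 (gradedModelMk hD hd x w) = poleRes M.V x :=
  linearPart_gradedModelProj hD hd _

theorem mu1_gradedModelMk {n : ℤ} {x : ℂ × ℕ →₀ M.V} (hx : ∀ p, x p ∈ M.deg n)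
    (w : ℂ × ℕ →₀ M.V) :
    (gradedModel hD hd).mu1 (gradedModelMk hD hd x w)
      = gradedModelMk hD hd (Finsupp.mapRange.linearMap M.mu1 x)
        (Finsupp.mapRange.linearMap M.mu1 w + (-1 : ℂ) ^ n • poleOp (-linearPart D) x) := by
  have hx' : (show (M.polar α).V from x) ∈ (M.polar α).deg n := hx
  refine (gradedModel_mu1 hD hd _).trans (Prod.ext (polar_mu1 x) ?_)
  refine congrArg₂ (fun a b : (M.polar α).V => a + b) (polar_mu1 w) ?_
  refine (congrArg (linearPart (theta α D)) ((M.polar α).sgn_apply hx')).trans ?_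
  rw [map_smul]
  exact congrArg (fun a : (M.polar α).V => (-1 : ℂ) ^ n • a) (linearPart_theta x)

/-- The graded model maps quasi-isomorphically to `M` if the cohomology of `M` is
finite-dimensional in each degree. -/
theorem gradedModelProj_isQuasiIso (hfin : ∀ n, FiniteDimensional ℂ (M.H n)) :
    IsQuasiIso (gradedModelProj hD hd) := by
  have hT : ∀ n, ∀ v ∈ M.deg n, (-linearPart D) v ∈ M.deg n := fun n v hv =>
    neg_mem (linearPart_connection_mem hD hv)
  have hc : ∀ v, (-linearPart D) (M.mu1 v) = M.mu1 ((-linearPart D) v) := fun v => by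
    rw [LinearMap.neg_apply, LinearMap.neg_apply, linearPart_connection_mu1 hd, map_neg]
  have hmu : ∀ {x : ℂ × ℕ →₀ M.V} {n : ℤ}, (∀ p, x p ∈ M.deg n) →
      Finsupp.mapRange.linearMap M.mu1 x = 0 → ∀ p, x p ∈ M.deg n ⊓ LinearMap.ker M.mu1 :=
    fun hx e p => ⟨hx p, DFunLike.congr_fun e p⟩
  have hmu' : ∀ {x : ℂ × ℕ →₀ M.V} {n : ℤ}, (∀ p, x p ∈ M.deg n ⊓ LinearMap.ker M.mu1) →
      Finsupp.mapRange.linearMap M.mu1 x = 0 := fun hx => Finsupp.ext fun p => (hx p).2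
  have hsq : ∀ n : ℤ, (-1 : ℂ) ^ n * (-1 : ℂ) ^ n = 1 := fun n => by
    rw [← mul_zpow]; simp
  rw [isQuasiIso_iff]
  constructor
  · intro n z hz hz' y hy e
    obtain ⟨x, w, rfl⟩ := exists_gradedModelMk hD hd z
    rw [gradedModelMk_mem] at hz
    have h0 : (0 : (gradedModel hD hd).V) = gradedModelMk hD hd 0 0 := rfl
    rw [mu1_gradedModelMk hD hd hz.1, h0, gradedModelMk_inj] at hz'
    rw [linearPart_gradedModelMk] at e
    obtain ⟨x', hx', rfl⟩ := exact_of_poleOp_of_poleRes (T := -linearPart D) hT hc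
      (hmu hz.1 hz'.1) (w := (-(-1 : ℂ) ^ n) • w) (fun p => Submodule.smul_mem _ _ (hz.2 p))
      (by rw [map_smul, eq_neg_of_add_eq_zero_left hz'.2, neg_smul, smul_neg, neg_neg, smul_smul,
        hsq, one_smul]) hy e
    -- Subtracting the differential of `x'` leaves an element of the second summand.
    have hw' : ∀ p, (w - (-1 : ℂ) ^ (n - 1) • poleOp (-linearPart D) x') p
        ∈ M.deg (n - 1) ⊓ LinearMap.ker M.mu1 := by
      have hmem : ∀ p, poleOp (-linearPart D) x' p ∈ M.deg (n - 1) := by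
        rintro ⟨c, k⟩
        rw [poleOp_apply]
        refine sub_mem (hx' _) (sub_mem (hT _ _ (hx' _)) (Submodule.smul_mem _ _ (hx' _)))
      refine hmu (fun p => sub_mem (hz.2 p) (Submodule.smul_mem _ _ (hmem p))) ?_
      rw [map_sub, map_smul, poleOp_map (g := M.mu1) fun v => (hc v).symm, eq_neg_of_add_eq_zero_left hz'.2,
        zpow_sub_one₀ (by norm_num)]
      simp
    obtain ⟨s, hs, v, hv, e⟩ := exists_poleOp_sub_exact (T := -linearPart D) hT hc hw'
    refine ⟨gradedModelMk hD hd (x' + (-1 : ℂ) ^ (n - 1) • s) (-v), ?_, ?_⟩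
    · rw [gradedModelMk_mem]
      exact ⟨fun p => add_mem (hx' p) (Submodule.smul_mem _ _ (hs p).1), fun p => neg_mem (hv p)⟩
    · rw [mu1_gradedModelMk hD hd fun p => add_mem (hx' p) (Submodule.smul_mem _ _ (hs p).1),
        gradedModelMk_inj]
      constructor
      · rw [map_add, map_smul, hmu' hs, smul_zero, add_zero]
      · rw [map_neg, e, map_add, map_smul, smul_add, smul_smul, hsq, one_smul]
        abel
  · intro n y hy hy'
    obtain ⟨x, hx, ⟨w, hw, e⟩, v, hv, e'⟩ := exists_polar_lift (T := -linearPart D) hT hc hy hy'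
    refine ⟨gradedModelMk hD hd x (-((-1 : ℂ) ^ n • w)), ?_, ?_, v, hv, ?_⟩
    · rw [gradedModelMk_mem]
      exact ⟨fun p => (hx p).1, fun p => neg_mem (Submodule.smul_mem _ _ (hw p))⟩
    · rw [mu1_gradedModelMk hD hd fun p => (hx p).1, hmu' hx, map_neg, map_smul, e,
        neg_add_cancel]
      rfl
    · rw [linearPart_gradedModelMk, e']

end

end AInfModule

end AInf

namespace AInf

/-! ### Finite-dimensionality of the cohomology of perfect modules -/

section

variable {V W : Type*} [AddCommGroup V] [Module ℂ V] [AddCommGroup W] [Module ℂ W]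
  {F : ℤ → Submodule ℂ V} {F' : ℤ → Submodule ℂ W} {D : V →ₗ[ℂ] V} {D' : W →ₗ[ℂ] W} {n n' : ℤ}

/-- The map on cohomology induced by a linear map, with a possible change of degree. -/
def cohMap (L : V →ₗ[ℂ] W) (h : ∀ v ∈ F n, D v = 0 → L v ∈ F' n' ∧ D' (L v) = 0)
    (h' : ∀ v ∈ F (n - 1), ∃ w ∈ F' (n' - 1), D' w = L (D v)) : Coh F D n →ₗ[ℂ] Coh F' D' n' :=
  Submodule.mapQ _ _
    (L.restrict (p := F n ⊓ LinearMap.ker D) (q := F' n' ⊓ LinearMap.ker D')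
      fun v hv => h v hv.1 hv.2) (by
    rintro ⟨m, hm⟩ ⟨x, hx, rfl⟩
    exact h' x hx)

theorem finiteDimensional_of_ker_le_range {H H' H'' : Type*} [AddCommGroup H] [Module ℂ H]
    [AddCommGroup H'] [Module ℂ H'] [AddCommGroup H''] [Module ℂ H''] [FiniteDimensional ℂ H']
    [FiniteDimensional ℂ H''] (a : H →ₗ[ℂ] H'') (b : H' →ₗ[ℂ] H)
    (h : LinearMap.ker a ≤ LinearMap.range b) : FiniteDimensional ℂ H := by
  have h1 : FiniteDimensional ℂ (LinearMap.ker a) := Submodule.finiteDimensional_of_le h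
  refine ⟨Submodule.fg_of_fg_map_of_fg_inf_ker a (IsNoetherian.noetherian _) ?_⟩
  rw [top_inf_eq]
  exact (Submodule.fg_iff_finiteDimensional _).2 h1

end

variable {A : AInfAlgebra.{u}}

namespace AInfModule

theorem free_mu1 : (free A).mu1 = A.mu1 := by
  ext m
  refine congrArg (A.mu 1) (funext fun k => ?_)
  fin_cases k
  rfl

theorem finiteDimensional_H_shift {M : AInfModule A} (h : ∀ n, FiniteDimensional ℂ (M.H n))
    (k n : ℤ) : FiniteDimensional ℂ ((M.shift k).H n) := by
  have h := h (n + k)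
  change FiniteDimensional ℂ (↥(M.deg (n + k) ⊓ LinearMap.ker M.mu1) ⧸
    ((M.deg (n - 1 + k)).map M.mu1).submoduleOf (M.deg (n + k) ⊓ LinearMap.ker M.mu1))
  rwa [show n - 1 + k = n + k - 1 by ring]

/-- The exact sequence `H^n(N) → H^n(cone f) → H^{n+1}(M)`. -/
theorem finiteDimensional_H_cone {M N : AInfModule A} (f : Closed M N)
    (hM : ∀ n, FiniteDimensional ℂ (M.H n)) (hN : ∀ n, FiniteDimensional ℂ (N.H n)) (n : ℤ) :
    FiniteDimensional ℂ ((cone f).H n) := by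
  have hM := hM (n + 1)
  have hN := hN n
  let a : (cone f).H n →ₗ[ℂ] M.H (n + 1) := cohMap (LinearMap.fst ℂ M.V N.V)
    (fun z hz hz' => ⟨hz.1, congrArg Prod.fst ((cone_mu1 f z).symm.trans hz')⟩)
    (fun z hz => ⟨z.1, by
      have h1 : z.1 ∈ M.deg (n - 1 + 1) := hz.1
      rwa [sub_add_cancel, ← add_sub_cancel_right n 1] at h1,
        (congrArg Prod.fst (cone_mu1 f z)).symm⟩)
  let b : N.H n →ₗ[ℂ] (cone f).H n := cohMap (LinearMap.inr ℂ M.V N.V)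
    (fun y hy hy' => ⟨⟨zero_mem _, hy⟩, (cone_mu1 f ((0, y) : M.V × N.V)).trans
      (Prod.ext (map_zero _) (by simp [hy']; rfl))⟩)
    (fun y hy => ⟨((0, y) : M.V × N.V), ⟨zero_mem _, hy⟩, by
      rw [cone_mu1]
      exact Prod.ext (map_zero _) (by simp; rfl)⟩)
  refine finiteDimensional_of_ker_le_range a b fun c hc => ?_
  induction c using Submodule.Quotient.induction_on with
  | H z =>
    obtain ⟨⟨x, y⟩, hz, hz'⟩ := z
    obtain ⟨x', hx', e⟩ := (Submodule.Quotient.mk_eq_zero _).1 hc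
    have e : M.mu1 x' = x := e
    have hx'' : x' ∈ M.deg n := by rwa [SetLike.mem_coe, add_sub_cancel_right] at hx'
    have hz' : (cone f).mu1 ((x, y) : M.V × N.V) = 0 := hz'
    rw [cone_mu1] at hz'
    have hy : N.mu1 y + linearPart f.1 (M.sgn x) = 0 := congrArg Prod.snd hz'
    refine ⟨Submodule.Quotient.mk ⟨y - linearPart f.1 (M.sgn x'),
      sub_mem hz.2 (linearPart_mem f (M.sgn_mem hx'')), ?_⟩, ?_⟩
    · change N.mu1 _ = 0
      rw [map_sub, ← linearPart_mu1, ← neg_neg (M.mu1 (M.sgn x')), ← sgn_mu1, e, map_neg,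
        sub_neg_eq_add, hy]
    · refine ((Submodule.Quotient.eq _).2 ⟨((-x', 0) : M.V × N.V),
        ⟨neg_mem (show x' ∈ M.deg (n - 1 + 1) by rwa [sub_add_cancel]), zero_mem _⟩, ?_⟩)
      rw [cone_mu1]
      refine Prod.ext ?_ ?_
      · change M.mu1 (-x') = 0 - x
        rw [map_neg, e, zero_sub]
      · change N.mu1 0 + linearPart f.1 (M.sgn (-x')) = y - linearPart f.1 (M.sgn x') - y
        simp

theorem IsTwisted.finiteDimensional_H (hfin : ∀ n, FiniteDimensional ℂ (A.H n))
    {P : AInfModule A} (hP : IsTwisted P) (n : ℤ) : FiniteDimensional ℂ (P.H n) := by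
  induction hP generalizing n with
  | free =>
    have h := hfin n
    change FiniteDimensional ℂ (Coh A.deg (AInfModule.free A).mu1 n)
    rwa [free_mu1]
  | shift M k _ ih => exact finiteDimensional_H_shift ih k n
  | cone M N f _ _ ihM ihN => exact finiteDimensional_H_cone f ihM ihN n

/-- The cohomology of a perfect module is a direct summand of that of a twisted module. -/
theorem IsPerfect.finiteDimensional_H (hfin : ∀ n, FiniteDimensional ℂ (A.H n))
    {M : AInfModule A} (hM : M.IsPerfect) (n : ℤ) : FiniteDimensional ℂ (M.H n) := by
  obtain ⟨P, hP, i, p, η, hη, e⟩ := hM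
  have := hP.finiteDimensional_H hfin n
  refine FiniteDimensional.of_injective (mapH i n) ?_
  rw [injective_iff_map_eq_zero]
  intro c hc
  induction c using Submodule.Quotient.induction_on with
  | H z =>
    obtain ⟨x, hx, hx'⟩ := z
    have hx' : M.mu1 x = 0 := hx'
    obtain ⟨y, hy, ey⟩ := (Submodule.Quotient.mk_eq_zero _).1 hc
    have ey : P.mu1 y = linearPart i.1 x := ey
    have h1 := congrArg (fun φ : PreHom M M => ev φ x []) e
    have h2 : ev (comp p.1 i.1) x [] = -M.mu1 (linearPart p.1 (P.sgn y)) := by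
      have : ev (comp p.1 i.1) x [] = linearPart p.1 (P.sgn (linearPart i.1 x)) := by
        refine Eq.trans ?_ (linearPart_apply p.1 _).symm
        rw [P.sgn_sgn, linearPart_apply]
        refine (Finset.sum_range_one fun k => p.1 k (i.1 (0 - k) (M.sgn x)
          (block k (0 - k) (mapHigh A.rsgn k (pad (block 0 0 (toSeq []))))))
          (block 0 k (pad (block 0 0 (toSeq []))))).trans ?_
        exact congrArg₂ (fun v a => p.1 0 (i.1 0 (M.sgn x) v) a) (Subsingleton.elim _ _)
          (Subsingleton.elim _ _)
      rw [this, ← ey, sgn_mu1, map_neg, linearPart_mu1]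
    have h3 : ev M.idHom x [] = M.sgn x := rfl
    have hη' := mem_hom_iff.1 hη (M.sgn x) n [] 0 (M.sgn_mem hx) .nil
    rw [ev_sub_fam, h2, h3, ev_diff] at h1
    simp only [splitSum_nil, AInfAlgebra.sg_nil, ev_mu_nil, A.op_nil, ev_zero_mid, add_zero] at h1
    have h4 : M.mu1 (M.sgn x) = 0 := by rw [← neg_neg (M.mu1 _), ← sgn_mu1, hx', map_zero, neg_zero]
    rw [h4, ev_zero_left, add_zero] at h1
    refine (Submodule.Quotient.mk_eq_zero _).2 ?_
    have h5 : x = (-1 : ℂ) ^ n • M.sgn x := by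
      rw [M.sgn_apply hx, smul_smul, ← mul_zpow]; simp
    refine ⟨(-1 : ℂ) ^ n • (-ev η (M.sgn x) [] - linearPart p.1 (P.sgn y)), ?_, ?_⟩
    · refine Submodule.smul_mem _ _ (sub_mem (neg_mem ?_) (linearPart_mem p (P.sgn_mem hy)))
      rwa [add_zero] at hη'
    · refine Eq.trans ?_ h5.symm
      rw [map_smul, map_sub, map_neg, h1]
      congr 1
      abel

end AInfModule

end AInf

open AInf in
theorem mainTheorem6 (A : AInfAlgebra.{u}) (α : A.Action)
    (hfin : ∀ n, FiniteDimensional ℂ (A.H n))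
    (hbdd : ∃ n₀ : ℤ, ∀ n < n₀, Subsingleton (A.H n))
    (M : AInfModule A) (hunit : M.StrictlyUnital)
    (hperf : M.IsPerfect) (hrs : M.IsRigidSimple) :
    ∃ M' : AInfModule A, M'.StrictlyUnital ∧
      (∃ f : AInfModule.Closed M M', AInfModule.IsQuasiIso f) ∧
      Nonempty (M'.NaiveAction α) := by
  obtain ⟨D, hD, hr, hd⟩ := AInfModule.exists_connection α hunit hrs.rigid
  exact ⟨AInfModule.gradedModel hD hd, AInfModule.gradedModel_strictlyUnital hD hd hunit hr,
    AInfModule.exists_inverse_quasiIso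
      (AInfModule.gradedModelProj_isQuasiIso hD hd (hperf.finiteDimensional_H hfin)),
    ⟨AInfModule.gradedModelAction hD hd⟩⟩
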